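/- Let $d\ge 3$ and let $v:\mathbb R^d\to\mathbb R$ be bounded and Borel measurable with bounded support. For $z\in\mathbb R^d$ let $(W_z(s))_{s\ge0}$ be a $d$-dimensional Brownian motion with $W_z(0)=z$, and let $Y_z=\int_0^\infty v(W_z(s))\,ds$, which converges absolutely almost surely. Let $x(t),y(t)\in\mathbb R^d$ for $t>0$, and let $Z(t)=\int_0^t v(X_s)\,ds$, where $(X_s)_{0\le s\le t}$ is a $d$-dimensional Brownian bridge running for time $t$ with $X_0=x(t)$ and $X_t=y(t)$. Suppose that, as $t\to\infty$, $x(t)\to x\in\mathbb R^d$ and $|y(t)|\to\infty$, while $|y(t)|^2/t$ remains bounded. Then, as $t\to\infty$, every moment of $Z(t)$ converges to the corresponding moment of $Y_x$ (all these moments being finite): $E[Z(t)^k]\to E[Y_x^k]$ for every integer $k\ge0$. Moreover there is $\alpha_0>0$ such that $E\exp\{\alpha\int_0^\infty|v(W_z(s))|\,ds\}<\infty$ for all $z\in\mathbb R^d$ and $|\alpha|<\alpha_0$, and for every such $\alpha_0$ $$E e^{\alpha Z(t)}\to E e^{\alpha Y_x}<\infty\qquad\text{for all }\alpha\in(-\alpha_0,\alpha_0).$$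 If $v$ is nonnegative, the same convergence, with finite limit, holds for all $\alpha\in(-\infty,\alpha_1)$, for any real $\alpha_1$ such that $E e^{\alpha Y_z}<\infty$ for all $\alpha<\alpha_1$ and all $z\in\mathbb R^d$; in particular, if $v$ is also not almost everywhere zero, for the critical value $\alpha_1\in(0,\infty)$ for which $E e^{\alpha Y_z}$ is finite for all $z$ when $\alpha<\alpha_1$ and infinite for all $z$ when $\alpha>\alpha_1$. -/

import Mathlib

open MeasureTheory ProbabilityTheory Filter Topology
open scoped NNReal ENNReal

noncomputable section

namespace BridgeIntegral

variable {Ω : Type*} [MeasurableSpace Ω] {d : ℕ}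

/-- The transition density `q(t; z) = (2πt)^(-d/2) exp(-|z|²/(2t))` of Brownian motion
in `ℝ^d`, for `t > 0`. -/
def heatKernel (t : ℝ) (z : EuclideanSpace ℝ (Fin d)) : ℝ :=
  (2 * Real.pi * t) ^ (-(d : ℝ) / 2) * Real.exp (-‖z‖ ^ 2 / (2 * t))

/-- `W` is a Brownian motion (Wiener process) in `ℝ^d` started at `x`: it starts at `x`, has
independent increments, the increment over `[s, u]` is centred Gaussian with covariance
`(u - s) I`, and almost every path is continuous. -/
structure IsBrownianMotion (W : ℝ≥0 → Ω → EuclideanSpace ℝ (Fin d))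
    (x : EuclideanSpace ℝ (Fin d)) (P : Measure Ω) : Prop where
  start : ∀ᵐ ω ∂P, W 0 ω = x
  indep : HasIndepIncrements W P
  increment : ∀ s u : ℝ≥0, s < u →
    HasLaw (fun ω ↦ W u ω - W s ω)
      ((volume : Measure (EuclideanSpace ℝ (Fin d))).withDensity
        (fun z ↦ ENNReal.ofReal (heatKernel ((u : ℝ) - (s : ℝ)) z))) P
  cont : ∀ᵐ ω ∂P, Continuous (fun s ↦ W s ω)

/-- The joint density at `z = (z₁, …, z_k)` of the positions at times `s₁ < ⋯ < s_k` in `(0, t)` of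
Brownian motion from `x` conditioned to be at `y` at time `t`: with `s₀ = 0`, `z₀ = x`,
`s_{k+1} = t`, `z_{k+1} = y` it is
`(∏_{j=0}^{k} q(s_{j+1} - s_j; z_{j+1} - z_j)) / q(t; y - x)`. -/
def bridgeDensity (x y : EuclideanSpace ℝ (Fin d)) (t : ℝ) {k : ℕ} (s : Fin k → ℝ)
    (z : Fin k → EuclideanSpace ℝ (Fin d)) : ℝ :=
  let σ : Fin (k + 2) → ℝ :=
    Fin.cons (α := fun _ ↦ ℝ) 0 (Fin.snoc (α := fun _ ↦ ℝ) s t)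
  let ζ : Fin (k + 2) → EuclideanSpace ℝ (Fin d) :=
    Fin.cons (α := fun _ ↦ EuclideanSpace ℝ (Fin d)) x
      (Fin.snoc (α := fun _ ↦ EuclideanSpace ℝ (Fin d)) z y)
  (∏ j : Fin (k + 1), heatKernel (σ j.succ - σ j.castSucc) (ζ j.succ - ζ j.castSucc)) /
    heatKernel t (y - x)

/-- `(X_s, 0 ≤ s ≤ t)` is a Brownian bridge in `ℝ^d` from `x` to `y` running for time `t`.
Values `X s` with `s > t` are irrelevant. -/
structure IsBrownianBridge (X : ℝ≥0 → Ω → EuclideanSpace ℝ (Fin d))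
    (x y : EuclideanSpace ℝ (Fin d)) (t : ℝ≥0) (P : Measure Ω) : Prop where
  start : ∀ᵐ ω ∂P, X 0 ω = x
  finish : ∀ᵐ ω ∂P, X t ω = y
  law : ∀ (k : ℕ) (s : Fin k → ℝ≥0), StrictMono s → (∀ i, 0 < s i ∧ s i < t) →
    HasLaw (fun ω i ↦ X (s i) ω)
      ((volume : Measure (Fin k → EuclideanSpace ℝ (Fin d))).withDensity
        (fun z ↦ ENNReal.ofReal (bridgeDensity x y t (fun i ↦ (s i : ℝ)) z))) P
  cont : ∀ᵐ ω ∂P, ContinuousOn (fun s ↦ X s ω) (Set.Icc 0 t)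

/-- The path integral `∫₀ᵗ v(X_s) ds`. -/
def pathIntegral (v : EuclideanSpace ℝ (Fin d) → ℝ) (X : ℝ≥0 → Ω → EuclideanSpace ℝ (Fin d))
    (t : ℝ≥0) (ω : Ω) : ℝ :=
  ∫ s in (0 : ℝ)..(t : ℝ), v (X s.toNNReal ω)

/-- The path integral over all times, `∫₀^∞ v(X_s) ds`. -/
def totalPathIntegral (v : EuclideanSpace ℝ (Fin d) → ℝ)
    (X : ℝ≥0 → Ω → EuclideanSpace ℝ (Fin d)) (ω : Ω) : ℝ :=
  ∫ s in Set.Ioi (0 : ℝ), v (X s.toNNReal ω)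

/-- For `|α| < α₀`, `E exp(α ∫₀^∞ |v(W_z(s))| ds) < ∞` for every starting point `z`. -/
def AbsExpFinite (v : EuclideanSpace ℝ (Fin d) → ℝ)
    (W : EuclideanSpace ℝ (Fin d) → ℝ≥0 → Ω → EuclideanSpace ℝ (Fin d)) (Q : Measure Ω)
    (α₀ : ℝ) : Prop :=
  ∀ α : ℝ, |α| < α₀ → ∀ z,
    Integrable (fun ω ↦ Real.exp (α * totalPathIntegral (fun w ↦ |v w|) (W z) ω)) Q

/-- For `α < α₁`, `E exp(α ∫₀^∞ v(W_z(s)) ds) < ∞` for every starting point `z`. -/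
def ExpFiniteBelow (v : EuclideanSpace ℝ (Fin d) → ℝ)
    (W : EuclideanSpace ℝ (Fin d) → ℝ≥0 → Ω → EuclideanSpace ℝ (Fin d)) (Q : Measure Ω)
    (α₁ : ℝ) : Prop :=
  ∀ α : ℝ, α < α₁ → ∀ z,
    Integrable (fun ω ↦ Real.exp (α * totalPathIntegral v (W z) ω)) Q

end BridgeIntegral

end

/-! Expanding the `k`-th power of a time integral over ordered times shows that its expectation
divided by `k!` is an iterated integral of heat kernels against the integrand. For Brownian motion
and a nonnegative integrand `g` this is the `k`-th power of the Green operator `f ↦ ∫₀^∞ P_r (g f)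
dr` applied to `1` (`greenPow`), so the exponential moment of order `β` is the series `∑ β^k
greenPow g k`. For the bridge the same iterated integral carries the terminal weight `q(t - s; y -
z) / q(t; y - x)`.

On a fixed window `[0, T]` this weight is bounded and tends to `1`, because `|y|²/t` stays bounded
(`tendsto_hk_div`); hence moments over the window converge (`tendsto_window_pow`). The rest of the
integral is small in `L¹` (`HasBridgeMoments.lintegral_tail_le`). Up to time `t/2` the weight is
bounded and `∫_T^∞ r^(-d/2) dr` is small. After `t/2`, read backwards from the far end, one finds
the Green potential of `|v|` at `y(t)`, which vanishes at infinity (`tendsto_greenPow_one`).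

Passing from `L¹` to powers and exponentials needs exponential moments of `∫₀ᵗ |v(X_s)| ds` bounded
for large `t`, of every order below one that is finite for Brownian motion
(`HasBridgeMoments.lintegral_exp_le`). Cut `[0, t]` into `n` equal pieces; some piece carries at
most `1/n` of the integral and is discarded. Across a gap of length `t/n` the kernel, relative to
`q(t; y - x)`, is at most `n^(d/2) exp(|y - x|²/(2t))`, so the past and the reversed future are
dominated by independent Brownian motions from `x` and `y`. The loss `1 - 1/n` in the exponent is
harmless since `n` is arbitrary. As `y(t)` escapes to infinity, the Brownian exponential moments
must be bounded uniformly in the starting point; `exists_tsum_greenPow_le` derives this from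
finiteness at one point.

Moment generating functions then converge termwise in their power series. For nonnegative `v` and `α
≤ 0` no exponential bound is needed: `exp(α ·)` is bounded and Lipschitz on the half-line, so the
`L¹` estimate suffices. -/

namespace BridgeIntegral

noncomputable section

/-! ### The Gaussian heat kernel: bounds, symmetry, total mass. -/

section HeatKernel

variable {d : ℕ}

local notation "𝔼" => EuclideanSpace ℝ (Fin d)

lemma measurable_heatKernel : Measurable (fun p : ℝ × 𝔼 ↦ heatKernel p.1 p.2) := by
  unfold heatKernel
  fun_prop

lemma heatKernel_nonneg {t : ℝ} (ht : 0 ≤ t) (z : 𝔼) : 0 ≤ heatKernel t z := by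
  unfold heatKernel; positivity

lemma heatKernel_pos {t : ℝ} (ht : 0 < t) (z : 𝔼) : 0 < heatKernel t z := by
  unfold heatKernel; positivity

lemma heatKernel_neg (t : ℝ) (z : 𝔼) : heatKernel t (-z) = heatKernel t z := by
  simp [heatKernel]

lemma heatKernel_sub_comm (t : ℝ) (z w : 𝔼) : heatKernel t (z - w) = heatKernel t (w - z) := by
  rw [← heatKernel_neg, neg_sub]

lemma heatKernel_le {τ t : ℝ} (hτ : 0 < τ) (h : τ ≤ t) (z : 𝔼) :
    heatKernel t z ≤ (2 * Real.pi * τ) ^ (-(d : ℝ) / 2) := by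
  have ht : 0 < t := hτ.trans_le h
  unfold heatKernel
  have h1 : (2 * Real.pi * t) ^ (-(d : ℝ) / 2) ≤ (2 * Real.pi * τ) ^ (-(d : ℝ) / 2) := by
    apply Real.rpow_le_rpow_of_nonpos (by positivity) (by gcongr)
    have : (0 : ℝ) ≤ d := by positivity
    linarith
  have h2 : Real.exp (-‖z‖ ^ 2 / (2 * t)) ≤ 1 := by
    rw [Real.exp_le_one_iff]
    have : 0 ≤ ‖z‖ ^ 2 / (2 * t) := by positivity
    rw [neg_div]; linarith
  calc _ ≤ (2 * Real.pi * τ) ^ (-(d : ℝ) / 2) * 1 := by gcongr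
    _ = _ := mul_one _

lemma integral_heatKernel {t : ℝ} (ht : 0 < t) :
    Integrable (fun z : 𝔼 ↦ heatKernel t z) ∧ ∫ z : 𝔼, heatKernel t z = 1 := by
  have hb : 0 < 1 / (2 * t) := by positivity
  have h := GaussianFourier.integral_rexp_neg_mul_sq_norm (V := 𝔼) hb
  have e : ∀ z : 𝔼, heatKernel t z
      = (2 * Real.pi * t) ^ (-(d : ℝ) / 2) * Real.exp (-(1 / (2 * t)) * ‖z‖ ^ 2) := by
    intro z; unfold heatKernel; congr 2; ring
  have hv : ∫ z : 𝔼, heatKernel t z = 1 := by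
    simp_rw [e]
    rw [integral_const_mul, h, finrank_euclideanSpace_fin]
    have : Real.pi / (1 / (2 * t)) = 2 * Real.pi * t := by field_simp
    rw [this, neg_div, Real.rpow_neg (by positivity)]
    exact inv_mul_cancel₀ (by positivity)
  refine ⟨?_, hv⟩
  -- A non-integrable function has Bochner integral `0`, so the value `1` already proves
  -- integrability.
  by_contra hc
  rw [integral_undef hc] at hv
  exact zero_ne_one hv

/-- The heat kernel with values in `ℝ≥0∞`. -/
def hk (t : ℝ) (z : 𝔼) : ℝ≥0∞ := ENNReal.ofReal (heatKernel t z)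

lemma measurable_hk : Measurable (fun p : ℝ × 𝔼 ↦ hk p.1 p.2) :=
  measurable_heatKernel.ennreal_ofReal

@[fun_prop]
lemma measurable_hk_comp {α : Type*} [MeasurableSpace α] {f : α → ℝ} {k : α → 𝔼} (hf : Measurable f)
    (hk' : Measurable k) : Measurable (fun a ↦ BridgeIntegral.hk (f a) (k a)) :=
  measurable_hk.comp (hf.prodMk hk')

lemma hk_sub_comm (t : ℝ) (z w : 𝔼) : hk t (z - w) = hk t (w - z) := by
  rw [hk, heatKernel_sub_comm, hk]

lemma hk_pos {t : ℝ} (ht : 0 < t) (z : 𝔼) : hk t z ≠ 0 := by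
  simp [hk, heatKernel_pos ht z]

lemma hk_ne_top (t : ℝ) (z : 𝔼) : hk t z ≠ ⊤ := ENNReal.ofReal_ne_top

lemma hk_le {τ t : ℝ} (hτ : 0 < τ) (h : τ ≤ t) (z : 𝔼) :
    hk t z ≤ ENNReal.ofReal ((2 * Real.pi * τ) ^ (-(d : ℝ) / 2)) :=
  ENNReal.ofReal_le_ofReal (heatKernel_le hτ h z)

lemma lintegral_hk {t : ℝ} (ht : 0 < t) : ∫⁻ z : 𝔼, hk t z = 1 := by
  unfold hk
  rw [← ofReal_integral_eq_lintegral_ofReal (integral_heatKernel ht).1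
    (ae_of_all _ fun z ↦ heatKernel_nonneg ht.le z), (integral_heatKernel ht).2]
  simp

lemma lintegral_hk_sub {t : ℝ} (ht : 0 < t) (x : 𝔼) : ∫⁻ z : 𝔼, hk t (z - x) = 1 := by
  rw [lintegral_sub_right_eq_self (fun z ↦ hk t z) x, lintegral_hk ht]

end HeatKernel

/-! ### Iterated heat-kernel integrals along a list of times. -/

section Chain

variable {d : ℕ}

local notation "𝔼" => EuclideanSpace ℝ (Fin d)

/-- The integral over `z₁, …, z_k` of `∏ q(s_j - s_{j-1}; z_j - z_{j-1}) g(z_j)` times `h(z_k)`,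
for `z₀ = x` and a list `s₁, …, s_k` of times. -/
def chain (g : 𝔼 → ℝ≥0∞) : ℝ → List ℝ → (𝔼 → ℝ≥0∞) → 𝔼 → ℝ≥0∞
  | _, [], h => h
  | s₀, s :: l, h => fun x ↦ ∫⁻ z, hk (s - s₀) (z - x) * (g z * chain g s l h z)

/-- The last element of the list `s₀ :: l`. -/
def lastTime : ℝ → List ℝ → ℝ
  | s₀, [] => s₀
  | _, s :: l => lastTime s l

@[simp] lemma lastTime_append_singleton (s₀ : ℝ) (l : List ℝ) (r : ℝ) :
    lastTime s₀ (l ++ [r]) = r := by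
  induction l generalizing s₀ with
  | nil => rfl
  | cons s l ih => exact ih s

lemma lastTime_append (s₀ : ℝ) (l₁ l₂ : List ℝ) :
    lastTime s₀ (l₁ ++ l₂) = lastTime (lastTime s₀ l₁) l₂ := by
  induction l₁ generalizing s₀ with
  | nil => rfl
  | cons s l ih => exact ih s

lemma lastTime_mem (s₀ : ℝ) (l : List ℝ) : lastTime s₀ l ∈ s₀ :: l := by
  induction l generalizing s₀ with
  | nil => simp [lastTime]
  | cons s l ih => exact List.mem_cons_of_mem _ (ih s)

lemma le_lastTime {s₀ : ℝ} {l : List ℝ} (h : (s₀ :: l).Pairwise (· < ·)) :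
    ∀ s ∈ s₀ :: l, s ≤ lastTime s₀ l := by
  induction l generalizing s₀ with
  | nil => simp [lastTime]
  | cons s l ih =>
    intro u hu
    have h2 := List.pairwise_cons.1 h
    rcases List.mem_cons.1 hu with rfl | hu
    · exact (h2.1 s (by simp)).le.trans (ih h2.2 s (by simp))
    · exact ih h2.2 u hu

lemma pairwise_append_singleton {s₀ : ℝ} {l : List ℝ} (h : (s₀ :: l).Pairwise (· < ·)) {r : ℝ}
    (hr : lastTime s₀ l < r) : (s₀ :: (l ++ [r])).Pairwise (· < ·) := by
  rw [← List.cons_append, List.pairwise_append]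
  refine ⟨h, by simp, fun a ha b hb ↦ ?_⟩
  rw [List.mem_singleton.1 hb]
  exact (le_lastTime h a ha).trans_lt hr

/-- The Markov property: what follows `l₁` matters only through a terminal function of the position
at the last time of `l₁`. -/
lemma chain_append (g : 𝔼 → ℝ≥0∞) (s₀ : ℝ) (l₁ l₂ : List ℝ) (h : 𝔼 → ℝ≥0∞) :
    chain g s₀ (l₁ ++ l₂) h = chain g s₀ l₁ (chain g (lastTime s₀ l₁) l₂ h) := by
  induction l₁ generalizing s₀ with
  | nil => rfl
  | cons s l ih => simp only [List.cons_append, chain, lastTime, ih]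

lemma measurable_chain {α : Type*} [MeasurableSpace α] {g : 𝔼 → ℝ≥0∞} (hg : Measurable g)
    (s₀ : ℝ) (l : List ℝ) {h : α → 𝔼 → ℝ≥0∞} (hh : Measurable (Function.uncurry h)) :
    Measurable (fun p : α × 𝔼 ↦ chain g s₀ l (h p.1) p.2) := by
  induction l generalizing s₀ with
  | nil => exact hh
  | cons s l ih =>
    simp only [chain]
    refine Measurable.lintegral_prod_right' (f := fun q : (α × 𝔼) × 𝔼 ↦
      hk (s - s₀) (q.2 - q.1.2) * (g q.2 * chain g s l (h q.1.1) q.2)) ?_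
    have := (ih s).comp (g := fun p : α × 𝔼 ↦ chain g s l (h p.1) p.2)
      (f := fun q : (α × 𝔼) × 𝔼 ↦ (q.1.1, q.2)) (by fun_prop)
    have h2 : Measurable (fun q : (α × 𝔼) × 𝔼 ↦ chain g s l (h q.1.1) q.2) := this
    fun_prop

lemma measurable_chain' {g : 𝔼 → ℝ≥0∞} (hg : Measurable g)
    (s₀ : ℝ) (l : List ℝ) {h : 𝔼 → ℝ≥0∞} (hh : Measurable h) :
    Measurable (chain g s₀ l h) :=
  (measurable_chain (α := Unit) hg s₀ l (h := fun _ ↦ h) (hh.comp measurable_snd)).comp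
    (g := fun p : Unit × 𝔼 ↦ chain g s₀ l h p.2) (f := fun x ↦ ((), x)) (by fun_prop)

lemma chain_mono {g g' : 𝔼 → ℝ≥0∞} (hg : ∀ z, g z ≤ g' z) (s₀ : ℝ) (l : List ℝ)
    {h h' : 𝔼 → ℝ≥0∞} (hh : ∀ z, h z ≤ h' z) (x : 𝔼) :
    chain g s₀ l h x ≤ chain g' s₀ l h' x := by
  induction l generalizing s₀ x with
  | nil => exact hh x
  | cons s l ih =>
    simp only [chain]
    gcongr with z
    · exact hg z
    · exact ih s z

lemma chain_const_mul (g : 𝔼 → ℝ≥0∞) (s₀ : ℝ) (l : List ℝ) (h : 𝔼 → ℝ≥0∞) {c : ℝ≥0∞}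
    (hc : c ≠ ⊤) (x : 𝔼) :
    chain g s₀ l (fun z ↦ c * h z) x = c * chain g s₀ l h x := by
  induction l generalizing s₀ x with
  | nil => rfl
  | cons s l ih =>
    simp only [chain]
    rw [← lintegral_const_mul' _ _ hc]
    congr with z
    rw [ih]; ring

/-- Each kernel has mass one, so every time costs one factor `K`. Used to know that a chain is a
finite constant that may be pulled through integrals. -/
lemma chain_le_pow {g : 𝔼 → ℝ≥0∞} {K : ℝ≥0∞} (hK : ∀ z, g z ≤ K) {s₀ : ℝ} {l : List ℝ}
    (hl : (s₀ :: l).Pairwise (· < ·)) (x : 𝔼) :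
    chain g s₀ l (fun _ ↦ 1) x ≤ K ^ l.length := by
  induction l generalizing s₀ x with
  | nil => simp [chain]
  | cons s l ih =>
    have h2 := List.pairwise_cons.1 hl
    have hs : 0 < s - s₀ := sub_pos.2 (h2.1 s (by simp))
    simp only [chain, List.length_cons]
    calc _ ≤ ∫⁻ z, hk (s - s₀) (z - x) * (K * K ^ l.length) := by
          gcongr with z
          · exact hK z
          · exact ih h2.2 z
      _ = K ^ (l.length + 1) := by
          rw [lintegral_mul_const _ (by fun_prop), lintegral_hk_sub hs, one_mul, pow_succ']

/-- Tonelli at every step. It lets the integration over later times act on the terminal function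
only. -/
lemma lintegral_chain {α : Type*} [MeasurableSpace α] {μ : Measure α} [SFinite μ]
    {g : 𝔼 → ℝ≥0∞} (hg : Measurable g) (s₀ : ℝ) (l : List ℝ) {h : α → 𝔼 → ℝ≥0∞}
    (hh : Measurable (Function.uncurry h)) (x : 𝔼) :
    ∫⁻ a, chain g s₀ l (h a) x ∂μ = chain g s₀ l (fun z ↦ ∫⁻ a, h a z ∂μ) x := by
  induction l generalizing s₀ x with
  | nil => rfl
  | cons s l ih =>
    simp only [chain]
    have hm := measurable_chain hg s l hh
    rw [lintegral_lintegral_swap]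
    · congr with z
      have hm' : Measurable fun a ↦ chain g s l (h a) z :=
        hm.comp (measurable_id.prodMk measurable_const)
      rw [lintegral_const_mul _ (by fun_prop), lintegral_const_mul _ hm', ih]
    · refine Measurable.aemeasurable ?_
      change Measurable fun p : α × 𝔼 ↦ hk (s - s₀) (p.2 - x) * (g p.2 * chain g s l (h p.1) p.2)
      fun_prop

end Chain

/-! ### Powers of time integrals as integrals over ordered times. -/

section Simplex

/-- For an atomless measure, the ordered part of a product of `k + 1` copies carries the fraction
`1 / (k + 1)` of what the remaining ordering leaves. -/
lemma succ_mul_lintegral_measure_Ioi_pow (k : ℕ) (ν : Measure ℝ) [SFinite ν] [NullSingletonClass ν] :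
    (k + 1 : ℝ≥0∞) * ∫⁻ r, ν (Set.Ioi r) ^ k ∂ν = ν Set.univ ^ (k + 1) := by
  induction k generalizing ν with
  | zero => simp
  | succ k ih =>
    have hM : Measurable fun r ↦ ν (Set.Ioi r) :=
      (Antitone.measurable fun a b hab ↦ measure_mono (Set.Ioi_subset_Ioi hab))
    -- The induction hypothesis is applied to the restriction of `ν` to `(r, ∞)`, which is why `ν`
    -- is generalized.
    have key : ∀ r, (k + 1 : ℝ≥0∞) * ∫⁻ u in Set.Ioi r, ν (Set.Ioi u) ^ k ∂ν
        = ν (Set.Ioi r) ^ (k + 1) := by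
      intro r
      have := ih (ν.restrict (Set.Ioi r))
      rw [Measure.restrict_apply_univ] at this
      rw [← this]
      congr 1
      refine setLIntegral_congr_fun measurableSet_Ioi fun u hu ↦ ?_
      rw [Measure.restrict_apply measurableSet_Ioi,
        Set.inter_eq_left.2 (Set.Ioi_subset_Ioi (le_of_lt hu))]
    have split : ∀ r, ∫⁻ u, ν (Set.Ioi u) ^ k ∂ν = ∫⁻ u in Set.Ioi r, ν (Set.Ioi u) ^ k ∂ν
        + ∫⁻ u, (Set.Ici u).indicator (fun _ ↦ ν (Set.Ioi u) ^ k) r ∂ν := by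
      intro r
      rw [← lintegral_add_compl _ (measurableSet_Ioi (a := r)), Set.compl_Ioi]
      congr 1
      rw [← lintegral_indicator measurableSet_Iic]
      congr with u
    calc ((k + 1 : ℕ) + 1 : ℝ≥0∞) * ∫⁻ r, ν (Set.Ioi r) ^ (k + 1) ∂ν
        = ∫⁻ r, ν (Set.Ioi r) ^ (k + 1) ∂ν
          + (k + 1) * ∫⁻ r, ν (Set.Ioi r) ^ (k + 1) ∂ν := by push_cast; ring
      _ = ∫⁻ r, (k + 1) * ∫⁻ u in Set.Ioi r, ν (Set.Ioi u) ^ k ∂ν ∂ν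
          + (k + 1) * ∫⁻ u, ∫⁻ r, (Set.Ici u).indicator (fun _ ↦ ν (Set.Ioi u) ^ k) r ∂ν ∂ν := by
        simp_rw [key]
        congr 2
        refine lintegral_congr fun u ↦ ?_
        -- Since `ν` has no atoms, integrating the indicator of `r ≥ u` in `r` supplies exactly one
        -- more power of the mass of `(u, ∞)`.
        rw [lintegral_indicator measurableSet_Ici, setLIntegral_const, pow_succ,
          measure_congr Ioi_ae_eq_Ici]
      _ = ∫⁻ r, (k + 1) * ∫⁻ u in Set.Ioi r, ν (Set.Ioi u) ^ k ∂ν ∂ν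
          + (k + 1) * ∫⁻ r, ∫⁻ u, (Set.Ici u).indicator (fun _ ↦ ν (Set.Ioi u) ^ k) r ∂ν ∂ν := by
        congr 2
        refine lintegral_lintegral_swap (Measurable.aemeasurable ?_)
        have : Function.uncurry (fun u r ↦ (Set.Ici u).indicator (fun _ ↦ ν (Set.Ioi u) ^ k) r)
            = {p : ℝ × ℝ | p.1 ≤ p.2}.indicator (fun p ↦ ν (Set.Ioi p.1) ^ k) := by
          ext p; simp [Set.indicator, Function.uncurry]
        rw [this]
        exact ((hM.comp measurable_fst).pow_const k).indicator
          (measurableSet_le measurable_fst measurable_snd)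
      _ = ∫⁻ r, (k + 1) * ∫⁻ u, ν (Set.Ioi u) ^ k ∂ν ∂ν := by
        have hm : Measurable fun r ↦ (k + 1 : ℝ≥0∞) * ∫⁻ u in Set.Ioi r, ν (Set.Ioi u) ^ k ∂ν := by
          simp_rw [key]; exact hM.pow_const _
        rw [← lintegral_const_mul' _ _ (by finiteness), ← lintegral_add_left hm]
        congr with r
        -- After the swap, the parts `u > r` and `u ≤ r` together fill the whole line.
        rw [← mul_add, ← split r]
      _ = ν Set.univ ^ (k + 1 + 1) := by
        rw [ih ν, lintegral_const, pow_succ (ν Set.univ) (k + 1)]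

/-- The integral of `f` over the part of `I` after time `s`. -/
def tailInt (I : Set ℝ) (f : ℝ → ℝ≥0∞) (s : ℝ) : ℝ≥0∞ := ∫⁻ r in I ∩ Set.Ioi s, f r

/-- The preceding identity for the measure `f dr` on `I ∩ (s, ∞)`, normalized by factorials so as to
be the induction step of `corrInt_lintegral`. -/
lemma lintegral_mul_tailInt_pow {I : Set ℝ} (hI : MeasurableSet I) {f : ℝ → ℝ≥0∞}
    (hf : Measurable f) (k : ℕ) (s : ℝ) :
    ∫⁻ r in I ∩ Set.Ioi s, f r * (tailInt I f r ^ k * ((k.factorial : ℝ≥0∞))⁻¹)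
      = tailInt I f s ^ (k + 1) * (((k + 1).factorial : ℕ) : ℝ≥0∞)⁻¹ := by
  set ν : Measure ℝ := (volume.restrict (I ∩ Set.Ioi s)).withDensity f with hν
  have : NullSingletonClass ν := inferInstance
  have h := succ_mul_lintegral_measure_Ioi_pow k ν
  have h1 : ν Set.univ = tailInt I f s := by
    rw [hν, withDensity_apply _ MeasurableSet.univ]; simp [tailInt]
  have h2 : ∀ r ∈ I ∩ Set.Ioi s, ν (Set.Ioi r) = tailInt I f r := by
    intro r hr
    rw [hν, withDensity_apply _ measurableSet_Ioi, Measure.restrict_restrict measurableSet_Ioi,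
      tailInt]
    congr 2
    ext u
    simp only [Set.mem_inter_iff, Set.mem_Ioi]
    exact ⟨fun h ↦ ⟨h.2.1, h.1⟩, fun h ↦ ⟨h.2, h.1, lt_trans hr.2 h.2⟩⟩
  have hM : Measurable fun r ↦ ν (Set.Ioi r) :=
      (Antitone.measurable fun a b hab ↦ measure_mono (Set.Ioi_subset_Ioi hab))
  have hIs : MeasurableSet (I ∩ Set.Ioi s) := hI.inter measurableSet_Ioi
  have h3 : ∫⁻ r, ν (Set.Ioi r) ^ k ∂ν = ∫⁻ r in I ∩ Set.Ioi s, f r * tailInt I f r ^ k := by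
    rw [hν, lintegral_withDensity_eq_lintegral_mul _ hf (by rw [← hν]; exact hM.pow_const k), ← hν]
    refine setLIntegral_congr_fun hIs fun r hr ↦ ?_
    simp only [Pi.mul_apply]
    rw [h2 r hr]
  rw [h3, h1] at h
  have hk : ((k.factorial : ℝ≥0∞))⁻¹ ≠ ⊤ := by simp [Nat.factorial_ne_zero]
  simp_rw [← mul_assoc]
  rw [lintegral_mul_const' _ _ hk, ← h, Nat.factorial_succ]
  push_cast
  rw [ENNReal.mul_inv (by simp) (by simp)]
  have : (k + 1 : ℝ≥0∞) * (k + 1 : ℝ≥0∞)⁻¹ = 1 := ENNReal.mul_inv_cancel (by simp) (by finiteness)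
  calc _ = ((k + 1 : ℝ≥0∞) * (k + 1 : ℝ≥0∞)⁻¹) *
        ((∫⁻ r in I ∩ Set.Ioi s, f r * tailInt I f r ^ k) * (k.factorial : ℝ≥0∞)⁻¹) := by
        rw [this, one_mul]
    _ = _ := by ring

/-- `Φ (l ++ [r₁, …, r_k])` integrated over `r₁ < ⋯ < r_k` in `I` after the last time of `l`. -/
def corrInt (I : Set ℝ) (Φ : List ℝ → ℝ≥0∞) : ℕ → List ℝ → ℝ≥0∞
  | 0, l => Φ l
  | k + 1, l => ∫⁻ r in I ∩ Set.Ioi (lastTime 0 l), corrInt I Φ k (l ++ [r])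

/-- Strictly increasing lists of positive times in `I`. -/
def IsTimes (I : Set ℝ) (l : List ℝ) : Prop := (0 :: l).Pairwise (· < ·) ∧ ∀ s ∈ l, s ∈ I

lemma IsTimes.nil (I : Set ℝ) : IsTimes I [] := by simp [IsTimes]

lemma IsTimes.append_singleton {I : Set ℝ} {l : List ℝ} (hl : IsTimes I l) {r : ℝ}
    (hr : r ∈ I ∩ Set.Ioi (lastTime 0 l)) : IsTimes I (l ++ [r]) := by
  refine ⟨pairwise_append_singleton hl.1 hr.2, fun s hs ↦ ?_⟩
  rcases List.mem_append.1 hs with h | h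
  · exact hl.2 s h
  · rw [List.mem_singleton.1 h]; exact hr.1

lemma corrInt_mono {I : Set ℝ} (hI : MeasurableSet I) {Φ Ψ : List ℝ → ℝ≥0∞}
    (h : ∀ l, IsTimes I l → Φ l ≤ Ψ l) (k : ℕ) {l : List ℝ} (hl : IsTimes I l) :
    corrInt I Φ k l ≤ corrInt I Ψ k l := by
  induction k generalizing l with
  | zero => exact h l hl
  | succ k ih =>
    exact setLIntegral_mono' (hI.inter measurableSet_Ioi) fun r hr ↦ ih (hl.append_singleton hr)

lemma corrInt_congr {I : Set ℝ} (hI : MeasurableSet I) {Φ Ψ : List ℝ → ℝ≥0∞}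
    (h : ∀ l, IsTimes I l → Φ l = Ψ l) (k : ℕ) {l : List ℝ} (hl : IsTimes I l) :
    corrInt I Φ k l = corrInt I Ψ k l :=
  le_antisymm (corrInt_mono hI (fun l hl ↦ (h l hl).le) k hl)
    (corrInt_mono hI (fun l hl ↦ (h l hl).ge) k hl)

lemma corrInt_const_mul (I : Set ℝ) (Φ : List ℝ → ℝ≥0∞) {c : ℝ≥0∞} (hc : c ≠ ⊤) (k : ℕ)
    (l : List ℝ) : corrInt I (fun l ↦ c * Φ l) k l = c * corrInt I Φ k l := by
  induction k generalizing l with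
  | zero => rfl
  | succ k ih => simp only [corrInt, ih]; rw [lintegral_const_mul' _ _ hc]

variable {d : ℕ}

local notation "𝔼" => EuclideanSpace ℝ (Fin d)

/-- The integral of `chain g s [r₁, …, r_k] (h r_k)` over `s < r₁ < ⋯ < r_k` in `I`. -/
def simplexInt (g : 𝔼 → ℝ≥0∞) (I : Set ℝ) (h : ℝ → 𝔼 → ℝ≥0∞) : ℕ → ℝ → 𝔼 → ℝ≥0∞
  | 0 => h
  | k + 1 => fun s x ↦
      ∫⁻ r in I ∩ Set.Ioi s, ∫⁻ z, hk (r - s) (z - x) * (g z * simplexInt g I h k r z)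

lemma measurable_setLIntegral_Ioi {α : Type*} [MeasurableSpace α] {I : Set ℝ}
    (hI : MeasurableSet I) {F : α → ℝ → ℝ≥0∞} (hF : Measurable (Function.uncurry F))
    {s : α → ℝ} (hs : Measurable s) : Measurable fun a ↦ ∫⁻ r in I ∩ Set.Ioi (s a), F a r := by
  have : ∀ a, ∫⁻ r in I ∩ Set.Ioi (s a), F a r
      = ∫⁻ r, {p : α × ℝ | p.2 ∈ I ∧ s p.1 < p.2}.indicator (Function.uncurry F) (a, r) := by
    intro a
    rw [← lintegral_indicator (hI.inter measurableSet_Ioi)]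
    rfl
  simp_rw [this]
  refine Measurable.lintegral_prod_right'
    (f := {p : α × ℝ | p.2 ∈ I ∧ s p.1 < p.2}.indicator (Function.uncurry F)) ?_
  exact hF.indicator ((hI.preimage measurable_snd).inter
    (measurableSet_lt (hs.comp measurable_fst) measurable_snd))

lemma measurable_simplexInt {g : 𝔼 → ℝ≥0∞} (hg : Measurable g) {I : Set ℝ} (hI : MeasurableSet I)
    {h : ℝ → 𝔼 → ℝ≥0∞} (hh : Measurable (Function.uncurry h)) (k : ℕ) :
    Measurable (Function.uncurry (simplexInt g I h k)) := by
  induction k with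
  | zero => exact hh
  | succ k ih =>
    refine measurable_setLIntegral_Ioi (α := ℝ × 𝔼) hI (F := fun p r ↦
      ∫⁻ z, hk (r - p.1) (z - p.2) * (g z * simplexInt g I h k r z)) ?_ measurable_fst
    refine Measurable.lintegral_prod_right' (f := fun q : ((ℝ × 𝔼) × ℝ) × 𝔼 ↦
      hk (q.1.2 - q.1.1.1) (q.2 - q.1.1.2) * (g q.2 * simplexInt g I h k q.1.2 q.2)) ?_
    have h2 : Measurable (fun q : ((ℝ × 𝔼) × ℝ) × 𝔼 ↦ simplexInt g I h k q.1.2 q.2) :=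
      ih.comp (f := fun q : ((ℝ × 𝔼) × ℝ) × 𝔼 ↦ (q.1.2, q.2)) (by fun_prop)
    fun_prop

lemma measurable_simplexInt_right {g : 𝔼 → ℝ≥0∞} (hg : Measurable g) {I : Set ℝ}
    (hI : MeasurableSet I) {h : ℝ → 𝔼 → ℝ≥0∞} (hh : Measurable (Function.uncurry h)) (k : ℕ)
    (s : ℝ) : Measurable (simplexInt g I h k s) :=
  (measurable_simplexInt hg hI hh k).comp (measurable_const.prodMk measurable_id)

/-- By `lintegral_chain`, integrating out the times after `l` changes only the terminal function.
The prefix `l` is arbitrary because the recursion fixes the earliest new time first and appends it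
to `l`. -/
lemma corrInt_chain {g : 𝔼 → ℝ≥0∞} (hg : Measurable g) {I : Set ℝ} (hI : MeasurableSet I)
    {h : ℝ → 𝔼 → ℝ≥0∞} (hh : Measurable (Function.uncurry h)) (x : 𝔼) (k : ℕ) (l : List ℝ) :
    corrInt I (fun l ↦ chain g 0 l (h (lastTime 0 l)) x) k l
      = chain g 0 l (simplexInt g I h k (lastTime 0 l)) x := by
  induction k generalizing l with
  | zero => rfl
  | succ k ih =>
    simp only [corrInt, ih, simplexInt, chain_append, lastTime_append_singleton, chain]
    refine lintegral_chain hg 0 l ?_ x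
    refine Measurable.lintegral_prod_right' (f := fun q : (ℝ × 𝔼) × 𝔼 ↦
      hk (q.1.1 - lastTime 0 l) (q.2 - q.1.2) * (g q.2 * simplexInt g I h k q.1.1 q.2)) ?_
    have h2 : Measurable (fun q : (ℝ × 𝔼) × 𝔼 ↦ simplexInt g I h k q.1.1 q.2) :=
      (measurable_simplexInt hg hI hh k).comp (f := fun q : (ℝ × 𝔼) × 𝔼 ↦ (q.1.1, q.2))
        (by fun_prop)
    fun_prop

lemma measurable_list_prod {Ω : Type*} [MeasurableSpace Ω] {X : ℝ → Ω → 𝔼}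
    (hX : Measurable (Function.uncurry X)) {g : 𝔼 → ℝ≥0∞} (hg : Measurable g) (l : List ℝ) :
    Measurable fun ω ↦ (l.map fun s ↦ g (X s ω)).prod := by
  induction l with
  | nil => simp
  | cons s l ih =>
    simp only [List.map_cons, List.prod_cons]
    exact (hg.comp (hX.comp measurable_prodMk_left)).mul ih

lemma measurable_tailInt {Ω : Type*} [MeasurableSpace Ω] {X : ℝ → Ω → 𝔼}
    (hX : Measurable (Function.uncurry X)) {g : 𝔼 → ℝ≥0∞} (hg : Measurable g) {I : Set ℝ}
    (hI : MeasurableSet I) :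
    Measurable fun p : ℝ × Ω ↦ tailInt I (fun r ↦ g (X r p.2)) p.1 := by
  refine measurable_setLIntegral_Ioi (α := ℝ × Ω) hI (F := fun p r ↦ g (X r p.2)) ?_ measurable_fst
  exact hg.comp (hX.comp (f := fun q : (ℝ × Ω) × ℝ ↦ (q.2, q.1.2)) (by fun_prop))

/-- Tonelli moves the time integrals inside the expectation, where each path contributes a power of
its own integral over `k!`. The weight `w` makes it possible to integrate out two families of times
one after the other. -/
lemma corrInt_lintegral {Ω : Type*} [MeasurableSpace Ω] {P : Measure Ω} [SFinite P]
    {X : ℝ → Ω → 𝔼} (hX : Measurable (Function.uncurry X)) {w : Ω → ℝ≥0∞} (hw : Measurable w)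
    {g : 𝔼 → ℝ≥0∞} (hg : Measurable g) {I : Set ℝ} (hI : MeasurableSet I) (k : ℕ) (l : List ℝ) :
    corrInt I (fun l ↦ ∫⁻ ω, w ω * (l.map fun s ↦ g (X s ω)).prod ∂P) k l
      = ∫⁻ ω, w ω * (l.map fun s ↦ g (X s ω)).prod *
        (tailInt I (fun r ↦ g (X r ω)) (lastTime 0 l) ^ k * (k.factorial : ℝ≥0∞)⁻¹) ∂P := by
  induction k generalizing l with
  | zero => simp [corrInt]
  | succ k ih =>
    simp only [corrInt, ih, lastTime_append_singleton, List.map_append, List.map_cons,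
      List.map_nil, List.prod_append, List.prod_cons, List.prod_nil, mul_one]
    have hp := measurable_list_prod hX hg l
    have ht := measurable_tailInt hX hg hI
    have hgX : Measurable fun p : ℝ × Ω ↦ g (X p.1 p.2) := hg.comp hX
    rw [lintegral_lintegral_swap]
    · refine lintegral_congr fun ω ↦ ?_
      have hgω : Measurable fun r ↦ g (X r ω) := hg.comp (hX.comp measurable_prodMk_right)
      rw [← lintegral_mul_tailInt_pow hI hgω, ← lintegral_const_mul]
      · refine lintegral_congr fun r ↦ ?_
        ring
      · have := ht.comp (measurable_prodMk_right (y := ω))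
        exact hgω.mul ((this.pow_const k).mul_const _)
    · refine Measurable.aemeasurable ?_
      exact ((hw.comp measurable_snd).mul ((hp.comp measurable_snd).mul hgX)).mul
        ((ht.pow_const k).mul_const _)

end Simplex

/-! ### Finite-dimensional laws expressed as chains. -/

section FiniteDimensional

variable {d : ℕ}

local notation "𝔼" => EuclideanSpace ℝ (Fin d)

lemma lintegral_pi_fin_succ {n : ℕ} (μ : Fin (n + 1) → Measure 𝔼) [∀ i, SigmaFinite (μ i)]
    {f : (Fin (n + 1) → 𝔼) → ℝ≥0∞} (hf : Measurable f) :
    ∫⁻ z, f z ∂Measure.pi μ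
      = ∫⁻ a, ∫⁻ b, f (Fin.cons (α := fun _ ↦ 𝔼) a b) ∂Measure.pi (fun j ↦ μ j.succ) ∂μ 0 := by
  have h := (measurePreserving_piFinSuccAbove μ 0).symm
  have hm : Measurable fun z ↦ f ((MeasurableEquiv.piFinSuccAbove (fun _ ↦ 𝔼) 0).symm z) :=
    hf.comp h.measurable
  rw [← h.lintegral_comp hf, lintegral_prod _ hm.aemeasurable]
  simp [MeasurableEquiv.piFinSuccAbove_symm_apply, Fin.insertNthEquiv]

lemma measurable_cons_snoc {k : ℕ} (x y : 𝔼) (j : Fin (k + 2)) :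
    Measurable fun z : Fin k → 𝔼 ↦
      (Fin.cons (α := fun _ ↦ 𝔼) x (Fin.snoc (α := fun _ ↦ 𝔼) z y) : Fin (k + 2) → 𝔼) j := by
  refine Fin.cases ?_ (fun i ↦ Fin.lastCases ?_ (fun i ↦ ?_) i) j <;> simp [measurable_pi_apply]

lemma measurable_prod_apply {g : 𝔼 → ℝ≥0∞} (hg : Measurable g) (k : ℕ) :
    Measurable fun z : Fin k → 𝔼 ↦ ∏ i, g (z i) :=
  Finset.measurable_prod _ fun i _ ↦ hg.comp (measurable_pi_apply i)

/-- Fixing the first position leaves an integral of the same kind started from that position at the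
first time; hence the general starting pair `(s₀, x)`. -/
lemma lintegral_prod_hk_eq_chain {g : 𝔼 → ℝ≥0∞} (hg : Measurable g) (t : ℝ) (y : 𝔼) {k : ℕ}
    (s : Fin k → ℝ) (s₀ : ℝ) (x : 𝔼) :
    ∫⁻ z : Fin k → 𝔼, (∏ j : Fin (k + 1),
        hk ((Fin.cons (α := fun _ ↦ ℝ) s₀ (Fin.snoc (α := fun _ ↦ ℝ) s t) : Fin (k + 2) → ℝ) j.succ
          - (Fin.cons (α := fun _ ↦ ℝ) s₀ (Fin.snoc (α := fun _ ↦ ℝ) s t) : Fin (k + 2) → ℝ)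
            j.castSucc)
          ((Fin.cons (α := fun _ ↦ 𝔼) x (Fin.snoc (α := fun _ ↦ 𝔼) z y) : Fin (k + 2) → 𝔼) j.succ
          - (Fin.cons (α := fun _ ↦ 𝔼) x (Fin.snoc (α := fun _ ↦ 𝔼) z y) : Fin (k + 2) → 𝔼)
            j.castSucc)) * ∏ i, g (z i)
      = chain g s₀ (List.ofFn s) (fun z ↦ hk (t - lastTime s₀ (List.ofFn s)) (y - z)) x := by
  induction k generalizing s₀ x with
  | zero =>
    rw [volume_pi, Measure.pi_of_empty, lintegral_dirac]
    simp [chain, lastTime, Fin.snoc]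
  | succ k ih =>
    -- Rewriting the sequence closed off by its end point as head and tail exposes the shape of the
    -- induction hypothesis.
    have hcons : ∀ {α : Type} (a : Fin (k + 1) → α) (b : α),
        (Fin.snoc (α := fun _ ↦ α) a b : Fin (k + 2) → α)
          = Fin.cons (α := fun _ ↦ α) (a 0) (Fin.snoc (α := fun _ ↦ α) (Fin.tail a) b) := by
      intro α a b
      rw [Fin.cons_snoc_eq_snoc_cons, Fin.cons_self_tail]
    rw [volume_pi, lintegral_pi_fin_succ]
    · rw [List.ofFn_succ]
      simp only [chain, lastTime]
      refine lintegral_congr fun a ↦ ?_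
      have := ih (fun i ↦ s i.succ) (s 0) a
      rw [← this, ← lintegral_const_mul, ← lintegral_const_mul, ← volume_pi]
      · refine lintegral_congr fun b ↦ ?_
        rw [Fin.prod_univ_succ, Fin.prod_univ_succ (n := k) (f := fun i ↦ g _)]
        simp only [Fin.cons_succ, Fin.castSucc_zero, Fin.cons_zero, ← Fin.succ_castSucc]
        rw [hcons s t, hcons (Fin.cons a b) y]
        simp only [Fin.cons_zero, Fin.cons_succ, Fin.tail_def]
        ring
      · exact measurable_const.mul ((Finset.measurable_prod _ fun j _ ↦
          measurable_hk_comp measurable_const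
          ((measurable_cons_snoc a y _).sub (measurable_cons_snoc a y _))).mul
          (measurable_prod_apply hg k))
      · exact (Finset.measurable_prod _ fun j _ ↦ measurable_hk_comp measurable_const
          ((measurable_cons_snoc a y _).sub (measurable_cons_snoc a y _))).mul
          (measurable_prod_apply hg k)
    · exact (Finset.measurable_prod _ fun j _ ↦ measurable_hk_comp measurable_const
        ((measurable_cons_snoc x y _).sub (measurable_cons_snoc x y _))).mul
        (measurable_prod_apply hg (k + 1))

lemma measurable_partialSum {k : ℕ} (i : Fin (k + 1)) :
    Measurable fun D : Fin k → 𝔼 ↦ Fin.partialSum D i := by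
  induction i using Fin.induction with
  | zero => simp
  | succ i ih => simp only [Fin.partialSum_succ]; fun_prop

lemma measurable_prod_partialSum {g : 𝔼 → ℝ≥0∞} (hg : Measurable g) (k : ℕ) (x : 𝔼) :
    Measurable fun D : Fin k → 𝔼 ↦ ∏ i : Fin k, g (x + Fin.partialSum D i.succ) :=
  Finset.measurable_prod _ fun _ _ ↦ hg.comp ((measurable_partialSum _).const_add x)

/-- The same computation from independent increments: translating the first increment by `x` turns
its density into the transition density from `x`, and the remaining increments start afresh from the
new position. -/
lemma lintegral_prod_partialSum_eq_chain {g : 𝔼 → ℝ≥0∞} (hg : Measurable g) {k : ℕ}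
    (s : Fin k → ℝ) (s₀ : ℝ) (x : 𝔼) :
    ∫⁻ D : Fin k → 𝔼, ∏ i : Fin k, g (x + Fin.partialSum D i.succ)
      ∂Measure.pi (fun j : Fin k ↦ (volume : Measure 𝔼).withDensity (fun z ↦
        ENNReal.ofReal (heatKernel (s j -
          (Fin.cons (α := fun _ ↦ ℝ) s₀ s : Fin (k + 1) → ℝ) j.castSucc) z)))
      = chain g s₀ (List.ofFn s) (fun _ ↦ 1) x := by
  induction k generalizing s₀ x with
  | zero => rw [Measure.pi_of_empty, lintegral_dirac]; simp [chain]
  | succ k ih =>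
    rw [lintegral_pi_fin_succ _ (measurable_prod_partialSum hg _ x), List.ofFn_succ]
    simp only [chain]
    have hint : ∀ a, ∫⁻ b : Fin k → 𝔼, ∏ i : Fin (k + 1),
        g (x + Fin.partialSum (Fin.cons (α := fun _ ↦ 𝔼) a b) i.succ)
        ∂Measure.pi (fun j : Fin k ↦ (volume : Measure 𝔼).withDensity (fun z ↦
          ENNReal.ofReal (heatKernel (s j.succ -
          (Fin.cons (α := fun _ ↦ ℝ) s₀ s : Fin (k + 2) → ℝ) j.succ.castSucc) z)))
        = g (x + a) * chain g (s 0) (List.ofFn fun i ↦ s i.succ) (fun _ ↦ 1) (x + a) := by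
      intro a
      rw [← ih (fun i ↦ s i.succ) (s 0) (x + a),
        ← lintegral_const_mul _ (measurable_prod_partialSum hg _ _)]
      simp only [Fin.prod_univ_succ, Fin.partialSum_succ', Fin.partialSum_zero, Fin.cons_zero,
        Fin.tail_cons, add_zero, ← Fin.succ_castSucc, Fin.cons_succ, add_assoc]
      congr! 7 with j
      exact congrArg (s j.succ - ·) (congrFun (Fin.cons_self_tail s).symm j.castSucc)
    rw [lintegral_congr hint]
    have hm : Measurable fun a ↦ g (x + a) *
        chain g (s 0) (List.ofFn fun i ↦ s i.succ) (fun _ ↦ 1) (x + a) := by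
      have := measurable_chain' hg (s 0) (List.ofFn fun i ↦ s i.succ)
        (h := fun _ ↦ 1) measurable_const
      fun_prop
    rw [lintegral_withDensity_eq_lintegral_mul _ (by change Measurable (hk _); fun_prop) hm,
      ← lintegral_sub_right_eq_self _ x]
    refine lintegral_congr fun a ↦ ?_
    simp [hk]

end FiniteDimensional

/-! ### Jointly measurable versions of the processes and their product moments. -/

section Versions

variable {d : ℕ} {Ω : Type*} [MeasurableSpace Ω] {P : Measure Ω}

local notation "𝔼" => EuclideanSpace ℝ (Fin d)

/-- A continuous process has a jointly measurable version. -/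
lemma exists_measurable_version {X : ℝ≥0 → Ω → 𝔼} (hm : ∀ s, AEMeasurable (X s) P)
    (hc : ∀ᵐ ω ∂P, Continuous fun s ↦ X s ω) :
    ∃ Y : ℝ → Ω → 𝔼, Measurable (Function.uncurry Y) ∧
      ∀ᵐ ω ∂P, ∀ s, Y s ω = X s.toNNReal ω := by
  -- The version, set to `0` on a null set, is the pointwise limit of processes frozen at the grid
  -- times `⌊n s⌋ / n`. These are jointly measurable because each uses only countably many random
  -- variables.
  let τ : ℕ → ℕ → ℝ≥0 := fun n j ↦ ((j : ℝ) / (n : ℝ)).toNNReal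
  have hae : ∀ᵐ ω ∂P, (Continuous fun s ↦ X s ω) ∧
      ∀ n j, X (τ n j) ω = (hm (τ n j)).mk _ ω := by
    refine hc.and (ae_all_iff.2 fun n ↦ ae_all_iff.2 fun j ↦ (hm (τ n j)).ae_eq_mk)
  set N := toMeasurable P {ω | ¬ ((Continuous fun s ↦ X s ω) ∧
      ∀ n j, X (τ n j) ω = (hm (τ n j)).mk _ ω)} with hN
  have hN0 : P N = 0 := by rw [hN, measure_toMeasurable]; exact hae
  have hgood : ∀ ω ∉ N, (Continuous fun s ↦ X s ω) ∧
      ∀ n j, X (τ n j) ω = (hm (τ n j)).mk _ ω := by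
    intro ω hω
    by_contra h
    exact hω (subset_toMeasurable P _ h)
  classical
  have hNm : MeasurableSet N := measurableSet_toMeasurable _ _
  let Z : ℕ → ℝ × Ω → 𝔼 := fun n p ↦
    if p.2 ∈ N then 0 else (hm (τ n ⌊max p.1 0 * n⌋₊)).mk _ p.2
  have hZ : ∀ n, Measurable (Z n) := by
    intro n
    refine Measurable.ite (hNm.preimage measurable_snd) measurable_const ?_
    have h1 : Measurable fun q : ℕ × Ω ↦ (hm (τ n q.1)).mk _ q.2 :=
      measurable_from_prod_countable_right fun j ↦ (hm (τ n j)).measurable_mk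
    exact h1.comp (f := fun p : ℝ × Ω ↦ (⌊max p.1 0 * n⌋₊, p.2)) (by fun_prop)
  refine ⟨fun s ω ↦ if ω ∈ N then 0 else X s.toNNReal ω,
    measurable_of_tendsto_metrizable hZ (tendsto_pi_nhds.2 fun p ↦ ?_), ?_⟩
  · rcases p with ⟨s, ω⟩
    by_cases hω : ω ∈ N
    · simp [Z, Function.uncurry, hω]
    · simp only [Z, Function.uncurry, hω, if_false]
      obtain ⟨hcont, heq⟩ := hgood ω hω
      simp_rw [← heq]
      have h1 : Tendsto (fun n : ℕ ↦ (⌊max s 0 * (n : ℝ)⌋₊ : ℝ) / (n : ℝ)) atTop (𝓝 (max s 0)) :=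
        (tendsto_nat_floor_mul_div_atTop (le_max_right s 0)).comp tendsto_natCast_atTop_atTop
      have h2 : Tendsto (fun n : ℕ ↦ τ n ⌊max s 0 * (n : ℝ)⌋₊) atTop (𝓝 (max s 0).toNNReal) :=
        (continuous_real_toNNReal.tendsto _).comp h1
      have h3 : (max s 0).toNNReal = s.toNNReal := by
        rcases le_total s 0 with h | h
        · simp [max_eq_right h, Real.toNNReal_of_nonpos h]
        · rw [max_eq_left h]
      rw [h3] at h2
      exact (hcont.tendsto _).comp h2
  · have : ∀ᵐ ω ∂P, ω ∉ N := measure_eq_zero_iff_ae_notMem.1 hN0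
    filter_upwards [this] with ω hω s
    simp [hω]

lemma IsBrownianBridge.aemeasurable {X : ℝ≥0 → Ω → 𝔼} {x y : 𝔼} {t : ℝ≥0}
    (h : IsBrownianBridge X x y t P) {s : ℝ≥0} (hs : s ≤ t) : AEMeasurable (X s) P := by
  rcases eq_or_lt_of_le (zero_le : (0 : ℝ≥0) ≤ s) with h0 | h0
  · rw [← h0]; exact aemeasurable_const.congr (h.start.mono fun ω hω ↦ hω.symm)
  rcases eq_or_lt_of_le hs with h1 | h1
  · rw [h1]; exact aemeasurable_const.congr (h.finish.mono fun ω hω ↦ hω.symm)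
  have := (h.law 1 (fun _ ↦ s) (by intro i j hij; omega) (fun _ ↦ ⟨h0, h1⟩)).aemeasurable
  exact (measurable_pi_apply 0).comp_aemeasurable this

/-- `ENNReal.ofReal` passes through the product because every factor is nonnegative, and for this
the sequence of times augmented by `0` and `t` must be monotone. -/
lemma ofReal_bridgeDensity {x y : 𝔼} {t : ℝ} (ht : 0 < t) {k : ℕ} {s : Fin k → ℝ}
    (hs : StrictMono s) (h : ∀ i, 0 < s i ∧ s i < t) (z : Fin k → 𝔼) :
    ENNReal.ofReal (bridgeDensity x y t s z) = (∏ j : Fin (k + 1),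
        hk ((Fin.cons (α := fun _ ↦ ℝ) 0 (Fin.snoc (α := fun _ ↦ ℝ) s t) : Fin (k + 2) → ℝ) j.succ
          - (Fin.cons (α := fun _ ↦ ℝ) 0 (Fin.snoc (α := fun _ ↦ ℝ) s t) : Fin (k + 2) → ℝ)
            j.castSucc)
          ((Fin.cons (α := fun _ ↦ 𝔼) x (Fin.snoc (α := fun _ ↦ 𝔼) z y) : Fin (k + 2) → 𝔼) j.succ
          - (Fin.cons (α := fun _ ↦ 𝔼) x (Fin.snoc (α := fun _ ↦ 𝔼) z y) : Fin (k + 2) → 𝔼)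
            j.castSucc)) / hk t (y - x) := by
  have hmono : Monotone
      (Fin.cons (α := fun _ ↦ ℝ) 0 (Fin.snoc (α := fun _ ↦ ℝ) s t) : Fin (k + 2) → ℝ) := by
    rw [Fin.monotone_iff_le_succ]
    intro i
    refine Fin.cases ?_ (fun i ↦ ?_) i
    · simp only [Fin.castSucc_zero, Fin.cons_zero, Fin.cons_succ]
      refine Fin.lastCases ?_ (fun j ↦ ?_) (0 : Fin (k + 1))
      · simpa using ht.le
      · simpa using (h j).1.le
    · simp only [← Fin.succ_castSucc, Fin.cons_succ, Fin.snoc_castSucc]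
      have : ∀ j : Fin (k + 1), i.castSucc < j → s i ≤ Fin.snoc (α := fun _ ↦ ℝ) s t j := by
        intro j
        refine Fin.lastCases (fun _ ↦ ?_) (fun j hj ↦ ?_) j
        · simpa using (h i).2.le
        · simpa using hs.monotone (Fin.castSucc_lt_castSucc_iff.1 hj).le
      exact this _ Fin.castSucc_lt_succ
  unfold bridgeDensity hk
  rw [ENNReal.ofReal_div_of_pos (heatKernel_pos ht _), ENNReal.ofReal_prod_of_nonneg]
  intro j _
  exact heatKernel_nonneg (sub_nonneg.2 (hmono (Fin.castSucc_le_succ j))) _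

lemma IsBrownianBridge.lintegral_prod {X : ℝ≥0 → Ω → 𝔼} {x y : 𝔼} {t : ℝ≥0} (ht : 0 < t)
    (h : IsBrownianBridge X x y t P) {g : 𝔼 → ℝ≥0∞} (hg : Measurable g) {l : List ℝ}
    (hl : IsTimes (Set.Ioo 0 (t : ℝ)) l) :
    ∫⁻ ω, (l.map fun s ↦ g (X s.toNNReal ω)).prod ∂P
      = chain g 0 l (fun z ↦ hk (t - lastTime 0 l) (y - z)) x / hk t (y - x) := by
  have hpw := (List.pairwise_cons.1 hl.1).2
  have hpos : ∀ i, 0 < l.get i := fun i ↦ (hl.2 _ (List.get_mem l i)).1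
  have hlt : ∀ i, l.get i < t := fun i ↦ (hl.2 _ (List.get_mem l i)).2
  have hsm : StrictMono l.get := fun i j hij ↦ List.pairwise_iff_get.1 hpw i j hij
  have hlaw := h.law l.length (fun i ↦ (l.get i).toNNReal)
    (fun i j hij ↦ (Real.toNNReal_lt_toNNReal_iff (hpos j)).2 (hsm hij))
    (fun i ↦ ⟨Real.toNNReal_pos.2 (hpos i), (Real.toNNReal_lt_iff_lt_coe (hpos i).le).2 (hlt i)⟩)
  have hcoe : (fun i ↦ (((l.get i).toNNReal : ℝ≥0) : ℝ)) = l.get :=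
    funext fun i ↦ Real.coe_toNNReal _ (hpos i).le
  simp only [hcoe] at hlaw
  have e : ∀ ω, (l.map fun s ↦ g (X s.toNNReal ω)).prod
      = ∏ i : Fin l.length, g (X (l.get i).toNNReal ω) := by
    intro ω
    conv_lhs => rw [← List.ofFn_get l, List.map_ofFn, List.prod_ofFn]
    rfl
  simp_rw [e]
  have := hlaw.lintegral_comp (f := fun z ↦ ∏ i, g (z i)) (measurable_prod_apply hg _).aemeasurable
  rw [this]
  have hd : Measurable fun z : Fin l.length → 𝔼 ↦
      ENNReal.ofReal (bridgeDensity x y t l.get z) := by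
    simp_rw [ofReal_bridgeDensity (x := x) (y := y) (NNReal.coe_pos.2 ht) hsm
      (fun i ↦ ⟨hpos i, hlt i⟩)]
    exact (Finset.measurable_prod _ fun j _ ↦ measurable_hk_comp measurable_const
        ((measurable_cons_snoc x y _).sub (measurable_cons_snoc x y _))).div_const _
  rw [lintegral_withDensity_eq_lintegral_mul _ hd (measurable_prod_apply hg _)]
  have h3 := lintegral_prod_hk_eq_chain hg t y l.get 0 x
  rw [List.ofFn_get] at h3
  rw [← h3, ENNReal.div_eq_inv_mul, ← lintegral_const_mul' _ _ (by
    simpa using hk_pos (NNReal.coe_pos.2 ht) _)]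
  refine lintegral_congr fun z ↦ ?_
  simp only [Pi.mul_apply]
  rw [ofReal_bridgeDensity (NNReal.coe_pos.2 ht) hsm (fun i ↦ ⟨hpos i, hlt i⟩),
    ENNReal.div_eq_inv_mul, mul_assoc]

/-- `E ∏_{s ∈ l} g (Y_s)` is what it is for a Brownian bridge from `x` to `y` in time `t`. -/
def HasBridgeMoments (Y : ℝ → Ω → 𝔼) (P : Measure Ω) (x y : 𝔼) (t : ℝ) : Prop :=
  ∀ g : 𝔼 → ℝ≥0∞, Measurable g → ∀ l, IsTimes (Set.Ioo 0 t) l →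
    ∫⁻ ω, (l.map fun s ↦ g (Y s ω)).prod ∂P
      = chain g 0 l (fun z ↦ hk (t - lastTime 0 l) (y - z)) x / hk t (y - x)

/-- `E ∏_{s ∈ l} g (Y_s)` is what it is for a Brownian motion from `x`. -/
def HasBrownianMoments (Y : ℝ → Ω → 𝔼) (P : Measure Ω) (x : 𝔼) : Prop :=
  ∀ g : 𝔼 → ℝ≥0∞, Measurable g → ∀ l, IsTimes (Set.Ioi 0) l →
    ∫⁻ ω, (l.map fun s ↦ g (Y s ω)).prod ∂P = chain g 0 l (fun _ ↦ 1) x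

/-- A Brownian bridge has a jointly measurable version on `[0, t]`, with the expected product
moments. -/
lemma IsBrownianBridge.exists_version {X : ℝ≥0 → Ω → 𝔼} {x y : 𝔼} {t : ℝ≥0} (ht : 0 < t)
    (h : IsBrownianBridge X x y t P) :
    IsProbabilityMeasure P ∧ ∃ Y : ℝ → Ω → 𝔼, Measurable (Function.uncurry Y) ∧
      (∀ᵐ ω ∂P, ∀ s ∈ Set.Icc (0 : ℝ) t, Y s ω = X s.toNNReal ω) ∧
      HasBridgeMoments Y P x y t := by
  refine ⟨⟨?_⟩, ?_⟩
  -- The empty list of times yields the total mass.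
  · have := h.lintegral_prod ht (g := fun _ ↦ 1) measurable_const (IsTimes.nil _)
    simpa [chain, lastTime, ENNReal.div_self (hk_pos (NNReal.coe_pos.2 ht) (y - x))
      (hk_ne_top _ _)] using this
  -- Freezing the bridge at time `t` makes its paths continuous on the whole half-line.
  obtain ⟨Y, hY, hYX⟩ := exists_measurable_version (P := P) (X := fun s ↦ X (min s t))
    (fun s ↦ h.aemeasurable (min_le_right s t)) (by
      filter_upwards [h.cont] with ω hω
      exact hω.comp_continuous (by fun_prop) (fun s ↦ ⟨zero_le, min_le_right s t⟩))
  have hYX' : ∀ᵐ ω ∂P, ∀ s ∈ Set.Icc (0 : ℝ) t, Y s ω = X s.toNNReal ω := by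
    filter_upwards [hYX] with ω hω s hs
    rw [hω, min_eq_left (Real.toNNReal_le_iff_le_coe.2 hs.2)]
  refine ⟨Y, hY, hYX', fun g hg l hl ↦ ?_⟩
  rw [← h.lintegral_prod ht hg hl]
  refine lintegral_congr_ae ?_
  filter_upwards [hYX'] with ω hω
  congr 1
  refine List.map_congr_left fun s hs ↦ ?_
  rw [hω s ⟨(hl.2 s hs).1.le, (hl.2 s hs).2.le⟩]

lemma IsBrownianMotion.lintegral_prod {W : ℝ≥0 → Ω → 𝔼} {x : 𝔼}
    (h : IsBrownianMotion W x P) {g : 𝔼 → ℝ≥0∞} (hg : Measurable g) {l : List ℝ}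
    (hl : IsTimes (Set.Ioi 0) l) :
    ∫⁻ ω, (l.map fun s ↦ g (W s.toNNReal ω)).prod ∂P = chain g 0 l (fun _ ↦ 1) x := by
  have hpw := (List.pairwise_cons.1 hl.1).2
  have hpos : ∀ i, 0 < l.get i := fun i ↦ hl.2 _ (List.get_mem l i)
  have hsm : StrictMono l.get := fun i j hij ↦ List.pairwise_iff_get.1 hpw i j hij
  let τ : Fin (l.length + 1) → ℝ≥0 :=
    Fin.cons (α := fun _ ↦ ℝ≥0) 0 (fun i ↦ (l.get i).toNNReal)
  have hτ : StrictMono τ := by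
    rw [Fin.strictMono_iff_lt_succ]
    intro i
    have : ∀ j : Fin (l.length + 1), j < i.succ → τ j < τ i.succ := by
      intro j
      refine Fin.cases (fun _ ↦ ?_) (fun j hj ↦ ?_) j
      · simpa [τ] using hpos i
      · simp only [τ, Fin.cons_succ]
        exact (Real.toNNReal_lt_toNNReal_iff (hpos i)).2 (hsm (Fin.succ_lt_succ_iff.1 hj))
    exact this _ Fin.castSucc_lt_succ
  have hτc : ∀ i, (τ i : ℝ) = (Fin.cons (α := fun _ ↦ ℝ) 0 l.get : Fin (l.length + 1) → ℝ) i := by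
    intro i
    refine Fin.cases ?_ (fun i ↦ ?_) i
    · simp [τ]
    · simp only [τ, Fin.cons_succ]
      exact Real.coe_toNNReal _ (hpos i).le
  have hind := h.indep _ τ hτ.monotone
  have hlaw := iIndepFun.hasLaw_pi (fun i ↦ h.increment _ _ (hτ (Fin.castSucc_lt_succ (i := i)))) hind
  have hps : ∀ i : Fin (l.length + 1), ∀ ω, W 0 ω + Fin.partialSum
      (fun j : Fin l.length ↦ W (τ j.succ) ω - W (τ j.castSucc) ω) i = W (τ i) ω := by
    intro i ω
    induction i using Fin.induction with
    | zero => simp [τ]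
    | succ i ih => rw [Fin.partialSum_succ, ← add_assoc, ih]; abel
  have e : ∀ᵐ ω ∂P, (l.map fun s ↦ g (W s.toNNReal ω)).prod
      = ∏ i : Fin l.length, g (x + Fin.partialSum
        (fun j : Fin l.length ↦ W (τ j.succ) ω - W (τ j.castSucc) ω) i.succ) := by
    filter_upwards [h.start] with ω hω
    rw [← hω]
    simp_rw [hps]
    conv_lhs => rw [← List.ofFn_get l, List.map_ofFn, List.prod_ofFn]
    rfl
  rw [lintegral_congr_ae e]
  have := hlaw.lintegral_comp (f := fun D ↦ ∏ i : Fin l.length, g (x + Fin.partialSum D i.succ))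
    (measurable_prod_partialSum hg _ x).aemeasurable
  rw [this]
  have h3 := lintegral_prod_partialSum_eq_chain hg l.get 0 x
  rw [List.ofFn_get] at h3
  rw [← h3]
  simp only [hτc, Fin.cons_succ]

/-- Brownian motion has a jointly measurable version, with the expected product moments. -/
lemma IsBrownianMotion.exists_version {W : ℝ≥0 → Ω → 𝔼} {x : 𝔼} (h : IsBrownianMotion W x P) :
    IsProbabilityMeasure P ∧ ∃ Y : ℝ → Ω → 𝔼, Measurable (Function.uncurry Y) ∧
      (∀ᵐ ω ∂P, ∀ s, Y s ω = W s.toNNReal ω) ∧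
      HasBrownianMoments Y P x := by
  refine ⟨(h.indep 0 (fun _ ↦ 0) monotone_const).isProbabilityMeasure, ?_⟩
  have hm : ∀ s, AEMeasurable (W s) P := by
    have h0 : AEMeasurable (W 0) P := aemeasurable_const.congr (h.start.mono fun ω hω ↦ hω.symm)
    intro s
    rcases eq_or_lt_of_le (zero_le : (0 : ℝ≥0) ≤ s) with hs | hs
    · rwa [← hs]
    · have := (h.increment 0 s hs).aemeasurable.add h0
      refine this.congr (ae_of_all _ fun ω ↦ ?_)
      simp
  obtain ⟨Y, hY, hYW⟩ := exists_measurable_version hm h.cont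
  refine ⟨Y, hY, hYW, fun g hg l hl ↦ ?_⟩
  rw [← h.lintegral_prod hg hl]
  refine lintegral_congr_ae ?_
  filter_upwards [hYW] with ω hω
  simp [hω]

end Versions

/-! ### Time reversal across a gap. -/

section Reversal

variable {d : ℕ} {Ω : Type*} [MeasurableSpace Ω] {P : Measure Ω}

local notation "𝔼" => EuclideanSpace ℝ (Fin d)

/-- The times `t - r`, `r ∈ l`, in the opposite order. -/
def reverseTimes (t : ℝ) (l : List ℝ) : List ℝ := (l.map fun r ↦ t - r).reverse

lemma reverseTimes_cons (t r : ℝ) (l : List ℝ) :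
    reverseTimes t (r :: l) = reverseTimes t l ++ [t - r] := by simp [reverseTimes]

/-- The step out of `w` crosses a gap of length at least `δ`, so its kernel is at most `c`; the
other kernels are symmetric and can be read backwards. The function `φ` collects the steps already
stripped from the end. -/
lemma chain_reverseTimes_le {g : 𝔼 → ℝ≥0∞} (hg : Measurable g) {δ : ℝ} {c : ℝ≥0∞}
    (hc : ∀ τ, δ ≤ τ → ∀ z : 𝔼, hk τ z ≤ c) (s t : ℝ) (w : 𝔼) (l : List ℝ) (r₀ : ℝ)
    (hl : ∀ r ∈ r₀ :: l, δ ≤ t - r - s) {φ : 𝔼 → ℝ≥0∞} (hφ : Measurable φ) :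
    chain g s (reverseTimes t (r₀ :: l)) φ w
      ≤ c * ∫⁻ z, g z * φ z * chain g r₀ l (fun _ ↦ 1) z := by
  induction l generalizing r₀ φ with
  | nil =>
    simp only [reverseTimes, List.map_cons, List.map_nil, List.reverse_singleton, chain, mul_one]
    rw [← lintegral_const_mul _ (by fun_prop)]
    gcongr with z
    exact hc _ (hl r₀ (by simp)) _
  | cons r₁ l ih =>
    have hm : Measurable fun p : 𝔼 × 𝔼 ↦ hk (r₁ - r₀) (p.2 - p.1) * (g p.2 * φ p.2) := by
      fun_prop
    have hm2 := measurable_chain' hg r₁ l (h := fun _ ↦ 1) measurable_const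
    rw [reverseTimes_cons, chain_append]
    refine (ih r₁ (fun r hr ↦ hl r (List.mem_cons_of_mem _ hr)) ?_).trans (le_of_eq ?_)
    · simp only [chain, reverseTimes_cons, lastTime_append_singleton, sub_sub_sub_cancel_left]
      exact hm.lintegral_prod_right'
    · congr 1
      simp only [chain, reverseTimes_cons, lastTime_append_singleton, sub_sub_sub_cancel_left]
      calc _ = ∫⁻ z, ∫⁻ z', g z * chain g r₁ l (fun _ ↦ 1) z *
              (hk (r₁ - r₀) (z' - z) * (g z' * φ z')) := by
            refine lintegral_congr fun z ↦ ?_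
            rw [lintegral_const_mul _ (by fun_prop)]; ring
        _ = ∫⁻ z', ∫⁻ z, g z * chain g r₁ l (fun _ ↦ 1) z *
              (hk (r₁ - r₀) (z' - z) * (g z' * φ z')) := by
            refine lintegral_lintegral_swap (Measurable.aemeasurable ?_)
            change Measurable fun p : 𝔼 × 𝔼 ↦ g p.1 * chain g r₁ l (fun _ ↦ 1) p.1 *
              (hk (r₁ - r₀) (p.2 - p.1) * (g p.2 * φ p.2))
            fun_prop
        _ = _ := by
            refine lintegral_congr fun z' ↦ ?_
            rw [← lintegral_const_mul _ (by fun_prop)]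
            refine lintegral_congr fun z ↦ ?_
            rw [hk_sub_comm]; ring

/-- With the step into `y` as terminal function, the reversed chain becomes an ordinary one out of
`y`. For the empty list the direct step from `w` to `y` is itself the gap step, which is what `hs`
covers. -/
lemma chain_reverseTimes_le' {g : 𝔼 → ℝ≥0∞} (hg : Measurable g) {δ : ℝ} {c : ℝ≥0∞}
    (hc : ∀ τ, δ ≤ τ → ∀ z : 𝔼, hk τ z ≤ c) (s t : ℝ) (w y : 𝔼) (l : List ℝ)
    (hs : δ ≤ t - s) (hl : ∀ r ∈ l, δ ≤ t - r - s) :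
    chain g s (reverseTimes t l) (fun z ↦ hk (t - lastTime s (reverseTimes t l)) (y - z)) w
      ≤ c * chain g 0 l (fun _ ↦ 1) y := by
  cases l with
  | nil => simpa [reverseTimes, chain, lastTime] using hc _ hs _
  | cons r l =>
    refine (chain_reverseTimes_le hg hc s t w l r hl (by fun_prop)).trans (le_of_eq ?_)
    simp only [chain, reverseTimes_cons, lastTime_append_singleton, sub_sub_cancel, sub_zero]
    congr 1
    refine lintegral_congr fun z ↦ ?_
    rw [hk_sub_comm]; ring

lemma ofReal_div_hk {τ t : ℝ} (hτ : 0 < τ) (ht : 0 < t) (w : 𝔼) :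
    ENNReal.ofReal ((2 * Real.pi * τ) ^ (-(d : ℝ) / 2)) / hk t w =
      ENNReal.ofReal ((t / τ) ^ ((d : ℝ) / 2) * Real.exp (‖w‖ ^ 2 / (2 * t))) := by
  rw [hk, ← ENNReal.ofReal_div_of_pos (heatKernel_pos ht w)]
  congr 1
  rw [div_eq_iff (heatKernel_pos ht w).ne']
  unfold heatKernel
  have e : Real.exp (‖w‖ ^ 2 / (2 * t)) * Real.exp (-‖w‖ ^ 2 / (2 * t)) = 1 := by
    rw [← Real.exp_add, neg_div, add_neg_cancel, Real.exp_zero]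
  have e2 : (t / τ) ^ ((d : ℝ) / 2) * (2 * Real.pi * t) ^ (-(d : ℝ) / 2)
      = (2 * Real.pi * τ) ^ (-(d : ℝ) / 2) := by
    rw [neg_div, Real.rpow_neg (by positivity), Real.rpow_neg (by positivity),
      ← Real.inv_rpow (by positivity), ← Real.inv_rpow (by positivity),
      ← Real.mul_rpow (by positivity) (by positivity)]
    congr 1
    field_simp
  calc _ = (t / τ) ^ ((d : ℝ) / 2) * (2 * Real.pi * t) ^ (-(d : ℝ) / 2)
        * (Real.exp (‖w‖ ^ 2 / (2 * t)) * Real.exp (-‖w‖ ^ 2 / (2 * t))) := by rw [e, e2, mul_one]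
    _ = _ := by ring

/-- A ratio of heat kernels is bounded by a constant depending on the ratio of the times. -/
lemma hk_div_le {τ s t : ℝ} (hτ : 0 < τ) (h : τ ≤ s) (ht : 0 < t) (z w : 𝔼) :
    hk s z / hk t w ≤
      ENNReal.ofReal ((t / τ) ^ ((d : ℝ) / 2) * Real.exp (‖w‖ ^ 2 / (2 * t))) := by
  rw [← ofReal_div_hk hτ ht]
  gcongr
  exact hk_le hτ h z

/-- The reversed times lie in `[a + δ, t)`, so a gap of length at least `δ` separates them from
`l₁`. -/
lemma isTimes_append_reverseTimes {t a δ : ℝ} (ha : 0 ≤ a) (hδ : 0 < δ) (hat : a + δ ≤ t) {l₁ l₂ : List ℝ}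
    (h₁ : IsTimes (Set.Ioc 0 a) l₁) (h₂ : IsTimes (Set.Ioc 0 (t - a - δ)) l₂) :
    IsTimes (Set.Ioo 0 t) (l₁ ++ reverseTimes t l₂) := by
  have hr : ∀ u ∈ reverseTimes t l₂, a + δ ≤ u ∧ u < t := by
    intro u hu
    obtain ⟨r, hr, rfl⟩ := List.mem_map.1 (List.mem_reverse.1 hu)
    have := h₂.2 r hr
    exact ⟨by linarith [this.2], by linarith [this.1]⟩
  have hp₁ := List.pairwise_cons.1 h₁.1
  have hp₂ := List.pairwise_cons.1 h₂.1
  refine ⟨List.pairwise_cons.2 ⟨?_, List.pairwise_append.2 ⟨hp₁.2, ?_, ?_⟩⟩, ?_⟩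
  · intro u hu
    rcases List.mem_append.1 hu with h | h
    · exact hp₁.1 u h
    · linarith [(hr u h).1]
  · rw [reverseTimes, List.pairwise_reverse, List.pairwise_map]
    exact hp₂.2.imp fun h ↦ by linarith
  · intro u hu w hw
    linarith [(h₁.2 u hu).2, (hr w hw).1]
  · intro u hu
    rcases List.mem_append.1 hu with h | h
    · exact ⟨(h₁.2 u h).1, by linarith [(h₁.2 u h).2]⟩
    · exact ⟨by linarith [(hr u h).1], (hr u h).2⟩

end Reversal

/-! ### The Green operator and its exponential series. -/

section Green

variable {d : ℕ}

local notation "𝔼" => EuclideanSpace ℝ (Fin d)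

/-- The `k`-th power of the operator `f ↦ ∫₀^∞ P_r (g f) dr`, `P_r` being the heat semigroup, applied
to the constant function `1`. -/
def greenPow (g : 𝔼 → ℝ≥0∞) : ℕ → 𝔼 → ℝ≥0∞
  | 0 => fun _ ↦ 1
  | k + 1 => fun x ↦ ∫⁻ r in Set.Ioi (0 : ℝ), ∫⁻ z, hk r (z - x) * (g z * greenPow g k z)

lemma measurable_greenPow {g : 𝔼 → ℝ≥0∞} (hg : Measurable g) (k : ℕ) :
    Measurable (greenPow g k) := by
  induction k with
  | zero => exact measurable_const
  | succ k ih =>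
    refine Measurable.lintegral_prod_right' (f := fun p : 𝔼 × ℝ ↦
      ∫⁻ z, hk p.2 (z - p.1) * (g z * greenPow g k z)) ?_
    refine Measurable.lintegral_prod_right' (f := fun p : (𝔼 × ℝ) × 𝔼 ↦
      hk p.1.2 (p.2 - p.1.1) * (g p.2 * greenPow g k p.2)) ?_
    fun_prop

lemma setLIntegral_Ioi_sub (s : ℝ) (f : ℝ → ℝ≥0∞) :
    ∫⁻ r in Set.Ioi s, f (r - s) = ∫⁻ r in Set.Ioi (0 : ℝ), f r := by
  rw [← lintegral_indicator measurableSet_Ioi, ← lintegral_indicator measurableSet_Ioi,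
    ← lintegral_sub_right_eq_self ((Set.Ioi 0).indicator f) s]
  refine lintegral_congr fun r ↦ ?_
  simp [Set.indicator]

/-- Time homogeneity: substitute `r - s` for `r` and enlarge the domain of integration to the
half-line. -/
lemma simplexInt_le_greenPow (g : 𝔼 → ℝ≥0∞) (I : Set ℝ) (k : ℕ) (s : ℝ) (x : 𝔼) :
    simplexInt g I (fun _ _ ↦ 1) k s x ≤ greenPow g k x := by
  induction k generalizing s x with
  | zero => exact le_rfl
  | succ k ih =>
    simp only [simplexInt, greenPow]
    rw [← setLIntegral_Ioi_sub s]
    refine (lintegral_mono_set Set.inter_subset_right).trans ?_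
    gcongr with r z
    exact ih r z

lemma simplexInt_Ioi (g : 𝔼 → ℝ≥0∞) (k : ℕ) {s : ℝ} (hs : 0 ≤ s) (x : 𝔼) :
    simplexInt g (Set.Ioi 0) (fun _ _ ↦ 1) k s x = greenPow g k x := by
  induction k generalizing s x with
  | zero => rfl
  | succ k ih =>
    simp only [simplexInt, greenPow]
    rw [← setLIntegral_Ioi_sub s, Set.inter_eq_right.2 (Set.Ioi_subset_Ioi hs)]
    refine setLIntegral_congr_fun measurableSet_Ioi fun r hr ↦ ?_
    refine lintegral_congr fun z ↦ ?_
    rw [ih (hs.trans (le_of_lt hr))]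

/-- Transience enters here: for `d ≥ 3` the exponent `-d/2` lies below `-1`. -/
lemma lintegral_Ioi_rpow_lt_top (hd : 3 ≤ d) {δ : ℝ} (hδ : 0 < δ) :
    ∫⁻ r in Set.Ioi δ, ENNReal.ofReal ((2 * Real.pi * r) ^ (-(d : ℝ) / 2)) < ⊤ := by
  have hd' : (3 : ℝ) ≤ d := by exact_mod_cast hd
  have h1 : IntegrableOn (fun r : ℝ ↦ (2 * Real.pi) ^ (-(d : ℝ) / 2) * r ^ (-(d : ℝ) / 2))
      (Set.Ioi δ) := (integrableOn_Ioi_rpow_of_lt (by linarith) hδ).const_mul _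
  have h2 : IntegrableOn (fun r : ℝ ↦ (2 * Real.pi * r) ^ (-(d : ℝ) / 2)) (Set.Ioi δ) := by
    refine h1.congr_fun (fun r hr ↦ ?_) measurableSet_Ioi
    exact (Real.mul_rpow (by positivity) (hδ.le.trans (le_of_lt hr))).symm
  exact h2.lintegral_lt_top

lemma lintegral_hk_mul_le {g f : 𝔼 → ℝ≥0∞} {K F : ℝ≥0∞}
    (hK : ∀ z, g z ≤ K) (hF : ∀ z, f z ≤ F) {r : ℝ} (hr : 0 < r) (x : 𝔼) :
    ∫⁻ z, hk r (z - x) * (g z * f z) ≤ K * F := by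
  calc _ ≤ ∫⁻ z, hk r (z - x) * (K * F) := by
        gcongr with z
        · exact hK z
        · exact hF z
    _ = K * F := by rw [lintegral_mul_const _ (by fun_prop), lintegral_hk_sub hr, one_mul]

/-- Splitting the time integral of the heat semigroup at `δ`. -/
lemma lintegral_green_le {g f : 𝔼 → ℝ≥0∞} (hg : Measurable g) (hf : Measurable f) {K F : ℝ≥0∞}
    (hK : ∀ z, g z ≤ K) (hF : ∀ z, f z ≤ F) {δ : ℝ} (hδ : 0 < δ) (x : 𝔼) :
    ∫⁻ r in Set.Ioi (0 : ℝ), ∫⁻ z, hk r (z - x) * (g z * f z)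
      ≤ ENNReal.ofReal δ * (K * F)
        + (∫⁻ r in Set.Ioi δ, ENNReal.ofReal ((2 * Real.pi * r) ^ (-(d : ℝ) / 2)))
          * ∫⁻ z, g z * f z := by
  rw [← Set.Ioc_union_Ioi_eq_Ioi hδ.le]
  refine (lintegral_union_le _ _ _).trans (add_le_add ?_ ?_)
  · calc _ ≤ ∫⁻ r in Set.Ioc 0 δ, K * F :=
          setLIntegral_mono' measurableSet_Ioc fun r hr ↦ lintegral_hk_mul_le hK hF hr.1 x
      _ = _ := by rw [setLIntegral_const, Real.volume_Ioc, sub_zero, mul_comm]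
  · rw [← lintegral_mul_const'' _ (by fun_prop)]
    refine setLIntegral_mono' measurableSet_Ioi fun r hr ↦ ?_
    rw [← lintegral_const_mul _ (by fun_prop)]
    gcongr with z
    exact hk_le (hδ.trans hr) le_rfl _

/-- Cut the time integral at `1`: short times cost `K`, long times `c * ∫ g`. The sum of the two
bounds the Green operator in the supremum norm and serves as `M`. -/
lemma greenPow_le_pow (hd : 3 ≤ d) {g : 𝔼 → ℝ≥0∞} (hg : Measurable g) {K : ℝ≥0∞} (hK' : K ≠ ⊤)
    (hK : ∀ z, g z ≤ K) (hN : ∫⁻ z, g z ≠ ⊤) :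
    ∃ M : ℝ≥0∞, M ≠ ⊤ ∧ ∀ k x, greenPow g k x ≤ M ^ k := by
  set c := ∫⁻ r in Set.Ioi (1 : ℝ), ENNReal.ofReal ((2 * Real.pi * r) ^ (-(d : ℝ) / 2)) with hc
  have hct : c ≠ ⊤ := (lintegral_Ioi_rpow_lt_top hd one_pos).ne
  refine ⟨K + c * ∫⁻ z, g z, by finiteness, fun k ↦ ?_⟩
  induction k with
  | zero => simp [greenPow]
  | succ k ih =>
    intro x
    refine (lintegral_green_le hg (measurable_greenPow hg k) hK ih one_pos x).trans ?_
    rw [← hc, ENNReal.ofReal_one, one_mul, pow_succ', add_mul, mul_assoc c]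
    gcongr
    rw [← lintegral_mul_const _ hg]
    gcongr with z
    exact ih z

/-- Keep only the times in `(1, 2)`, an interval of length one on which the kernel from `x` is at
least `c` where `g` does not vanish. A value at one point thus controls an integral against `g`. -/
lemma mul_lintegral_mul_greenPow_le {g : 𝔼 → ℝ≥0∞} (k : ℕ) (x : 𝔼)
    {c : ℝ≥0∞} (hc' : c ≠ ⊤) (hc : ∀ r ∈ Set.Ioo (1 : ℝ) 2, ∀ z, g z ≠ 0 → c ≤ hk r (z - x)) :
    c * ∫⁻ z, g z * greenPow g k z ≤ greenPow g (k + 1) x := by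
  calc c * ∫⁻ z, g z * greenPow g k z
      = ∫⁻ r in Set.Ioo (1 : ℝ) 2, ∫⁻ z, c * (g z * greenPow g k z) := by
        rw [setLIntegral_const, Real.volume_Ioo, lintegral_const_mul' _ _ hc']
        norm_num
    _ ≤ ∫⁻ r in Set.Ioo (1 : ℝ) 2, ∫⁻ z, hk r (z - x) * (g z * greenPow g k z) := by
        refine setLIntegral_mono' measurableSet_Ioo fun r hr ↦ lintegral_mono fun z ↦ ?_
        by_cases hz : g z = 0
        · simp [hz]
        · gcongr; exact hc r hr z hz
    _ ≤ _ := lintegral_mono_set (fun r hr ↦ lt_trans one_pos hr.1)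

/-- If the exponential series of Green powers converges at one point, it is bounded. -/
lemma exists_tsum_greenPow_le (hd : 3 ≤ d) {g : 𝔼 → ℝ≥0∞} (hg : Measurable g) {K : ℝ≥0∞}
    (hK' : K ≠ ⊤) (hK : ∀ z, g z ≤ K) (x₀ : 𝔼) {c : ℝ≥0∞} (hc' : c ≠ ⊤) (hc0 : c ≠ 0)
    (hc : ∀ r ∈ Set.Ioo (1 : ℝ) 2, ∀ z, g z ≠ 0 → c ≤ hk r (z - x₀))
    {B : ℝ≥0∞} (hB : B ≠ ⊤) (hu : ∑' k, B ^ k * greenPow g k x₀ ≠ ⊤) :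
    ∃ S : ℝ≥0∞, S ≠ ⊤ ∧ ∀ x, ∑' k, B ^ k * greenPow g k x ≤ S := by
  -- With this `δ`, times before `δ` contribute at most half of the bound being proved, and that
  -- half can be absorbed.
  obtain ⟨δ, hδ, hδ2⟩ : ∃ δ : ℝ, 0 < δ ∧ B * (ENNReal.ofReal δ * K) ≤ 2⁻¹ := by
    refine ⟨(2 * (B.toReal * K.toReal + 1))⁻¹, by positivity, ?_⟩
    have h0 : 0 < 2 * (B.toReal * K.toReal + 1) := by positivity
    rw [← ENNReal.ofReal_toReal hB, ← ENNReal.ofReal_toReal hK', ← ENNReal.ofReal_mul (by positivity),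
      ← ENNReal.ofReal_mul (by positivity), ENNReal.ofReal_toReal hB, ENNReal.ofReal_toReal hK']
    refine (ENNReal.ofReal_le_ofReal (q := 2⁻¹) ?_).trans (by
      rw [ENNReal.ofReal_inv_of_pos two_pos]; simp)
    rw [mul_left_comm, inv_mul_le_iff₀ h0]
    linarith
  set C := ∫⁻ r in Set.Ioi δ, ENNReal.ofReal ((2 * Real.pi * r) ^ (-(d : ℝ) / 2)) with hC
  have hCt : C ≠ ⊤ := (lintegral_Ioi_rpow_lt_top hd hδ).ne
  set T := ∑' k, B ^ k * greenPow g k x₀ with hT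
  -- `S` solves `S = S / 2 + C * (c⁻¹ * T) + 1`, so the recursion for the partial sums preserves the
  -- bound `S`.
  set S := 2 * (1 + C * (c⁻¹ * T)) with hS
  have hc1 : c⁻¹ ≠ ⊤ := by simpa using hc0
  refine ⟨S, by finiteness, fun x ↦ ?_⟩
  have hgm := measurable_greenPow hg
  -- The partial sums satisfy `u_(n+1) = 1 + B G(g u_n)` with `G` the time integral of the heat
  -- semigroup; induction bounds them uniformly in `n` and `x`.
  have hpart : ∀ n, ∀ x, ∑ k ∈ Finset.range n, B ^ k * greenPow g k x ≤ S := by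
    intro n
    induction n with
    | zero => simp
    | succ n ih =>
      intro x
      have hum : Measurable fun z ↦ ∑ k ∈ Finset.range n, B ^ k * greenPow g k z := by fun_prop
      -- The convergence at `x₀` is used here: it bounds the contribution of the times after `δ`,
      -- independently of `x` and `n`.
      have hgu : B * ∫⁻ z, g z * ∑ k ∈ Finset.range n, B ^ k * greenPow g k z ≤ c⁻¹ * T := by
        rw [← lintegral_const_mul _ (by fun_prop)]
        calc _ = ∫⁻ z, ∑ k ∈ Finset.range n, B ^ (k + 1) * (g z * greenPow g k z) := by
              refine lintegral_congr fun z ↦ ?_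
              simp only [Finset.mul_sum]
              refine Finset.sum_congr rfl fun k _ ↦ ?_
              ring
          _ = ∑ k ∈ Finset.range n, B ^ (k + 1) * ∫⁻ z, g z * greenPow g k z := by
              rw [lintegral_finsetSum _ fun k _ ↦ by fun_prop]
              refine Finset.sum_congr rfl fun k _ ↦ ?_
              rw [lintegral_const_mul _ (by fun_prop)]
          _ ≤ ∑ k ∈ Finset.range n, c⁻¹ * (B ^ (k + 1) * greenPow g (k + 1) x₀) := by
              refine Finset.sum_le_sum fun k _ ↦ ?_
              calc B ^ (k + 1) * ∫⁻ z, g z * greenPow g k z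
                  = c⁻¹ * (B ^ (k + 1) * (c * ∫⁻ z, g z * greenPow g k z)) := by
                    rw [mul_left_comm _ c, ← mul_assoc c⁻¹, ENNReal.inv_mul_cancel hc0 hc', one_mul]
                _ ≤ _ := by
                    gcongr
                    exact mul_lintegral_mul_greenPow_le k x₀ hc' hc
          _ ≤ c⁻¹ * T := by
              rw [← Finset.mul_sum]
              gcongr
              rw [hT, tsum_eq_zero_add' ENNReal.summable]
              exact (ENNReal.sum_le_tsum (f := fun k ↦ B ^ (k + 1) * greenPow g (k + 1) x₀) _).trans
                le_add_self
      rw [Finset.sum_range_succ']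
      have e : ∑ k ∈ Finset.range n, B ^ (k + 1) * greenPow g (k + 1) x
          = B * ∫⁻ r in Set.Ioi (0 : ℝ), ∫⁻ z, hk r (z - x) *
            (g z * ∑ k ∈ Finset.range n, B ^ k * greenPow g k z) := by
        have hmm : ∀ k, Measurable fun r : ℝ ↦ ∫⁻ z, hk r (z - x) * (g z * greenPow g k z) :=
          fun k ↦ Measurable.lintegral_prod_right' (f := fun p : ℝ × 𝔼 ↦
            hk p.1 (p.2 - x) * (g p.2 * greenPow g k p.2)) (by fun_prop)
        have : ∀ r, ∫⁻ z, hk r (z - x) * (g z * ∑ k ∈ Finset.range n, B ^ k * greenPow g k z)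
            = ∑ k ∈ Finset.range n, B ^ k * ∫⁻ z, hk r (z - x) * (g z * greenPow g k z) := by
          intro r
          rw [← Finset.sum_congr rfl fun k _ ↦ lintegral_const_mul (B ^ k) (by fun_prop),
            ← lintegral_finsetSum _ fun k _ ↦ by fun_prop]
          refine lintegral_congr fun z ↦ ?_
          simp only [Finset.mul_sum]
          refine Finset.sum_congr rfl fun k _ ↦ ?_
          ring
        simp_rw [this]
        rw [lintegral_finsetSum _ fun k _ ↦ (hmm k).const_mul _, Finset.mul_sum]
        refine Finset.sum_congr rfl fun k _ ↦ ?_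
        rw [lintegral_const_mul _ (hmm k)]
        simp only [greenPow]; ring
      rw [e]
      simp only [pow_zero, greenPow, mul_one]
      calc _ ≤ B * (ENNReal.ofReal δ * (K * S) + C *
              ∫⁻ z, g z * ∑ k ∈ Finset.range n, B ^ k * greenPow g k z) + 1 := by
            gcongr
            exact lintegral_green_le hg hum hK ih hδ x
        _ = B * (ENNReal.ofReal δ * K) * S + C *
              (B * ∫⁻ z, g z * ∑ k ∈ Finset.range n, B ^ k * greenPow g k z) + 1 := by ring
        _ ≤ 2⁻¹ * S + C * (c⁻¹ * T) + 1 := by gcongr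
        _ = 2⁻¹ * S + 2⁻¹ * S := by
            rw [add_assoc]; congr 1
            rw [hS, ← mul_assoc (2⁻¹ : ℝ≥0∞) 2, ENNReal.inv_mul_cancel (by simp) (by simp), one_mul, add_comm]
        _ = S := by rw [← add_mul, ENNReal.inv_two_add_inv_two, one_mul]
  exact ENNReal.tsum_le_of_sum_range_le fun n ↦ hpart n x

end Green

/-! ### Moments as iterated integrals, and the exponential bound for bridges. -/

section ExponentialBound

variable {d : ℕ} {Ω : Type*} [MeasurableSpace Ω] {P : Measure Ω}

local notation "𝔼" => EuclideanSpace ℝ (Fin d)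

lemma ofReal_exp_mul {b a : ℝ} (hb : 0 ≤ b) (ha : 0 ≤ a) :
    ENNReal.ofReal (Real.exp (b * a))
      = ∑' k : ℕ, ENNReal.ofReal b ^ k * (ENNReal.ofReal a ^ k * (k.factorial : ℝ≥0∞)⁻¹) := by
  have hs := Real.summable_pow_div_factorial (b * a)
  rw [Real.exp_eq_exp_ℝ, NormedSpace.exp_eq_tsum_div,
    ENNReal.ofReal_tsum_of_nonneg (fun k ↦ by positivity) hs]
  refine tsum_congr fun k ↦ ?_
  rw [ENNReal.ofReal_div_of_pos (by positivity), mul_pow, ENNReal.ofReal_mul (by positivity),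
    ENNReal.ofReal_pow hb, ENNReal.ofReal_pow ha, ENNReal.ofReal_natCast, div_eq_mul_inv, mul_assoc]

lemma HasBrownianMoments.lintegral_tailInt_pow [SFinite P] {Y : ℝ → Ω → 𝔼} {x : 𝔼}
    (hY : Measurable (Function.uncurry Y)) (h : HasBrownianMoments Y P x) {g : 𝔼 → ℝ≥0∞}
    (hg : Measurable g) {I : Set ℝ} (hI : MeasurableSet I) (hI0 : I ⊆ Set.Ioi 0) (k : ℕ) :
    ∫⁻ ω, tailInt I (fun r ↦ g (Y r ω)) 0 ^ k * (k.factorial : ℝ≥0∞)⁻¹ ∂P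
      = simplexInt g I (fun _ _ ↦ 1) k 0 x := by
  have h1 := corrInt_lintegral (P := P) hY (w := fun _ ↦ 1) measurable_const hg hI k []
  have h2 := corrInt_chain hg hI (h := fun _ _ ↦ 1) measurable_const x k []
  simp only [List.map_nil, List.prod_nil, one_mul, lastTime, chain] at h1 h2
  rw [← h1, ← h2]
  exact corrInt_congr hI (fun l hl ↦ h g hg l ⟨hl.1, fun s hs ↦ hI0 (hl.2 s hs)⟩) k (IsTimes.nil I)

lemma HasBrownianMoments.lintegral_tailInt_Ioi_pow [SFinite P] {Y : ℝ → Ω → 𝔼} {x : 𝔼}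
    (hY : Measurable (Function.uncurry Y)) (h : HasBrownianMoments Y P x) {g : 𝔼 → ℝ≥0∞}
    (hg : Measurable g) (k : ℕ) :
    ∫⁻ ω, tailInt (Set.Ioi 0) (fun r ↦ g (Y r ω)) 0 ^ k * (k.factorial : ℝ≥0∞)⁻¹ ∂P
      = greenPow g k x := by
  rw [h.lintegral_tailInt_pow hY hg measurableSet_Ioi subset_rfl, simplexInt_Ioi g k le_rfl]

lemma HasBridgeMoments.lintegral_tailInt_pow [SFinite P] {Y : ℝ → Ω → 𝔼} {x y : 𝔼} {t : ℝ}
    (hY : Measurable (Function.uncurry Y)) (h : HasBridgeMoments Y P x y t) {g : 𝔼 → ℝ≥0∞}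
    (hg : Measurable g) {I : Set ℝ} (hI : MeasurableSet I) (hI0 : I ⊆ Set.Ioo 0 t) (k : ℕ)
    (ht : 0 < t) :
    ∫⁻ ω, tailInt I (fun r ↦ g (Y r ω)) 0 ^ k * (k.factorial : ℝ≥0∞)⁻¹ ∂P
      = simplexInt g I (fun s z ↦ hk (t - s) (y - z) / hk t (y - x)) k 0 x := by
  have h1 := corrInt_lintegral (P := P) hY (w := fun _ ↦ 1) measurable_const hg hI k []
  have h2 := corrInt_chain hg hI (h := fun s z ↦ hk (t - s) (y - z) / hk t (y - x))
    (by change Measurable fun p : ℝ × 𝔼 ↦ hk (t - p.1) (y - p.2) / hk t (y - x); fun_prop) x k []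
  simp only [List.map_nil, List.prod_nil, one_mul, lastTime, chain] at h1 h2
  rw [← h1, ← h2]
  refine corrInt_congr hI (fun l hl ↦ ?_) k (IsTimes.nil I)
  rw [h g hg l ⟨hl.1, fun s hs ↦ hI0 (hl.2 s hs)⟩, ENNReal.div_eq_inv_mul,
    ← chain_const_mul _ _ _ _ (by simpa using hk_pos ht _)]
  simp only [ENNReal.div_eq_inv_mul]

/-- Away from a gap, the past and the reversed future of a Brownian bridge are dominated by
independent Brownian motions from its two ends. -/
lemma HasBridgeMoments.lintegral_prod_mul_prod_le {Y : ℝ → Ω → 𝔼} {x y : 𝔼} {t a δ : ℝ}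
    (h : HasBridgeMoments Y P x y t) {g : 𝔼 → ℝ≥0∞} (hg : Measurable g) {K : ℝ≥0∞} (hK' : K ≠ ⊤)
    (hK : ∀ z, g z ≤ K) (ha : 0 ≤ a) (hδ : 0 < δ) (hat : a + δ ≤ t) {l₁ l₂ : List ℝ}
    (h₁ : IsTimes (Set.Ioc 0 a) l₁) (h₂ : IsTimes (Set.Ioc 0 (t - a - δ)) l₂) :
    ∫⁻ ω, (l₂.map fun r ↦ g (Y (t - r) ω)).prod * (l₁.map fun s ↦ g (Y s ω)).prod ∂P
      ≤ ENNReal.ofReal ((t / δ) ^ ((d : ℝ) / 2) * Real.exp (‖y - x‖ ^ 2 / (2 * t)))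
        * chain g 0 l₂ (fun _ ↦ 1) y * chain g 0 l₁ (fun _ ↦ 1) x := by
  have ht : 0 < t := by linarith
  have hl := isTimes_append_reverseTimes ha hδ hat h₁ h₂
  have e : ∀ ω, (l₂.map fun r ↦ g (Y (t - r) ω)).prod * (l₁.map fun s ↦ g (Y s ω)).prod
      = ((l₁ ++ reverseTimes t l₂).map fun s ↦ g (Y s ω)).prod := by
    intro ω
    rw [List.map_append, List.prod_append, mul_comm, reverseTimes, List.map_reverse,
      List.prod_reverse, List.map_map]
    rfl
  simp_rw [e]
  rw [h g hg _ hl, ← ofReal_div_hk hδ ht, ENNReal.div_eq_inv_mul, ENNReal.div_eq_inv_mul, mul_assoc,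
    mul_assoc, ← mul_assoc (ENNReal.ofReal _)]
  gcongr
  have hlast : lastTime 0 l₁ ≤ a := by
    rcases List.mem_cons.1 (lastTime_mem 0 l₁) with h | h
    · rw [h]; exact ha
    · exact (h₁.2 _ h).2
  have hfin : chain g 0 l₂ (fun _ ↦ 1) y ≠ ⊤ :=
    ((chain_le_pow hK h₂.1 y).trans_lt (by finiteness)).ne
  -- The bound on the reversed future does not depend on the position at the end of `l₁`, so it
  -- enters as a constant terminal function.
  rw [chain_append, ← chain_const_mul _ _ _ _ (by finiteness)]
  refine chain_mono (fun _ ↦ le_rfl) _ _ (fun z ↦ ?_) _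
  rw [mul_one]
  rw [lastTime_append]
  refine chain_reverseTimes_le' hg (fun τ hτ z ↦ hk_le hδ hτ z) _ _ _ _ _ (by linarith)
    fun r hr ↦ ?_
  linarith [(h₂.2 r hr).2]

/-- Two rounds of integration over ordered times: over the past, weighted by the product along a
fixed reversed future, and then over the reversed future, weighted by the power of the past
integral. -/
lemma HasBridgeMoments.lintegral_tailInt_pow_mul_le [SFinite P] {Y : ℝ → Ω → 𝔼} {x y : 𝔼}
    {t a δ : ℝ} (hY : Measurable (Function.uncurry Y))
    (h : HasBridgeMoments Y P x y t) {g : 𝔼 → ℝ≥0∞} (hg : Measurable g) {K : ℝ≥0∞} (hK' : K ≠ ⊤)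
    (hK : ∀ z, g z ≤ K) (hG : ∀ k z, greenPow g k z ≠ ⊤)
    (ha : 0 ≤ a) (hδ : 0 < δ) (hat : a + δ ≤ t) (k m : ℕ) :
    ∫⁻ ω, tailInt (Set.Ioc 0 a) (fun r ↦ g (Y r ω)) 0 ^ k * (k.factorial : ℝ≥0∞)⁻¹
        * (tailInt (Set.Ioc 0 (t - a - δ)) (fun r ↦ g (Y (t - r) ω)) 0 ^ m
          * (m.factorial : ℝ≥0∞)⁻¹) ∂P
      ≤ ENNReal.ofReal ((t / δ) ^ ((d : ℝ) / 2) * Real.exp (‖y - x‖ ^ 2 / (2 * t)))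
        * greenPow g k x * greenPow g m y := by
  set C := ENNReal.ofReal ((t / δ) ^ ((d : ℝ) / 2) * Real.exp (‖y - x‖ ^ 2 / (2 * t))) with hC
  have hY' : Measurable (Function.uncurry fun r ↦ Y (t - r)) :=
    hY.comp (f := fun p : ℝ × Ω ↦ (t - p.1, p.2)) (by fun_prop)
  have hs : ∀ I : Set ℝ, MeasurableSet I → ∀ (k : ℕ) (z : 𝔼),
      corrInt I (fun l ↦ chain g 0 l (fun _ ↦ 1) z) k [] ≤ greenPow g k z := by
    intro I hI k z
    refine (corrInt_chain hg hI (h := fun _ _ ↦ 1) measurable_const z k []).trans_le ?_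
    exact simplexInt_le_greenPow g I k 0 z
  have step1 : ∀ l₂, IsTimes (Set.Ioc 0 (t - a - δ)) l₂ →
      ∫⁻ ω, tailInt (Set.Ioc 0 a) (fun r ↦ g (Y r ω)) 0 ^ k * (k.factorial : ℝ≥0∞)⁻¹
        * (l₂.map fun r ↦ g (Y (t - r) ω)).prod ∂P
      ≤ C * greenPow g k x * chain g 0 l₂ (fun _ ↦ 1) y := by
    intro l₂ h₂
    have hfin : chain g 0 l₂ (fun _ ↦ 1) y ≠ ⊤ :=
      ((chain_le_pow hK h₂.1 y).trans_lt (by finiteness)).ne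
    have h1 := corrInt_lintegral (P := P) hY (measurable_list_prod hY' hg l₂) hg
      (measurableSet_Ioc (a := 0) (b := a)) k []
    simp only [List.map_nil, List.prod_nil, mul_one, lastTime] at h1
    simp_rw [mul_comm _ (List.prod _)]
    rw [← h1]
    refine (corrInt_mono measurableSet_Ioc
      (fun l₁ h₁ ↦ h.lintegral_prod_mul_prod_le hg hK' hK ha hδ hat h₁ h₂) k (IsTimes.nil _)).trans ?_
    rw [← hC, corrInt_const_mul _ _ (by finiteness), mul_right_comm]
    gcongr
    exact hs _ measurableSet_Ioc k x
  have hw : Measurable fun ω ↦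
      tailInt (Set.Ioc 0 a) (fun r ↦ g (Y r ω)) 0 ^ k * (k.factorial : ℝ≥0∞)⁻¹ :=
    (((measurable_tailInt hY hg measurableSet_Ioc).comp measurable_prodMk_left).pow_const
      k).mul_const _
  have h1 := corrInt_lintegral (P := P) hY' hw hg
      (measurableSet_Ioc (a := 0) (b := t - a - δ)) m []
  simp only [List.map_nil, List.prod_nil, mul_one, lastTime] at h1
  rw [← h1]
  refine (corrInt_mono measurableSet_Ioc step1 m (IsTimes.nil _)).trans ?_
  have := hG k x
  rw [corrInt_const_mul _ _ (by finiteness)]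
  gcongr
  exact hs _ measurableSet_Ioc m y

lemma measurable_intervalIntegral {Y : ℝ → Ω → 𝔼} (hY : Measurable (Function.uncurry Y))
    {f : 𝔼 → ℝ} (hf : Measurable f) (a b : ℝ) :
    Measurable fun ω ↦ ∫ r in a..b, f (Y r ω) := by
  have : StronglyMeasurable fun p : ℝ × Ω ↦ f (Y p.1 p.2) := (hf.comp hY).stronglyMeasurable
  exact (this.integral_prod_left'.measurable).sub this.integral_prod_left'.measurable

lemma tailInt_Ioc_eq_ofReal {F : ℝ → ℝ} (hF : Measurable F) (h0 : ∀ r, 0 ≤ F r) {K : ℝ}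
    (hK : ∀ r, F r ≤ K) {b : ℝ} (hb : 0 ≤ b) :
    tailInt (Set.Ioc 0 b) (fun r ↦ ENNReal.ofReal (F r)) 0
      = ENNReal.ofReal (∫ r in (0 : ℝ)..b, F r) := by
  have hi : IntegrableOn F (Set.Ioc 0 b) :=
    Measure.integrableOn_of_bounded (M := K) (by simp) hF.aestronglyMeasurable
      (ae_of_all _ fun r ↦ by rw [Real.norm_of_nonneg (h0 r)]; exact hK r)
  rw [intervalIntegral.integral_of_le hb, ofReal_integral_eq_lintegral_ofReal hi
    (ae_of_all _ fun r ↦ h0 r), tailInt]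
  congr 2
  exact Set.inter_eq_left.2 fun r hr ↦ hr.1

/-- One of `n` equal pieces of `[0, t]` carries at most the fraction `1 / n` of an integral. -/
lemma exists_piece_le {F : ℝ → ℝ} (hi : ∀ a b, IntervalIntegrable F volume a b) {n : ℕ}
    (hn : 0 < n) (t : ℝ) :
    ∃ j < n, ∫ r in (j * (t / n))..(j * (t / n) + t / n), F r ≤ (∫ r in (0 : ℝ)..t, F r) / n := by
  by_contra! hcon
  have hs := intervalIntegral.sum_integral_adjacent_intervals (f := F) (μ := volume)
    (a := fun j : ℕ ↦ j * (t / n)) (n := n) (fun k _ ↦ hi _ _)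
  have hn' : (n : ℝ) ≠ 0 := by positivity
  have : ∑ j ∈ Finset.range n, (∫ r in (0 : ℝ)..t, F r) / n
      < ∑ j ∈ Finset.range n, ∫ r in ((j : ℕ) * (t / n))..(((j + 1 : ℕ) : ℝ) * (t / n)), F r := by
    refine Finset.sum_lt_sum_of_nonempty (Finset.nonempty_range_iff.2 hn.ne') fun j hj ↦ ?_
    have := hcon j (Finset.mem_range.1 hj)
    rwa [Nat.cast_succ, add_one_mul]
  rw [hs] at this
  simp only [Finset.sum_const, Finset.card_range, nsmul_eq_mul, Nat.cast_zero, zero_mul] at this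
  rw [mul_div_cancel₀ _ hn', mul_div_cancel₀ _ hn'] at this
  exact lt_irrefl _ this

/-- Discarding a lightest of `n` equal pieces costs at most the factor `1 - 1/n` in the exponent and
leaves a gap of length `t/n`. Across it the two exponential series decouple into Green series at `x`
and at `y`. -/
lemma HasBridgeMoments.lintegral_exp_le [SFinite P] {Y : ℝ → Ω → 𝔼} {x y : 𝔼} {t : ℝ}
    (hY : Measurable (Function.uncurry Y)) (h : HasBridgeMoments Y P x y t) (ht : 0 < t)
    {f : 𝔼 → ℝ} (hf : Measurable f) (hf0 : ∀ z, 0 ≤ f z) {K : ℝ} (hK : ∀ z, f z ≤ K)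
    (hG : ∀ k z, greenPow (fun z ↦ ENNReal.ofReal (f z)) k z ≠ ⊤) {β : ℝ} (hβ : 0 ≤ β) {S : ℝ≥0∞}
    (hS : ∀ z, ∑' k, ENNReal.ofReal β ^ k * greenPow (fun z ↦ ENNReal.ofReal (f z)) k z ≤ S)
    {n : ℕ} (hn : 0 < n) :
    ∫⁻ ω, ENNReal.ofReal (Real.exp (β * (1 - 1 / n) * ∫ r in (0 : ℝ)..t, f (Y r ω))) ∂P
      ≤ n * (ENNReal.ofReal ((n : ℝ) ^ ((d : ℝ) / 2) * Real.exp (‖y - x‖ ^ 2 / (2 * t)))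
        * S * S) := by
  set g : 𝔼 → ℝ≥0∞ := fun z ↦ ENNReal.ofReal (f z) with hgdef
  have hg : Measurable g := hf.ennreal_ofReal
  have hgK : ∀ z, g z ≤ ENNReal.ofReal K := fun z ↦ ENNReal.ofReal_le_ofReal (hK z)
  set δ := t / n with hδdef
  have hn' : (0 : ℝ) < n := by positivity
  have hδ : 0 < δ := by positivity
  have hnδ : n * δ = t := by rw [hδdef]; field_simp
  have hFm : ∀ ω, Measurable fun r ↦ f (Y r ω) :=
    fun ω ↦ hf.comp (hY.comp measurable_prodMk_right)
  have hi : ∀ ω a b, IntervalIntegrable (fun r ↦ f (Y r ω)) volume a b := by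
    intro ω a b
    refine (intervalIntegrable_const (c := K)).mono_fun (hFm ω).aestronglyMeasurable
      (ae_of_all _ fun r ↦ ?_)
    simp only [Real.norm_eq_abs]
    rw [abs_of_nonneg (hf0 _)]
    exact (hK _).trans (le_abs_self K)
  let L : ℕ → Ω → ℝ := fun j ω ↦ ∫ r in (0 : ℝ)..(j * δ), f (Y r ω)
  let R : ℕ → Ω → ℝ := fun j ω ↦ ∫ r in (j * δ + δ)..t, f (Y r ω)
  have hjt : ∀ j < n, (j : ℝ) * δ + δ ≤ t := by
    intro j hj
    rw [← hnδ, ← add_one_mul]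
    gcongr
    exact_mod_cast hj
  -- The light piece depends on the path; summing over all `n` candidates removes this dependence
  -- and produces the factor `n`.
  have hpoint : ∀ ω, ENNReal.ofReal (Real.exp (β * (1 - 1 / n) * ∫ r in (0 : ℝ)..t, f (Y r ω)))
      ≤ ∑ j ∈ Finset.range n, ENNReal.ofReal (Real.exp (β * L j ω))
        * ENNReal.ofReal (Real.exp (β * R j ω)) := by
    intro ω
    obtain ⟨j, hj, hle⟩ := exists_piece_le (hi ω) hn t
    refine le_trans ?_ (Finset.single_le_sum (f := fun j ↦ ENNReal.ofReal (Real.exp (β * L j ω))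
        * ENNReal.ofReal (Real.exp (β * R j ω))) (fun _ _ ↦ zero_le) (Finset.mem_range.2 hj))
    rw [← ENNReal.ofReal_mul (by positivity), ← Real.exp_add, ← mul_add]
    refine ENNReal.ofReal_le_ofReal (Real.exp_le_exp.2 ?_)
    rw [mul_assoc]
    refine mul_le_mul_of_nonneg_left ?_ hβ
    have e1 := intervalIntegral.integral_add_adjacent_intervals (hi ω 0 (j * δ))
      (hi ω (j * δ) (j * δ + δ))
    have e2 := intervalIntegral.integral_add_adjacent_intervals (hi ω 0 (j * δ + δ))
      (hi ω (j * δ + δ) t)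
    simp only [L, R]
    rw [sub_mul, one_mul, one_div_mul_eq_div]
    linarith
  have hbound : ∀ j < n, ∫⁻ ω, ENNReal.ofReal (Real.exp (β * L j ω))
        * ENNReal.ofReal (Real.exp (β * R j ω)) ∂P
      ≤ ENNReal.ofReal ((n : ℝ) ^ ((d : ℝ) / 2) * Real.exp (‖y - x‖ ^ 2 / (2 * t))) * S * S := by
    intro j hj
    have hL : ∀ ω, ENNReal.ofReal (L j ω)
        = tailInt (Set.Ioc 0 (j * δ)) (fun r ↦ g (Y r ω)) 0 := fun ω ↦
      (tailInt_Ioc_eq_ofReal (hFm ω) (fun _ ↦ hf0 _) (fun _ ↦ hK _) (by positivity)).symm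
    -- The integral after the gap is rewritten with time running backwards from `t`.
    have hR : ∀ ω, ENNReal.ofReal (R j ω)
        = tailInt (Set.Ioc 0 (t - j * δ - δ)) (fun r ↦ g (Y (t - r) ω)) 0 := by
      intro ω
      have hb : 0 ≤ t - j * δ - δ := by linarith [hjt j hj]
      refine Eq.trans ?_ (tailInt_Ioc_eq_ofReal (F := fun r ↦ f (Y (t - r) ω))
        ((hFm ω).comp (measurable_const.sub measurable_id)) (fun _ ↦ hf0 _)
        (fun _ ↦ hK _) hb).symm
      rw [intervalIntegral.integral_comp_sub_left (fun r ↦ f (Y r ω)) t]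
      simp only [R, sub_zero]
      congr 2
      ring
    have hL0 : ∀ ω, 0 ≤ L j ω := fun ω ↦
      intervalIntegral.integral_nonneg (by positivity) fun _ _ ↦ hf0 _
    have hR0 : ∀ ω, 0 ≤ R j ω := fun ω ↦
      intervalIntegral.integral_nonneg (hjt j hj) fun _ _ ↦ hf0 _
    have hY' : Measurable (Function.uncurry fun r ↦ Y (t - r)) :=
      hY.comp (f := fun p : ℝ × Ω ↦ (t - p.1, p.2)) (by fun_prop)
    have hmL : Measurable fun ω ↦ tailInt (Set.Ioc 0 (j * δ)) (fun r ↦ g (Y r ω)) 0 :=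
      (measurable_tailInt hY hg measurableSet_Ioc).comp measurable_prodMk_left
    have hmR : Measurable fun ω ↦
        tailInt (Set.Ioc 0 (t - j * δ - δ)) (fun r ↦ g (Y (t - r) ω)) 0 :=
      (measurable_tailInt hY' hg measurableSet_Ioc).comp measurable_prodMk_left
    set B := ENNReal.ofReal β with hB
    have hBt : B ≠ ⊤ := ENNReal.ofReal_ne_top
    set C := ENNReal.ofReal ((n : ℝ) ^ ((d : ℝ) / 2) * Real.exp (‖y - x‖ ^ 2 / (2 * t))) with hC
    -- The gap is a fixed fraction of `t`, so the power in the constant depends on `n` but not on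
    -- `t`.
    have htδ : t / δ = n := by rw [← hnδ]; field_simp
    calc _ = ∫⁻ ω, ∑' k, ∑' m, B ^ k * B ^ m *
            (tailInt (Set.Ioc 0 (j * δ)) (fun r ↦ g (Y r ω)) 0 ^ k * (k.factorial : ℝ≥0∞)⁻¹
            * (tailInt (Set.Ioc 0 (t - j * δ - δ)) (fun r ↦ g (Y (t - r) ω)) 0 ^ m
              * (m.factorial : ℝ≥0∞)⁻¹)) ∂P := by
          refine lintegral_congr fun ω ↦ ?_
          rw [ofReal_exp_mul hβ (hL0 ω), ofReal_exp_mul hβ (hR0 ω), hL, hR, ← ENNReal.tsum_mul_right]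
          refine tsum_congr fun k ↦ ?_
          rw [← ENNReal.tsum_mul_left]
          refine tsum_congr fun m ↦ ?_
          ring
      _ = ∑' k, ∑' m, B ^ k * B ^ m * ∫⁻ ω,
            (tailInt (Set.Ioc 0 (j * δ)) (fun r ↦ g (Y r ω)) 0 ^ k * (k.factorial : ℝ≥0∞)⁻¹
            * (tailInt (Set.Ioc 0 (t - j * δ - δ)) (fun r ↦ g (Y (t - r) ω)) 0 ^ m
              * (m.factorial : ℝ≥0∞)⁻¹)) ∂P := by
          rw [lintegral_tsum fun k ↦ by fun_prop]
          refine tsum_congr fun k ↦ ?_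
          rw [lintegral_tsum fun m ↦ by fun_prop]
          refine tsum_congr fun m ↦ ?_
          rw [lintegral_const_mul _ (by fun_prop)]
      _ ≤ ∑' k, ∑' m, B ^ k * B ^ m * (C * greenPow g k x * greenPow g m y) := by
          gcongr with k m
          have := h.lintegral_tailInt_pow_mul_le hY hg ENNReal.ofReal_ne_top hgK hG
            (a := j * δ) (by positivity) hδ (hjt j hj) k m
          rwa [htδ] at this
      _ = C * (∑' k, B ^ k * greenPow g k x) * (∑' m, B ^ m * greenPow g m y) := by
          rw [← ENNReal.tsum_mul_left (a := C), ← ENNReal.tsum_mul_right]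
          refine tsum_congr fun k ↦ ?_
          rw [← ENNReal.tsum_mul_left]
          refine tsum_congr fun m ↦ ?_
          ring
      _ ≤ C * S * S := by gcongr <;> exact hS _
  calc _ ≤ ∫⁻ ω, ∑ j ∈ Finset.range n, ENNReal.ofReal (Real.exp (β * L j ω))
        * ENNReal.ofReal (Real.exp (β * R j ω)) ∂P := lintegral_mono hpoint
    _ = ∑ j ∈ Finset.range n, ∫⁻ ω, ENNReal.ofReal (Real.exp (β * L j ω))
        * ENNReal.ofReal (Real.exp (β * R j ω)) ∂P := by
        refine lintegral_finsetSum _ fun j _ ↦ ?_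
        exact (((measurable_intervalIntegral hY hf _ _).const_mul β).exp.ennreal_ofReal).mul
          (((measurable_intervalIntegral hY hf _ _).const_mul β).exp.ennreal_ofReal)
    _ ≤ ∑ j ∈ Finset.range n, ENNReal.ofReal ((n : ℝ) ^ ((d : ℝ) / 2)
        * Real.exp (‖y - x‖ ^ 2 / (2 * t))) * S * S :=
        Finset.sum_le_sum fun j hj ↦ hbound j (Finset.mem_range.1 hj)
    _ = _ := by simp

end ExponentialBound

/-! ### Limits for long bridges: terminal weight, bounded windows, potential at infinity. -/

section Limits

variable {d : ℕ}

local notation "𝔼" => EuclideanSpace ℝ (Fin d)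

lemma tendsto_norm_div {y : ℝ≥0 → 𝔼} {C : ℝ} (hy : ∀ᶠ t : ℝ≥0 in atTop, ‖y t‖ ^ 2 / (t : ℝ) ≤ C) :
    Tendsto (fun t : ℝ≥0 ↦ ‖y t‖ / (t : ℝ)) atTop (𝓝 0) := by
  have hT : Tendsto (fun t : ℝ≥0 ↦ C / (t : ℝ)) atTop (𝓝 0) :=
    tendsto_const_nhds.div_atTop (NNReal.tendsto_coe_atTop.2 tendsto_id)
  have h2 : Tendsto (fun t : ℝ≥0 ↦ (‖y t‖ / (t : ℝ)) ^ 2) atTop (𝓝 0) := by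
    refine squeeze_zero' (Eventually.of_forall fun t ↦ by positivity) ?_ hT
    filter_upwards [hy] with t ht
    rw [div_pow, sq (t : ℝ), ← div_div]
    gcongr
  have h3 := h2.sqrt
  rw [Real.sqrt_zero] at h3
  refine h3.congr fun t ↦ ?_
  exact Real.sqrt_sq (by positivity)

/-- The cross term is at most `2‖x‖‖y‖/t`, and `‖y‖/t` tends to `0` because its square is at most
`C/t`. -/
lemma tendsto_norm_sub_sq_div {x y : ℝ≥0 → 𝔼} {x₀ : 𝔼} (hx : Tendsto x atTop (𝓝 x₀)) {C : ℝ}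
    (hy : ∀ᶠ t : ℝ≥0 in atTop, ‖y t‖ ^ 2 / (t : ℝ) ≤ C) :
    Tendsto (fun t : ℝ≥0 ↦ ‖y t - x t‖ ^ 2 / (t : ℝ) - ‖y t‖ ^ 2 / t) atTop (𝓝 0) := by
  have h1 := tendsto_norm_div hy
  have hinv : Tendsto (fun t : ℝ≥0 ↦ ((t : ℝ))⁻¹) atTop (𝓝 0) :=
    tendsto_inv_atTop_zero.comp (NNReal.tendsto_coe_atTop.2 tendsto_id)
  have h2 : Tendsto (fun t : ℝ≥0 ↦ 2 * ‖x t‖ * (‖y t‖ / (t : ℝ)) + ‖x t‖ ^ 2 * ((t : ℝ))⁻¹)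
      atTop (𝓝 0) := by
    have := ((hx.norm.const_mul 2).mul h1).add ((hx.norm.pow 2).mul hinv)
    simpa using this
  refine squeeze_zero_norm' ?_ h2
  filter_upwards [eventually_gt_atTop 0] with t ht
  have ht' : (0 : ℝ) < t := ht
  rw [← sub_div, Real.norm_eq_abs, abs_div, abs_of_pos ht', div_le_iff₀ ht', add_mul]
  have e1 : 2 * ‖x t‖ * (‖y t‖ / (t : ℝ)) * t = 2 * ‖x t‖ * ‖y t‖ := by field_simp
  have e2 : ‖x t‖ ^ 2 * ((t : ℝ))⁻¹ * t = ‖x t‖ ^ 2 := by field_simp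
  rw [e1, e2, norm_sub_sq_real]
  have h3 := abs_real_inner_le_norm (y t) (x t)
  rw [abs_le] at h3 ⊢
  constructor <;> nlinarith [norm_nonneg (x t), norm_nonneg (y t)]

lemma eventually_norm_sub_sq_div_le {x y : ℝ≥0 → 𝔼} {x₀ : 𝔼} (hx : Tendsto x atTop (𝓝 x₀)) {C : ℝ}
    (hy : ∀ᶠ t : ℝ≥0 in atTop, ‖y t‖ ^ 2 / (t : ℝ) ≤ C) :
    ∀ᶠ t : ℝ≥0 in atTop, ‖y t - x t‖ ^ 2 / (2 * (t : ℝ)) ≤ C + 1 := by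
  filter_upwards [hy, (tendsto_norm_sub_sq_div hx hy).eventually_le_const one_pos] with t h1 h2
  have : ‖y t - x t‖ ^ 2 / (2 * (t : ℝ)) ≤ ‖y t - x t‖ ^ 2 / (t : ℝ) := by
    rw [mul_comm, ← div_div]
    exact half_le_self (by positivity)
  linarith

/-- Both the prefactors and the Gaussian exponents agree in the limit. The positions `x` and `z` may
move with `t`, as the induction over windows requires. -/
lemma tendsto_hk_div {x y z : ℝ≥0 → 𝔼} {x₀ z₀ : 𝔼} (hx : Tendsto x atTop (𝓝 x₀))
    (hz : Tendsto z atTop (𝓝 z₀)) {C : ℝ}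
    (hy : ∀ᶠ t : ℝ≥0 in atTop, ‖y t‖ ^ 2 / (t : ℝ) ≤ C) (s : ℝ) :
    Tendsto (fun t : ℝ≥0 ↦ hk (t - s) (y t - z t) / hk (t : ℝ) (y t - x t)) atTop (𝓝 1) := by
  have hT : Tendsto (fun t : ℝ≥0 ↦ (t : ℝ)) atTop atTop := NNReal.tendsto_coe_atTop.2 tendsto_id
  have hρ : Tendsto (fun t : ℝ≥0 ↦ (t : ℝ) / ((t : ℝ) - s)) atTop (𝓝 1) := by
    have h1 : Tendsto (fun t : ℝ≥0 ↦ 1 + s / ((t : ℝ) - s)) atTop (𝓝 (1 + 0)) :=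
      tendsto_const_nhds.add (tendsto_const_nhds.div_atTop (tendsto_atTop_add_const_right _ _ hT))
    rw [add_zero] at h1
    refine h1.congr' ?_
    filter_upwards [hT.eventually_gt_atTop s] with t ht
    have : (t : ℝ) - s ≠ 0 := (sub_pos.2 ht).ne'
    field_simp
    ring
  -- Although `‖y‖²/t` need not tend to `0`, replacing `t` by `t - s` in its denominator changes it
  -- by a bounded quantity times something vanishing.
  have hb : Tendsto (fun t : ℝ≥0 ↦ ‖y t‖ ^ 2 / (t : ℝ) * ((t : ℝ) / ((t : ℝ) - s) - 1)) atTop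
      (𝓝 0) := by
    have h0 : Tendsto (fun t : ℝ≥0 ↦ C * |(t : ℝ) / ((t : ℝ) - s) - 1|) atTop (𝓝 0) := by
      have := ((hρ.sub_const 1).abs).const_mul C
      simpa using this
    refine squeeze_zero_norm' ?_ h0
    filter_upwards [hy] with t ht
    rw [norm_mul, Real.norm_eq_abs, Real.norm_eq_abs, abs_of_nonneg (by positivity)]
    gcongr
  have hE : Tendsto (fun t : ℝ≥0 ↦ ‖y t - x t‖ ^ 2 / (2 * (t : ℝ))
      - ‖y t - z t‖ ^ 2 / (2 * ((t : ℝ) - s))) atTop (𝓝 0) := by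
    have h1 := tendsto_norm_sub_sq_div hx hy
    have h2 := (tendsto_norm_sub_sq_div hz hy).mul hρ
    have h3 := ((h1.sub (h2.add hb)).mul_const (1 / 2))
    simp only [zero_mul, add_zero, sub_zero] at h3
    refine h3.congr' ?_
    filter_upwards [hT.eventually_gt_atTop s, hT.eventually_gt_atTop 0] with t ht ht0
    have : (t : ℝ) - s ≠ 0 := (sub_pos.2 ht).ne'
    field_simp
    ring
  have hmain : Tendsto (fun t : ℝ≥0 ↦ ((t : ℝ) / ((t : ℝ) - s)) ^ ((d : ℝ) / 2) *
      Real.exp (‖y t - x t‖ ^ 2 / (2 * (t : ℝ)) - ‖y t - z t‖ ^ 2 / (2 * ((t : ℝ) - s)))) atTop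
      (𝓝 1) := by
    have h1 := (hρ.rpow_const (p := (d : ℝ) / 2) (Or.inl one_ne_zero)).mul hE.rexp
    simpa using h1
  have := (ENNReal.tendsto_ofReal hmain)
  rw [ENNReal.ofReal_one] at this
  refine this.congr' ?_
  filter_upwards [hT.eventually_gt_atTop s, hT.eventually_gt_atTop 0] with t ht ht0
  have hts : 0 < (t : ℝ) - s := sub_pos.2 ht
  rw [hk, hk, ← ENNReal.ofReal_div_of_pos (heatKernel_pos ht0 _)]
  congr 1
  unfold heatKernel
  rw [mul_div_mul_comm, ← Real.exp_sub, neg_div, neg_div, neg_div, sub_neg_eq_add, neg_add_eq_sub]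
  congr 1
  rw [Real.rpow_neg (by positivity), Real.rpow_neg (by positivity), inv_div_inv,
    ← Real.div_rpow (by positivity) (by positivity), mul_div_mul_left _ _ (by positivity)]

/-- From `‖w - z‖² ≤ 2‖w - x‖² + 2`: doubling the time pays for moving the centre. This gives an
integrable majorant independent of the moving centre, for dominated convergence. -/
lemma hk_sub_le {τ : ℝ} (hτ : 0 < τ) {x z : 𝔼} (h : ‖x - z‖ ≤ 1) (w : 𝔼) :
    hk τ (w - x) ≤ ENNReal.ofReal (2 ^ ((d : ℝ) / 2) * Real.exp (1 / (2 * τ))) * hk (2 * τ) (w - z) := by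
  rw [hk, hk, ← ENNReal.ofReal_mul (by positivity)]
  apply ENNReal.ofReal_le_ofReal
  unfold heatKernel
  have e : (2 * Real.pi * τ) ^ (-(d : ℝ) / 2)
      = 2 ^ ((d : ℝ) / 2) * (2 * Real.pi * (2 * τ)) ^ (-(d : ℝ) / 2) := by
    rw [show 2 * Real.pi * (2 * τ) = 2 * (2 * Real.pi * τ) by ring,
      Real.mul_rpow (x := 2) (y := 2 * Real.pi * τ) (by positivity) (by positivity), ← mul_assoc,
      ← Real.rpow_add (by positivity), neg_div, add_neg_cancel, Real.rpow_zero, one_mul]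
  have h2 : -‖w - x‖ ^ 2 / (2 * τ) ≤ 1 / (2 * τ) + -‖w - z‖ ^ 2 / (2 * (2 * τ)) := by
    have h3 : ‖w - z‖ ≤ ‖w - x‖ + ‖x - z‖ := norm_sub_le_norm_sub_add_norm_sub w x z
    have h4 : ‖w - z‖ ^ 2 ≤ 2 * ‖w - x‖ ^ 2 + 2 := by
      nlinarith [norm_nonneg (w - z), norm_nonneg (w - x), norm_nonneg (x - z),
        sq_nonneg (‖w - x‖ - ‖x - z‖)]
    rw [div_add_div _ _ (by positivity) (by positivity), div_le_div_iff₀ (by positivity)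
      (by positivity)]
    have : 0 < τ ^ 2 := by positivity
    nlinarith
  rw [e]
  calc _ ≤ 2 ^ ((d : ℝ) / 2) * (2 * Real.pi * (2 * τ)) ^ (-(d : ℝ) / 2) *
        Real.exp (1 / (2 * τ) + -‖w - z‖ ^ 2 / (2 * (2 * τ))) := by gcongr
    _ = _ := by rw [Real.exp_add]; ring

lemma continuous_heatKernel (t : ℝ) : Continuous fun z : 𝔼 ↦ heatKernel t z := by
  unfold heatKernel; fun_prop

lemma continuous_hk (t : ℝ) : Continuous fun z : 𝔼 ↦ hk t z :=
  ENNReal.continuous_ofReal.comp (continuous_heatKernel t)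

lemma simplexInt_le {g : 𝔼 → ℝ≥0∞} {K : ℝ≥0∞} (hK : ∀ z, g z ≤ K) {T : ℝ}
    {h : ℝ → 𝔼 → ℝ≥0∞} {D : ℝ≥0∞} (hD : ∀ s ∈ Set.Icc 0 T, ∀ z, h s z ≤ D) (k : ℕ) :
    ∀ s ∈ Set.Icc 0 T, ∀ z, simplexInt g (Set.Ioc 0 T) h k s z ≤ (ENNReal.ofReal T * K) ^ k * D := by
  induction k with
  | zero => simpa [simplexInt] using hD
  | succ k ih =>
    intro s hs z
    simp only [simplexInt]
    calc _ ≤ ∫⁻ r in Set.Ioc 0 T ∩ Set.Ioi s, K * ((ENNReal.ofReal T * K) ^ k * D) := by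
          refine setLIntegral_mono' (measurableSet_Ioc.inter measurableSet_Ioi) fun r hr ↦ ?_
          calc _ ≤ ∫⁻ w, hk (r - s) (w - z) * (K * ((ENNReal.ofReal T * K) ^ k * D)) := by
                gcongr with w
                · exact hK w
                · exact ih r ⟨hr.1.1.le, hr.1.2⟩ w
            _ = _ := by
                rw [lintegral_mul_const _ (by fun_prop), lintegral_hk_sub (sub_pos.2 hr.2), one_mul]
      _ ≤ K * ((ENNReal.ofReal T * K) ^ k * D) * ENNReal.ofReal T := by
          rw [setLIntegral_const]
          gcongr
          refine (measure_mono Set.inter_subset_left).trans_eq ?_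
          rw [Real.volume_Ioc, sub_zero]
      _ = _ := by rw [pow_succ]; ring

/-- Iterated integrals over a bounded time window are continuous in the terminal function and the
starting point. -/
lemma tendsto_simplexInt {g : 𝔼 → ℝ≥0∞} (hg : Measurable g) {K : ℝ≥0∞} (hK' : K ≠ ⊤)
    (hK : ∀ z, g z ≤ K) (T : ℝ) {h : ℝ≥0 → ℝ → 𝔼 → ℝ≥0∞}
    (hh : ∀ t, Measurable (Function.uncurry (h t))) {D : ℝ≥0∞} (hD' : D ≠ ⊤)
    (hD : ∀ᶠ t in atTop, ∀ s ∈ Set.Icc 0 T, ∀ z, h t s z ≤ D)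
    (hlim : ∀ s (z : ℝ≥0 → 𝔼) z₀, Tendsto z atTop (𝓝 z₀) →
      Tendsto (fun t ↦ h t s (z t)) atTop (𝓝 1)) (k : ℕ) :
    ∀ s ∈ Set.Icc 0 T, ∀ (z : ℝ≥0 → 𝔼) z₀, Tendsto z atTop (𝓝 z₀) →
      Tendsto (fun t ↦ simplexInt g (Set.Ioc 0 T) (h t) k s (z t)) atTop
        (𝓝 (simplexInt g (Set.Ioc 0 T) (fun _ _ ↦ 1) k s z₀)) := by
  induction k with
  | zero => intro s _ z z₀ hz; exact hlim s z z₀ hz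
  | succ k ih =>
    intro s hs z z₀ hz
    simp only [simplexInt]
    have hI : MeasurableSet (Set.Ioc 0 T ∩ Set.Ioi s) := measurableSet_Ioc.inter measurableSet_Ioi
    set M := (ENNReal.ofReal T * K) ^ k * D with hM
    have hMt : M ≠ ⊤ := by finiteness
    have hbd : ∀ᶠ t in atTop, ∀ s ∈ Set.Icc 0 T, ∀ z,
        simplexInt g (Set.Ioc 0 T) (h t) k s z ≤ M := by
      filter_upwards [hD] with t ht
      exact simplexInt_le hK ht k
    have hms := fun t ↦ measurable_simplexInt hg (measurableSet_Ioc (a := 0) (b := T)) (hh t) k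
    have hmr := fun t ↦ measurable_simplexInt_right hg (measurableSet_Ioc (a := 0) (b := T)) (hh t) k
    refine tendsto_lintegral_filter_of_dominated_convergence (fun _ ↦ K * M) ?_ ?_ ?_ ?_
    · refine Eventually.of_forall fun t ↦ ?_
      refine Measurable.lintegral_prod_right' (f := fun p : ℝ × 𝔼 ↦
        hk (p.1 - s) (p.2 - z t) * (g p.2 * simplexInt g (Set.Ioc 0 T) (h t) k p.1 p.2)) ?_
      have : Measurable fun p : ℝ × 𝔼 ↦ simplexInt g (Set.Ioc 0 T) (h t) k p.1 p.2 := hms t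
      fun_prop
    · filter_upwards [hbd] with t ht
      refine (ae_restrict_iff' hI).2 (ae_of_all _ fun r hr ↦ ?_)
      calc _ ≤ ∫⁻ w, hk (r - s) (w - z t) * (K * M) := by
            gcongr with w
            · exact hK w
            · exact ht r ⟨hr.1.1.le, hr.1.2⟩ w
        _ = _ := by
            rw [lintegral_mul_const _ (by fun_prop), lintegral_hk_sub (sub_pos.2 hr.2), one_mul]
    · rw [setLIntegral_const]
      have : volume (Set.Ioc 0 T ∩ Set.Ioi s) ≠ ⊤ :=
        ((measure_mono Set.inter_subset_left).trans_lt (by simp)).ne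
      finiteness
    · refine (ae_restrict_iff' hI).2 (ae_of_all _ fun r hr ↦ ?_)
      have hrs : 0 < r - s := sub_pos.2 hr.2
      refine tendsto_lintegral_filter_of_dominated_convergence
        (fun w ↦ ENNReal.ofReal (2 ^ ((d : ℝ) / 2) * Real.exp (1 / (2 * (r - s)))) *
          hk (2 * (r - s)) (w - z₀) * (K * M)) ?_ ?_ ?_ ?_
      · refine Eventually.of_forall fun t ↦ ?_
        have := hmr t r
        fun_prop
      · have hz1 : ∀ᶠ t in atTop, ‖z t - z₀‖ ≤ 1 := by
          have := (tendsto_iff_norm_sub_tendsto_zero.1 hz).eventually_le_const one_pos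
          exact this
        filter_upwards [hbd, hz1] with t ht hz1
        refine ae_of_all _ fun w ↦ ?_
        gcongr
        · exact hk_sub_le hrs hz1 w
        · exact hK w
        · exact ht r ⟨hr.1.1.le, hr.1.2⟩ w
      · rw [lintegral_mul_const _ (by fun_prop), lintegral_const_mul _ (by fun_prop),
          lintegral_hk_sub (by positivity)]
        finiteness
      · refine ae_of_all _ fun w ↦ ?_
        have h1 : Tendsto (fun t ↦ hk (r - s) (w - z t)) atTop (𝓝 (hk (r - s) (w - z₀))) :=
          ((continuous_hk (r - s)).tendsto _).comp (tendsto_const_nhds.sub hz)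
        have h2 := ih r ⟨hr.1.1.le, hr.1.2⟩ (fun _ ↦ w) w tendsto_const_nhds
        have h2b : simplexInt g (Set.Ioc 0 T) (fun _ _ ↦ 1) k r w ≠ ⊤ := by
          refine ((simplexInt_le hK (D := 1) (fun _ _ _ ↦ le_rfl) k r ⟨hr.1.1.le, hr.1.2⟩ w).trans_lt
            ?_).ne
          finiteness
        have h3 : Tendsto (fun t ↦ g w * simplexInt g (Set.Ioc 0 T) (h t) k r w) atTop
            (𝓝 (g w * simplexInt g (Set.Ioc 0 T) (fun _ _ ↦ 1) k r w)) :=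
          ENNReal.Tendsto.const_mul h2 (Or.inr ((hK w).trans_lt hK'.lt_top).ne)
        refine ENNReal.Tendsto.mul h1 (Or.inr ?_) h3 (Or.inr (hk_ne_top _ _))
        exact ENNReal.mul_ne_top ((hK w).trans_lt hK'.lt_top).ne h2b

/-- The potential of a bounded function with bounded support vanishes at infinity. -/
lemma tendsto_greenPow_one (hd : 3 ≤ d) {g : 𝔼 → ℝ≥0∞} (hg : Measurable g) {K : ℝ≥0∞} (hK' : K ≠ ⊤)
    (hK : ∀ z, g z ≤ K) (hN : ∫⁻ z, g z ≠ ⊤) {R : ℝ} (hR : ∀ z, g z ≠ 0 → ‖z‖ ≤ R)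
    {y : ℝ≥0 → 𝔼} (hy : Tendsto (fun t ↦ ‖y t‖) atTop atTop) :
    Tendsto (fun t ↦ greenPow g 1 (y t)) atTop (𝓝 0) := by
  set c : ℝ → ℝ≥0∞ := fun r ↦ ENNReal.ofReal ((2 * Real.pi * r) ^ (-(d : ℝ) / 2)) with hc
  simp only [greenPow, mul_one]
  have h0 : ∫⁻ r in Set.Ioi (0 : ℝ), (0 : ℝ≥0∞) = 0 := by simp
  rw [← h0]
  -- The majorant uses the unit mass of the kernel up to time `1` and its supremum afterwards.
  refine tendsto_lintegral_filter_of_dominated_convergence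
    (fun r ↦ (Set.Iic 1).indicator (fun _ ↦ K) r
      + (Set.Ioi 1).indicator (fun r ↦ c r * ∫⁻ z, g z) r) ?_ ?_ ?_ ?_
  · exact Eventually.of_forall fun t ↦ Measurable.lintegral_prod_right' (f := fun p : ℝ × 𝔼 ↦
      hk p.1 (p.2 - y t) * g p.2) (by fun_prop)
  · refine Eventually.of_forall fun t ↦ (ae_restrict_iff' measurableSet_Ioi).2
      (ae_of_all _ fun r hr ↦ ?_)
    rcases le_or_gt r 1 with h1 | h1
    · have := lintegral_hk_mul_le (f := fun _ ↦ 1) (F := 1) hK (fun _ ↦ le_rfl) hr (y t)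
      simpa [h1, not_lt.2 h1] using this
    · simp only [Set.indicator, Set.mem_Iic, not_le.2 h1, if_false, Set.mem_Ioi, h1, if_true, zero_add]
      rw [← lintegral_const_mul _ hg]
      gcongr with z
      exact hk_le hr le_rfl _
  · rw [lintegral_add_left (measurable_const.indicator measurableSet_Iic),
      lintegral_indicator measurableSet_Iic, lintegral_indicator measurableSet_Ioi,
      Measure.restrict_restrict measurableSet_Iic, Measure.restrict_restrict measurableSet_Ioi,
      setLIntegral_const, lintegral_mul_const'' _ (by fun_prop)]
    have h1 : Set.Iic (1 : ℝ) ∩ Set.Ioi 0 = Set.Ioc 0 1 := by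
      ext; simp [and_comm]
    have h2 : Set.Ioi (1 : ℝ) ∩ Set.Ioi 0 = Set.Ioi 1 :=
      Set.inter_eq_left.2 (Set.Ioi_subset_Ioi zero_le_one)
    have h3 : ∫⁻ r in Set.Ioi (1 : ℝ), c r ≠ ⊤ := (lintegral_Ioi_rpow_lt_top hd one_pos).ne
    rw [h1, h2, Real.volume_Ioc]
    finiteness
  · refine (ae_restrict_iff' measurableSet_Ioi).2 (ae_of_all _ fun r hr ↦ ?_)
    have hr0 : 0 < r := hr
    -- At a fixed time the kernel from `y t` to the support is at most its value at distance `‖y t‖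
    -- - R`.
    have hlim : Tendsto (fun t ↦ ENNReal.ofReal ((2 * Real.pi * r) ^ (-(d : ℝ) / 2) *
        Real.exp (-((‖y t‖ - R) ^ 2 / (2 * r)))) * ∫⁻ z, g z) atTop (𝓝 0) := by
      have h1 : Tendsto (fun t ↦ (‖y t‖ - R) ^ 2 / (2 * r)) atTop atTop :=
        ((tendsto_pow_atTop two_ne_zero).comp
          (tendsto_atTop_add_const_right _ (-R) hy)).atTop_div_const (by positivity)
      have h2 := (Real.tendsto_exp_neg_atTop_nhds_zero.comp h1).const_mul
        ((2 * Real.pi * r) ^ (-(d : ℝ) / 2))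
      have h3 := ENNReal.Tendsto.mul_const (ENNReal.tendsto_ofReal h2) (b := ∫⁻ z, g z)
        (Or.inr hN)
      simpa using h3
    refine tendsto_of_tendsto_of_tendsto_of_le_of_le' tendsto_const_nhds hlim
      (Eventually.of_forall fun _ ↦ zero_le) ?_
    filter_upwards [hy.eventually_ge_atTop R] with t ht
    rw [← lintegral_const_mul _ hg]
    refine lintegral_mono fun z ↦ ?_
    by_cases hz : g z = 0
    · simp [hz]
    · gcongr
      refine ENNReal.ofReal_le_ofReal ?_
      unfold heatKernel
      have h1 := norm_sub_norm_le (y t) z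
      rw [norm_sub_rev] at h1
      have h2 := hR z hz
      have h3 : (‖y t‖ - R) ^ 2 ≤ ‖z - y t‖ ^ 2 := by
        apply pow_le_pow_left₀ (by linarith); linarith
      rw [← neg_div]
      gcongr

end Limits

/-! ### The moment method: from truncations to moments, from moments to exponentials. -/

section MomentMethod

/-- The cut-off `T` is fixed before `t` grows, so the truncation error need only be small for `t`
large depending on `T`. -/
lemma tendsto_of_truncation {a : ℝ≥0 → ℝ} {aT : ℝ → ℝ≥0 → ℝ} {b : ℝ → ℝ} {b₀ : ℝ}
    (h1 : ∀ T, 0 < T → Tendsto (aT T) atTop (𝓝 (b T))) (h2 : Tendsto b atTop (𝓝 b₀))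
    (h3 : ∀ ε > 0, ∀ᶠ T in atTop, ∀ᶠ t in atTop, |a t - aT T t| ≤ ε) :
    Tendsto a atTop (𝓝 b₀) := by
  rw [Metric.tendsto_nhds]
  intro ε hε
  obtain ⟨T, hT, hT2, hT0⟩ := ((h3 (ε / 4) (by positivity)).and
    (((Metric.tendsto_nhds.1 h2) (ε / 4) (by positivity)).and (eventually_gt_atTop 0))).exists
  filter_upwards [hT, (Metric.tendsto_nhds.1 (h1 T hT0)) (ε / 4) (by positivity)] with t ht ht2
  rw [Real.dist_eq] at hT2 ht2 ⊢
  calc |a t - b₀| = |(a t - aT T t) + (aT T t - b T) + (b T - b₀)| := by ring_nf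
    _ ≤ |a t - aT T t| + |aT T t - b T| + |b T - b₀| := abs_add_three _ _ _
    _ < ε := by linarith

lemma abs_pow_le_exp {β : ℝ} (hβ : 0 < β) (z : ℝ) (k : ℕ) :
    |z| ^ k ≤ k.factorial / β ^ k * Real.exp (β * |z|) := by
  have h := Real.pow_div_factorial_le_exp (β * |z|) (by positivity) k
  rw [div_le_iff₀ (by positivity), mul_pow] at h
  rw [div_mul_eq_mul_div, le_div_iff₀ (by positivity)]
  linarith

variable {Ω : Type*} [MeasurableSpace Ω] {P : Measure Ω}

lemma integrable_pow_of_exp {Z : Ω → ℝ} (hZ : AEMeasurable Z P) {β : ℝ} (hβ : 0 < β)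
    (h : Integrable (fun ω ↦ Real.exp (β * |Z ω|)) P) (k : ℕ) :
    Integrable (fun ω ↦ Z ω ^ k) P := by
  refine (h.const_mul (k.factorial / β ^ k)).mono' (hZ.pow_const k).aestronglyMeasurable
    (ae_of_all _ fun ω ↦ ?_)
  rw [Real.norm_eq_abs, abs_pow]
  exact abs_pow_le_exp hβ _ k

lemma integrable_exp_of_abs {Z : Ω → ℝ} (hZ : AEMeasurable Z P) {α β : ℝ} (hαβ : |α| ≤ β)
    (h : Integrable (fun ω ↦ Real.exp (β * |Z ω|)) P) :
    Integrable (fun ω ↦ Real.exp (α * Z ω)) P := by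
  refine h.mono' (hZ.const_mul α).exp.aestronglyMeasurable (ae_of_all _ fun ω ↦ ?_)
  rw [Real.norm_eq_abs, abs_of_pos (Real.exp_pos _)]
  refine Real.exp_le_exp.2 ?_
  calc α * Z ω ≤ |α| * |Z ω| := by rw [← abs_mul]; exact le_abs_self _
    _ ≤ _ := by gcongr

lemma term_bound {α β : ℝ} (hβ : 0 < β) (z : ℝ) (k : ℕ) :
    ‖α ^ k / k.factorial * z ^ k‖ ≤ (|α| / β) ^ k * Real.exp (β * |z|) := by
  simp only [norm_mul, norm_div, norm_pow, Real.norm_eq_abs, Nat.abs_cast]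
  calc |α| ^ k / k.factorial * |z| ^ k
      ≤ |α| ^ k / k.factorial * (k.factorial / β ^ k * Real.exp (β * |z|)) := by
        gcongr; exact abs_pow_le_exp hβ z k
    _ = _ := by rw [div_pow]; field_simp

/-- Finiteness at the larger order `β` dominates the power series by a geometric one of ratio
`|α|/β`, so sum and expectation may be exchanged. -/
lemma hasSum_mgf {Z : Ω → ℝ} (hZ : AEMeasurable Z P) {α β : ℝ} (hαβ : |α| < β)
    (h : Integrable (fun ω ↦ Real.exp (β * |Z ω|)) P) :
    ∑' k : ℕ, α ^ k / k.factorial * ∫ ω, Z ω ^ k ∂P = ∫ ω, Real.exp (α * Z ω) ∂P := by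
  have hβ : 0 < β := (abs_nonneg α).trans_lt hαβ
  have hr : |α| / β < 1 := by rwa [div_lt_one hβ]
  have hint : ∀ k : ℕ, Integrable (fun ω ↦ α ^ k / k.factorial * Z ω ^ k) P := fun k ↦
    (integrable_pow_of_exp hZ hβ h k).const_mul _
  have hsum : Summable fun k : ℕ ↦ ∫ ω, ‖α ^ k / k.factorial * Z ω ^ k‖ ∂P := by
    refine Summable.of_nonneg_of_le (fun k ↦ integral_nonneg fun ω ↦ norm_nonneg _) (fun k ↦ ?_)
      ((summable_geometric_of_lt_one (by positivity) hr).mul_right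
        (∫ ω, Real.exp (β * |Z ω|) ∂P))
    rw [← integral_const_mul]
    exact integral_mono (hint k).norm (h.const_mul _) fun ω ↦ term_bound hβ _ k
  have := integral_tsum_of_summable_integral_norm hint hsum
  simp_rw [integral_const_mul] at this
  rw [this]
  refine integral_congr_ae (ae_of_all _ fun ω ↦ ?_)
  simp only
  rw [Real.exp_eq_exp_ℝ, NormedSpace.exp_eq_tsum_div]
  refine tsum_congr fun k ↦ ?_
  rw [mul_pow]; ring

/-- Convergence of moments and a uniform exponential bound give convergence of moment generating
functions. -/
lemma tendsto_integral_exp_of_moments {Ωs : ℝ≥0 → Type*} [∀ t, MeasurableSpace (Ωs t)]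
    {Ps : ∀ t, Measure (Ωs t)} {Z : ∀ t, Ωs t → ℝ} {Y : Ω → ℝ}
    {α β B : ℝ} (hαβ : |α| < β)
    (hZ : ∀ᶠ t in atTop, AEMeasurable (Z t) (Ps t) ∧
      Integrable (fun ω ↦ Real.exp (β * |Z t ω|)) (Ps t) ∧
      ∫ ω, Real.exp (β * |Z t ω|) ∂Ps t ≤ B)
    (hY : AEMeasurable Y P) (hYi : Integrable (fun ω ↦ Real.exp (β * |Y ω|)) P)
    (hm : ∀ k : ℕ, Tendsto (fun t ↦ ∫ ω, Z t ω ^ k ∂Ps t) atTop (𝓝 (∫ ω, Y ω ^ k ∂P))) :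
    Tendsto (fun t ↦ ∫ ω, Real.exp (α * Z t ω) ∂Ps t) atTop (𝓝 (∫ ω, Real.exp (α * Y ω) ∂P)) := by
  have hβ : 0 < β := (abs_nonneg α).trans_lt hαβ
  have hr : |α| / β < 1 := by rwa [div_lt_one hβ]
  rw [← hasSum_mgf hY hαβ hYi]
  have : ∀ᶠ t in atTop, ∑' k : ℕ, α ^ k / k.factorial * ∫ ω, Z t ω ^ k ∂Ps t
      = ∫ ω, Real.exp (α * Z t ω) ∂Ps t := by
    filter_upwards [hZ] with t ht
    exact hasSum_mgf ht.1 hαβ ht.2.1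
  refine Tendsto.congr' this ?_
  refine tendsto_tsum_of_dominated_convergence (bound := fun k : ℕ ↦ (|α| / β) ^ k * B)
    ((summable_geometric_of_lt_one (by positivity) hr).mul_right B)
    (fun k ↦ (hm k).const_mul _) ?_
  filter_upwards [hZ] with t ht k
  rw [← integral_const_mul]
  refine (norm_integral_le_integral_norm _).trans ?_
  refine (integral_mono ((integrable_pow_of_exp ht.1 hβ ht.2.1 k).const_mul _).norm
    (ht.2.1.const_mul ((|α| / β) ^ k)) fun ω ↦ term_bound hβ _ k).trans ?_
  rw [integral_const_mul]
  gcongr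
  exact ht.2.2

/-- If `M ≤ N`, the `k`-th power is Lipschitz with constant `k N^(k-1)`. If `M ≥ N`, the crude bound
`2 k M^k` may be multiplied by `M/N ≥ 1`. Closeness in `L¹` is thus needed only where `M` is
moderate, the rest being left to a higher moment. -/
lemma abs_pow_sub_pow_le_truncated {a b M N : ℝ} (ha : |a| ≤ M) (hb : |b| ≤ M) (hN : 0 < N) (k : ℕ) :
    |a ^ k - b ^ k| ≤ k * N ^ (k - 1) * |a - b| + 2 * k / N * M ^ (k + 1) := by
  have hM : 0 ≤ M := (abs_nonneg a).trans ha
  rcases Nat.eq_zero_or_pos k with rfl | hk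
  · simp
  have h1 : |a ^ k - b ^ k| ≤ |a - b| * k * M ^ (k - 1) := by
    refine (abs_pow_sub_pow_le a b k).trans ?_
    gcongr
    exact max_le ha hb
  have hab : |a - b| ≤ 2 * M := (abs_sub _ _).trans (by linarith)
  rcases le_total M N with h | h
  · calc _ ≤ |a - b| * k * N ^ (k - 1) := h1.trans (by gcongr)
      _ = k * N ^ (k - 1) * |a - b| := by ring
      _ ≤ _ := by
        have : 0 ≤ 2 * k / N * M ^ (k + 1) := by positivity
        linarith
  · calc _ ≤ 2 * M * k * M ^ (k - 1) := h1.trans (by gcongr)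
      _ = 2 * k * M ^ k := by
        obtain ⟨m, rfl⟩ := Nat.exists_eq_succ_of_ne_zero hk.ne'
        simp only [Nat.succ_eq_add_one, Nat.add_sub_cancel, pow_succ]; ring
      _ ≤ 2 * k * M ^ k * (M / N) := le_mul_of_one_le_right (by positivity) ((one_le_div hN).2 h)
      _ = 2 * k / N * M ^ (k + 1) := by rw [pow_succ]; ring
      _ ≤ _ := by
        have : 0 ≤ k * N ^ (k - 1) * |a - b| := by positivity
        linarith

/-- Powers of two random variables that are close in `L¹` have close means, under an exponential
bound. -/
lemma abs_integral_pow_sub_le {Z Z' M : Ω → ℝ} (hZ : AEMeasurable Z P) (hZ' : AEMeasurable Z' P)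
    (hM : AEMeasurable M P) (h1 : ∀ ω, |Z ω| ≤ M ω) (h2 : ∀ ω, |Z' ω| ≤ M ω) {β B : ℝ} (hβ : 0 < β)
    (hi : Integrable (fun ω ↦ Real.exp (β * M ω)) P) (hB : ∫ ω, Real.exp (β * M ω) ∂P ≤ B)
    {N : ℝ} (hN : 0 < N) (k : ℕ) :
    |∫ ω, Z ω ^ k ∂P - ∫ ω, Z' ω ^ k ∂P|
      ≤ k * N ^ (k - 1) * ∫ ω, |Z ω - Z' ω| ∂P
        + 2 * k / N * ((k + 1).factorial / β ^ (k + 1) * B) := by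
  have hM0 : ∀ ω, 0 ≤ M ω := fun ω ↦ (abs_nonneg _).trans (h1 ω)
  have hiM : Integrable (fun ω ↦ Real.exp (β * |M ω|)) P := by
    simpa only [abs_of_nonneg (hM0 _)] using hi
  have hle : ∀ {Z : Ω → ℝ}, AEMeasurable Z P → (∀ ω, |Z ω| ≤ M ω) →
      Integrable (fun ω ↦ Real.exp (β * |Z ω|)) P := by
    intro Z hZ h
    refine hi.mono' ((hZ.abs.const_mul β).exp).aestronglyMeasurable (ae_of_all _ fun ω ↦ ?_)
    rw [Real.norm_eq_abs, abs_of_pos (Real.exp_pos _)]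
    gcongr
    exact h ω
  have hZi := integrable_pow_of_exp hZ hβ (hle hZ h1)
  have hZi' := integrable_pow_of_exp hZ' hβ (hle hZ' h2)
  have hMi := integrable_pow_of_exp hM hβ hiM (k + 1)
  have hd : Integrable (fun ω ↦ |Z ω - Z' ω|) P := by
    have := ((hZi 1).sub (hZi' 1)).abs
    simpa using this
  rw [← integral_sub (hZi k) (hZi' k)]
  refine (abs_integral_le_integral_abs).trans ?_
  calc _ ≤ ∫ ω, (k * N ^ (k - 1) * |Z ω - Z' ω| + 2 * k / N * M ω ^ (k + 1)) ∂P :=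
        integral_mono ((hZi k).sub (hZi' k)).abs ((hd.const_mul _).add (hMi.const_mul _))
          fun ω ↦ abs_pow_sub_pow_le_truncated (h1 ω) (h2 ω) hN k
    _ = k * N ^ (k - 1) * ∫ ω, |Z ω - Z' ω| ∂P + 2 * k / N * ∫ ω, M ω ^ (k + 1) ∂P := by
        rw [integral_add (hd.const_mul _) (hMi.const_mul _), integral_const_mul, integral_const_mul]
    _ ≤ _ := by
        gcongr
        calc ∫ ω, M ω ^ (k + 1) ∂P
            ≤ ∫ ω, (k + 1).factorial / β ^ (k + 1) * Real.exp (β * M ω) ∂P := by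
              refine integral_mono hMi (hi.const_mul _) fun ω ↦ ?_
              have := abs_pow_le_exp hβ (M ω) (k + 1)
              rwa [abs_of_nonneg (hM0 ω)] at this
          _ ≤ _ := by rw [integral_const_mul]; gcongr

end MomentMethod

/-! ### The bridge on a bounded window and in the tail. -/

section Window

variable {d : ℕ}

local notation "𝔼" => EuclideanSpace ℝ (Fin d)

lemma abs_intervalIntegral_path_le {Ω : Type*} {Y : ℝ → Ω → 𝔼} {f : 𝔼 → ℝ} {K : ℝ}
    (hK : ∀ z, |f z| ≤ K) (ω : Ω) {T : ℝ} (hT : 0 ≤ T) :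
    |∫ r in (0 : ℝ)..T, f (Y r ω)| ≤ K * T := by
  have := intervalIntegral.norm_integral_le_of_norm_le_const (a := 0) (b := T) (C := K)
    (f := fun r ↦ f (Y r ω)) (fun r _ ↦ hK _)
  rwa [sub_zero, abs_of_nonneg hT, Real.norm_eq_abs] at this

section OneProcess

variable {Ω : Type*} [MeasurableSpace Ω] {P : Measure Ω}
  {Y : ℝ → Ω → EuclideanSpace ℝ (Fin d)}

lemma measurable_path (hY : Measurable (Function.uncurry Y)) {f : 𝔼 → ℝ} (hf : Measurable f)
    (ω : Ω) : Measurable fun r ↦ f (Y r ω) :=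
  hf.comp (hY.comp measurable_prodMk_right)

lemma intervalIntegrable_path (hY : Measurable (Function.uncurry Y)) {f : 𝔼 → ℝ}
    (hf : Measurable f) {K : ℝ} (hK : ∀ z, |f z| ≤ K) (ω : Ω) (a b : ℝ) :
    IntervalIntegrable (fun r ↦ f (Y r ω)) volume a b := by
  refine (intervalIntegrable_const (c := K)).mono_fun (measurable_path hY hf ω).aestronglyMeasurable
    (ae_of_all _ fun r ↦ ?_)
  simp only [Real.norm_eq_abs]
  exact (hK _).trans (le_abs_self K)

lemma integral_window_pow_eq [SFinite P] (hY : Measurable (Function.uncurry Y)) {f : 𝔼 → ℝ}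
    (hf : Measurable f) (hf0 : ∀ z, 0 ≤ f z) {K : ℝ} (hK : ∀ z, f z ≤ K) {T : ℝ} (hT : 0 ≤ T)
    (k : ℕ) :
    ∫ ω, (∫ r in (0 : ℝ)..T, f (Y r ω)) ^ k ∂P = k.factorial *
      (∫⁻ ω, tailInt (Set.Ioc 0 T) (fun r ↦ ENNReal.ofReal (f (Y r ω))) 0 ^ k
        * (k.factorial : ℝ≥0∞)⁻¹ ∂P).toReal := by
  have h0 : ∀ ω, 0 ≤ ∫ r in (0 : ℝ)..T, f (Y r ω) := fun ω ↦
    intervalIntegral.integral_nonneg hT fun _ _ ↦ hf0 _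
  have hm := measurable_intervalIntegral hY hf 0 T
  rw [integral_eq_lintegral_of_nonneg_ae (ae_of_all _ fun ω ↦ pow_nonneg (h0 ω) k)
    (hm.pow_const k).aestronglyMeasurable]
  have : ∀ ω, tailInt (Set.Ioc 0 T) (fun r ↦ ENNReal.ofReal (f (Y r ω))) 0
      = ENNReal.ofReal (∫ r in (0 : ℝ)..T, f (Y r ω)) := fun ω ↦
    tailInt_Ioc_eq_ofReal (measurable_path hY hf ω) (fun _ ↦ hf0 _) (fun _ ↦ hK _) hT
  simp_rw [this]
  rw [lintegral_mul_const _ (hm.ennreal_ofReal.pow_const k), ENNReal.toReal_mul]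
  simp_rw [ENNReal.ofReal_pow (h0 _)]
  rw [ENNReal.toReal_inv, ENNReal.toReal_natCast]
  field_simp

/-- Moments of a window integral, after shifting the integrand by a constant. -/
lemma integral_window_pow_eq_sum [IsProbabilityMeasure P] (hY : Measurable (Function.uncurry Y))
    {v : 𝔼 → ℝ} (hv : Measurable v) {K : ℝ} (hK : ∀ z, |v z| ≤ K) {T : ℝ} (hT : 0 < T) (k : ℕ) :
    ∫ ω, (∫ r in (0 : ℝ)..T, v (Y r ω)) ^ k ∂P = ∑ m ∈ Finset.range (k + 1),
      (∫ ω, (∫ r in (0 : ℝ)..T, (v (Y r ω) + K)) ^ m ∂P)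
        * ((-(K * T)) ^ (k - m) * (k.choose m)) := by
  have hf : Measurable fun z ↦ v z + K := hv.add_const K
  have hfK' : ∀ z, |v z + K| ≤ 2 * K := fun z ↦ by
    have h1 := abs_le.1 (hK z)
    rw [abs_of_nonneg (by linarith)]
    linarith
  have e : ∀ ω, ∫ r in (0 : ℝ)..T, v (Y r ω) = (∫ r in (0 : ℝ)..T, (v (Y r ω) + K)) + -(K * T) := by
    intro ω
    rw [intervalIntegral.integral_add (intervalIntegrable_path hY hv hK ω 0 T)
      intervalIntegrable_const, intervalIntegral.integral_const]
    simp only [smul_eq_mul, sub_zero]; ring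
  simp_rw [e, add_pow, mul_assoc]
  rw [integral_finsetSum]
  · simp_rw [integral_mul_const]
  · intro m _
    refine Integrable.mul_const ?_ _
    refine Integrable.of_bound ((measurable_intervalIntegral hY hf 0 T).pow_const
      m).aestronglyMeasurable ((2 * K * T) ^ m) (ae_of_all _ fun ω ↦ ?_)
    rw [norm_pow, Real.norm_eq_abs]
    exact pow_le_pow_left₀ (abs_nonneg _) (abs_intervalIntegral_path_le hfK' ω hT.le) m

end OneProcess

section Convergence

variable {Ω : ℝ≥0 → Type*} [∀ t, MeasurableSpace (Ω t)] {P : ∀ t, Measure (Ω t)}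
  {Y : ∀ t, ℝ → Ω t → EuclideanSpace ℝ (Fin d)} {x y : ℝ≥0 → EuclideanSpace ℝ (Fin d)}
  {x₀ : EuclideanSpace ℝ (Fin d)}
  {Ω' : Type*} [MeasurableSpace Ω'] {Q : Measure Ω'} {W : ℝ → Ω' → EuclideanSpace ℝ (Fin d)}

/-- Both moments are `k!` times iterated integrals differing only in their terminal function. Once
`t ≥ 2T`, the remaining time is at least `t/2`, which gives the bound `2^(d/2) exp(C + 1)` on the
bridge weight. -/
lemma tendsto_window_pow_of_nonneg [SFinite Q] (hP : ∀ t, 0 < t → IsProbabilityMeasure (P t))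
    (hY : ∀ t, Measurable (Function.uncurry (Y t)))
    (hB : ∀ t, 0 < t → HasBridgeMoments (Y t) (P t) (x t) (y t) t)
    (hW : Measurable (Function.uncurry W)) (hQ : HasBrownianMoments W Q x₀)
    (hx : Tendsto x atTop (𝓝 x₀)) {C : ℝ} (hy : ∀ᶠ t : ℝ≥0 in atTop, ‖y t‖ ^ 2 / (t : ℝ) ≤ C)
    {f : 𝔼 → ℝ} (hf : Measurable f) (hf0 : ∀ z, 0 ≤ f z) {K : ℝ} (hK : ∀ z, f z ≤ K)
    {T : ℝ} (hT : 0 < T) (k : ℕ) :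
    Tendsto (fun t ↦ ∫ ω, (∫ r in (0 : ℝ)..T, f (Y t r ω)) ^ k ∂P t) atTop
      (𝓝 (∫ ω, (∫ r in (0 : ℝ)..T, f (W r ω)) ^ k ∂Q)) := by
  set g : 𝔼 → ℝ≥0∞ := fun z ↦ ENNReal.ofReal (f z) with hgdef
  have hg : Measurable g := hf.ennreal_ofReal
  have hgK : ∀ z, g z ≤ ENNReal.ofReal K := fun z ↦ ENNReal.ofReal_le_ofReal (hK z)
  have hTt : Tendsto (fun t : ℝ≥0 ↦ (t : ℝ)) atTop atTop := NNReal.tendsto_coe_atTop.2 tendsto_id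
  let h : ℝ≥0 → ℝ → 𝔼 → ℝ≥0∞ := fun t s z ↦ hk (t - s) (y t - z) / hk (t : ℝ) (y t - x t)
  have hlim := tendsto_simplexInt hg ENNReal.ofReal_ne_top hgK T (h := h)
    (D := ENNReal.ofReal (2 ^ ((d : ℝ) / 2) * Real.exp (C + 1)))
    (fun t ↦ by
      change Measurable fun p : ℝ × 𝔼 ↦ hk (t - p.1) (y t - p.2) / hk (t : ℝ) (y t - x t)
      fun_prop)
    ENNReal.ofReal_ne_top (by
      filter_upwards [eventually_norm_sub_sq_div_le hx hy, hTt.eventually_ge_atTop (2 * T)]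
        with t h1 h2 s hs z
      have ht : (0 : ℝ) < t := by linarith
      refine (hk_div_le (τ := t / 2) (by positivity) (by linarith [hs.2]) ht _ _).trans ?_
      refine ENNReal.ofReal_le_ofReal ?_
      rw [div_div_cancel₀ ht.ne']
      gcongr)
    (fun s z z₀ hz ↦ tendsto_hk_div hx hz hy s) k 0 ⟨le_rfl, hT.le⟩ x x₀ hx
  have hfin : simplexInt g (Set.Ioc 0 T) (fun _ _ ↦ 1) k 0 x₀ ≠ ⊤ :=
    ((simplexInt_le hgK (D := 1) (fun _ _ _ ↦ le_rfl) k 0 ⟨le_rfl, hT.le⟩ x₀).trans_lt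
      (by finiteness)).ne
  rw [integral_window_pow_eq hW hf hf0 hK hT.le,
    hQ.lintegral_tailInt_pow hW hg measurableSet_Ioc Set.Ioc_subset_Ioi_self]
  refine (((ENNReal.tendsto_toReal hfin).comp hlim).const_mul (k.factorial : ℝ)).congr' ?_
  filter_upwards [hTt.eventually_gt_atTop T] with t ht
  have ht0 : (0 : ℝ) < t := hT.trans ht
  have := hP t ht0
  rw [integral_window_pow_eq (hY t) hf hf0 hK hT.le, (hB t ht0).lintegral_tailInt_pow (hY t) hg
    measurableSet_Ioc (fun r hr ↦ ⟨hr.1, hr.2.trans_lt ht⟩) k ht0]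
  rfl

/-- The iterated integrals need a nonnegative integrand. On a bounded window adding `K` to `v`
shifts the integral by the constant `K * T`, and the moments are recovered binomially. -/
lemma tendsto_window_pow [IsProbabilityMeasure Q] (hP : ∀ t, 0 < t → IsProbabilityMeasure (P t))
    (hY : ∀ t, Measurable (Function.uncurry (Y t)))
    (hB : ∀ t, 0 < t → HasBridgeMoments (Y t) (P t) (x t) (y t) t)
    (hW : Measurable (Function.uncurry W)) (hQ : HasBrownianMoments W Q x₀)
    (hx : Tendsto x atTop (𝓝 x₀)) {C : ℝ} (hy : ∀ᶠ t : ℝ≥0 in atTop, ‖y t‖ ^ 2 / (t : ℝ) ≤ C)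
    {v : 𝔼 → ℝ} (hv : Measurable v) {K : ℝ} (hK : ∀ z, |v z| ≤ K)
    {T : ℝ} (hT : 0 < T) (k : ℕ) :
    Tendsto (fun t ↦ ∫ ω, (∫ r in (0 : ℝ)..T, v (Y t r ω)) ^ k ∂P t) atTop
      (𝓝 (∫ ω, (∫ r in (0 : ℝ)..T, v (W r ω)) ^ k ∂Q)) := by
  set f : 𝔼 → ℝ := fun z ↦ v z + K with hfdef
  have hf : Measurable f := hv.add_const K
  have hf0 : ∀ z, 0 ≤ f z := fun z ↦ by linarith [(abs_le.1 (hK z)).1]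
  have hfK : ∀ z, f z ≤ 2 * K := fun z ↦ by
    have := (abs_le.1 (hK z)).2
    simp only [hfdef]; linarith
  rw [integral_window_pow_eq_sum hW hv hK hT]
  refine Tendsto.congr' ?_ (tendsto_finsetSum _ fun m _ ↦
    (tendsto_window_pow_of_nonneg hP hY hB hW hQ hx hy hf hf0 hfK hT m).mul_const _)
  filter_upwards [eventually_gt_atTop 0] with t ht
  have := hP t ht
  exact (integral_window_pow_eq_sum (hY t) hv hK hT k).symm

end Convergence

section Tail

variable {Ω : Type*} [MeasurableSpace Ω] {P : Measure Ω}

/-- For `r ≤ t/2` the kernel into `y` relative to `hk t (y - x)` is at most `D`, and the kernel out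
of `x` is bounded by its maximum. For `r > t/2` the roles are exchanged: the kernel out of `x` is
absorbed in `D`, and the one into `y`, read from `y`, builds up the Green potential there. -/
lemma HasBridgeMoments.lintegral_tail_le [SFinite P] {Y : ℝ → Ω → 𝔼} {x y : 𝔼} {t : ℝ}
    (hY : Measurable (Function.uncurry Y)) (h : HasBridgeMoments Y P x y t) (ht : 0 < t)
    {g : 𝔼 → ℝ≥0∞} (hg : Measurable g) {T : ℝ} (hT : 0 ≤ T) {D : ℝ≥0∞}
    (hD : ENNReal.ofReal (2 ^ ((d : ℝ) / 2) * Real.exp (‖y - x‖ ^ 2 / (2 * t))) ≤ D) :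
    ∫⁻ ω, (∫⁻ r in Set.Ioo T t, g (Y r ω)) ∂P
      ≤ D * ((∫⁻ r in Set.Ioi T, ENNReal.ofReal ((2 * Real.pi * r) ^ (-(d : ℝ) / 2)))
          * ∫⁻ z, g z) + D * greenPow g 1 y := by
  have h1 := h.lintegral_tailInt_pow hY hg (measurableSet_Ioo (a := T) (b := t))
    (Set.Ioo_subset_Ioo_left hT) 1 ht
  have hI : Set.Ioo T t ∩ Set.Ioi 0 = Set.Ioo T t :=
    Set.inter_eq_left.2 fun r hr ↦ hT.trans_lt hr.1
  simp only [tailInt, pow_one, Nat.factorial_one, Nat.cast_one, inv_one, mul_one, simplexInt, hI,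
    sub_zero] at h1
  rw [h1]
  have hD2 : ∀ s, t / 2 ≤ s → ∀ z : 𝔼, hk s z / hk t (y - x) ≤ D := by
    intro s hs z
    refine (hk_div_le (τ := t / 2) (by positivity) hs ht _ _).trans ?_
    rwa [div_div_cancel₀ ht.ne']
  have hsub : Set.Ioo T t ⊆ Set.Ioc T (t / 2) ∪ Set.Ioo (t / 2) t := by
    intro r hr
    rcases le_or_gt r (t / 2) with h | h
    · exact Or.inl ⟨hr.1, h⟩
    · exact Or.inr ⟨h, hr.2⟩
  refine (lintegral_mono_set hsub).trans ((lintegral_union_le _ _ _).trans (add_le_add ?_ ?_))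
  · calc _ ≤ ∫⁻ r in Set.Ioc T (t / 2), D * (ENNReal.ofReal ((2 * Real.pi * r) ^ (-(d : ℝ) / 2))
            * ∫⁻ z, g z) := by
          refine setLIntegral_mono' measurableSet_Ioc fun r hr ↦ ?_
          rw [← mul_assoc, ← lintegral_const_mul _ hg]
          refine lintegral_mono fun z ↦ ?_
          calc _ = hk (t - r) (y - z) / hk t (y - x) * hk r (z - x) * g z := by ring
            _ ≤ _ := by
              gcongr
              · exact hD2 _ (by linarith [hr.2]) _
              · exact hk_le (hT.trans_lt hr.1) le_rfl _
      _ ≤ ∫⁻ r in Set.Ioi T, D * (ENNReal.ofReal ((2 * Real.pi * r) ^ (-(d : ℝ) / 2))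
            * ∫⁻ z, g z) := lintegral_mono_set Set.Ioc_subset_Ioi_self
      _ = _ := by
          rw [lintegral_const_mul'' _ (by fun_prop), lintegral_mul_const'' _ (by fun_prop)]
  · have hm : Measurable fun r : ℝ ↦ ∫⁻ z, hk r (z - y) * (g z * greenPow g 0 z) := by
      simp only [greenPow, mul_one]
      exact Measurable.lintegral_prod_right' (f := fun p : ℝ × 𝔼 ↦ hk p.1 (p.2 - y) * g p.2)
        (by fun_prop)
    calc _ ≤ ∫⁻ r in Set.Ioo (t / 2) t, D * ∫⁻ z, hk (t - r) (z - y) * (g z * greenPow g 0 z) := by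
          refine setLIntegral_mono' measurableSet_Ioo fun r hr ↦ ?_
          rw [← lintegral_const_mul _ (by simp only [greenPow]; fun_prop)]
          refine lintegral_mono fun z ↦ ?_
          calc _ = hk r (z - x) / hk t (y - x) * (hk (t - r) (z - y) * (g z * greenPow g 0 z)) := by
                rw [hk_sub_comm (t - r) z y, ENNReal.div_eq_inv_mul, ENNReal.div_eq_inv_mul]
                simp only [greenPow]; ring
            _ ≤ _ := by
              gcongr
              exact hD2 _ hr.1.le _
      _ = D * ∫⁻ r in Set.Ioo (t / 2) t, ∫⁻ z, hk (t - r) (z - y) * (g z * greenPow g 0 z) :=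
          lintegral_const_mul _ (hm.comp (measurable_const.sub measurable_id))
      _ ≤ D * ∫⁻ r in Set.Ioi (0 : ℝ), ∫⁻ z, hk r (z - y) * (g z * greenPow g 0 z) := by
          refine mul_le_mul' le_rfl ?_
          rw [← lintegral_indicator measurableSet_Ioo, ← lintegral_indicator measurableSet_Ioi,
            ← lintegral_sub_left_eq_self ((Set.Ioi (0 : ℝ)).indicator _) t]
          refine lintegral_mono fun r ↦ ?_
          simp only [Set.indicator]
          split_ifs with h1 h2
          · exact le_rfl
          · exact absurd (sub_pos.2 h1.2) h2
          · exact zero_le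
          · exact le_rfl
      _ = _ := rfl

lemma tendsto_lintegral_Ioi_rpow (hd : 3 ≤ d) :
    Tendsto (fun T ↦ ∫⁻ r in Set.Ioi T, ENNReal.ofReal ((2 * Real.pi * r) ^ (-(d : ℝ) / 2))) atTop
      (𝓝 0) := by
  set c : ℝ → ℝ≥0∞ := fun r ↦ ENNReal.ofReal ((2 * Real.pi * r) ^ (-(d : ℝ) / 2)) with hc
  have hcm : Measurable c := by fun_prop
  have h0 : ∫⁻ r in Set.Ioi (1 : ℝ), (0 : ℝ≥0∞) = 0 := by simp
  have h : Tendsto (fun T ↦ ∫⁻ r in Set.Ioi (1 : ℝ), (Set.Ioi T).indicator c r) atTop (𝓝 0) := by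
    rw [← h0]
    refine tendsto_lintegral_filter_of_dominated_convergence c ?_ ?_ ?_ ?_
    · exact Eventually.of_forall fun T ↦ hcm.indicator measurableSet_Ioi
    · exact Eventually.of_forall fun T ↦ ae_of_all _ fun r ↦ Set.indicator_le_self _ _ _
    · exact (lintegral_Ioi_rpow_lt_top hd one_pos).ne
    · refine ae_of_all _ fun r ↦ tendsto_const_nhds.congr' ?_
      filter_upwards [eventually_ge_atTop r] with T hT
      simp [Set.indicator, not_lt.2 hT]
  refine h.congr' ?_
  filter_upwards [eventually_ge_atTop 1] with T hT
  rw [lintegral_indicator measurableSet_Ioi, Measure.restrict_restrict measurableSet_Ioi,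
    Set.inter_eq_left.2 (Set.Ioi_subset_Ioi hT)]

end Tail

end Window

/-! ### Brownian path integrals of a bounded function with bounded support. -/

section Potential

variable {d : ℕ} {v : EuclideanSpace ℝ (Fin d) → ℝ} {K R : ℝ}

local notation "𝔼" => EuclideanSpace ℝ (Fin d)

/-- The absolute value of `v`, with values in `ℝ≥0∞`. -/
def eabs (v : 𝔼 → ℝ) (z : 𝔼) : ℝ≥0∞ := ENNReal.ofReal |v z|

lemma measurable_eabs (hv : Measurable v) : Measurable (eabs v) :=
  (measurable_norm.comp hv).ennreal_ofReal

lemma eabs_le (hK : ∀ z, |v z| ≤ K) (z : 𝔼) : eabs v z ≤ ENNReal.ofReal K :=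
  ENNReal.ofReal_le_ofReal (hK z)

lemma norm_le_of_eabs_ne_zero (hR : ∀ z, v z ≠ 0 → ‖z‖ ≤ R) (z : 𝔼) (hz : eabs v z ≠ 0) :
    ‖z‖ ≤ R :=
  hR z fun h ↦ hz (by simp [eabs, h])

lemma lintegral_eabs_ne_top (hK : ∀ z, |v z| ≤ K) (hR : ∀ z, v z ≠ 0 → ‖z‖ ≤ R) :
    ∫⁻ z, eabs v z ≠ ⊤ := by
  have h : ∫⁻ z, eabs v z
      ≤ ∫⁻ z, (Metric.closedBall (0 : 𝔼) R).indicator (fun _ ↦ ENNReal.ofReal K) z := by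
    refine lintegral_mono fun z ↦ ?_
    by_cases hz : eabs v z = 0
    · simp [hz]
    · have : z ∈ Metric.closedBall (0 : 𝔼) R := by
        simpa using norm_le_of_eabs_ne_zero hR z hz
      simpa [this] using eabs_le hK z
  refine (h.trans_lt ?_).ne
  rw [lintegral_indicator measurableSet_closedBall, setLIntegral_const]
  exact ENNReal.mul_lt_top ENNReal.ofReal_lt_top measure_closedBall_lt_top

lemma exists_le_hk (R : ℝ) (x₀ : 𝔼) : ∃ c : ℝ≥0∞, c ≠ ⊤ ∧ c ≠ 0 ∧
    ∀ r ∈ Set.Ioo (1 : ℝ) 2, ∀ z : 𝔼, ‖z‖ ≤ R → c ≤ hk r (z - x₀) := by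
  refine ⟨ENNReal.ofReal ((2 * Real.pi * 2) ^ (-(d : ℝ) / 2)
    * Real.exp (-(R + ‖x₀‖) ^ 2 / 2)), ENNReal.ofReal_ne_top, ?_, fun r hr z hz ↦ ?_⟩
  · simp only [ne_eq, ENNReal.ofReal_eq_zero, not_le]
    positivity
  · refine ENNReal.ofReal_le_ofReal ?_
    have hr0 : 0 < r := lt_trans one_pos hr.1
    unfold heatKernel
    have h1 : (2 * Real.pi * 2) ^ (-(d : ℝ) / 2) ≤ (2 * Real.pi * r) ^ (-(d : ℝ) / 2) := by
      apply Real.rpow_le_rpow_of_nonpos (by positivity)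
      · have := hr.2.le
        gcongr
      · have : (0 : ℝ) ≤ d := by positivity
        linarith
    have h2 : ‖z - x₀‖ ^ 2 / (2 * r) ≤ (R + ‖x₀‖) ^ 2 / 2 := by
      have h3 : ‖z - x₀‖ ≤ R + ‖x₀‖ := (norm_sub_le _ _).trans (by gcongr)
      have h4 : (2 : ℝ) ≤ 2 * r := by linarith [hr.1]
      gcongr
    have h5 : -(R + ‖x₀‖) ^ 2 / 2 ≤ -‖z - x₀‖ ^ 2 / (2 * r) := by
      rw [neg_div, neg_div]; exact neg_le_neg h2
    gcongr

lemma exists_tsum_eabs_le (hd : 3 ≤ d) (hv : Measurable v) (hK : ∀ z, |v z| ≤ K)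
    (hR : ∀ z, v z ≠ 0 → ‖z‖ ≤ R) {β : ℝ} (x₀ : 𝔼)
    (hu : ∑' k, ENNReal.ofReal β ^ k * greenPow (eabs v) k x₀ ≠ ⊤) :
    ∃ S : ℝ≥0∞, S ≠ ⊤ ∧ ∀ x, ∑' k, ENNReal.ofReal β ^ k * greenPow (eabs v) k x ≤ S := by
  obtain ⟨c, hc', hc0, hc⟩ := exists_le_hk R x₀
  exact exists_tsum_greenPow_le hd (measurable_eabs hv) ENNReal.ofReal_ne_top (eabs_le hK) x₀ hc' hc0
    (fun r hr z hz ↦ hc r hr z (norm_le_of_eabs_ne_zero hR z hz)) ENNReal.ofReal_ne_top hu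

lemma greenPow_eabs_ne_top (hd : 3 ≤ d) (hv : Measurable v) (hK : ∀ z, |v z| ≤ K)
    (hR : ∀ z, v z ≠ 0 → ‖z‖ ≤ R) (k : ℕ) (z : 𝔼) : greenPow (eabs v) k z ≠ ⊤ := by
  obtain ⟨M, hM, h⟩ := greenPow_le_pow hd (measurable_eabs hv) ENNReal.ofReal_ne_top (eabs_le hK)
    (lintegral_eabs_ne_top hK hR)
  exact ((h k z).trans_lt (by finiteness)).ne

/-- The exponential series of Green powers converges for a small parameter. -/
lemma exists_pos_tsum_greenPow_ne_top (hd : 3 ≤ d) (hv : Measurable v) (hK : ∀ z, |v z| ≤ K)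
    (hR : ∀ z, v z ≠ 0 → ‖z‖ ≤ R) :
    ∃ α₀ : ℝ, 0 < α₀ ∧ ∀ z, ∑' k, ENNReal.ofReal α₀ ^ k * greenPow (eabs v) k z ≠ ⊤ := by
  obtain ⟨M, hM, h⟩ := greenPow_le_pow hd (measurable_eabs hv) ENNReal.ofReal_ne_top (eabs_le hK)
    (lintegral_eabs_ne_top hK hR)
  -- This makes the ratio of the dominating geometric series at most `1/2`; the added `1` covers `M
  -- = 0`.
  refine ⟨(2 * (M.toReal + 1))⁻¹, by positivity, fun z ↦ ?_⟩
  have hq : ENNReal.ofReal (2 * (M.toReal + 1))⁻¹ * M ≤ 2⁻¹ := by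
    have h0 : 0 < 2 * (M.toReal + 1) := by positivity
    conv_lhs => rw [← ENNReal.ofReal_toReal hM]
    rw [← ENNReal.ofReal_mul (by positivity)]
    simp only [ENNReal.toReal_ofReal ENNReal.toReal_nonneg]
    refine (ENNReal.ofReal_le_ofReal (q := 2⁻¹) ?_).trans (by
      rw [ENNReal.ofReal_inv_of_pos two_pos]; simp)
    rw [inv_mul_le_iff₀ h0]
    linarith
  have hle : ∑' k, ENNReal.ofReal (2 * (M.toReal + 1))⁻¹ ^ k * greenPow (eabs v) k z
      ≤ ∑' k : ℕ, (2⁻¹ : ℝ≥0∞) ^ k := by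
    refine ENNReal.tsum_le_tsum fun k ↦ ?_
    calc _ ≤ ENNReal.ofReal (2 * (M.toReal + 1))⁻¹ ^ k * M ^ k := by gcongr; exact h k z
      _ = (ENNReal.ofReal (2 * (M.toReal + 1))⁻¹ * M) ^ k := (mul_pow _ _ _).symm
      _ ≤ _ := by gcongr
  refine (hle.trans_lt ?_).ne
  rw [ENNReal.tsum_geometric, ENNReal.one_sub_inv_two, inv_inv]
  exact ENNReal.ofNat_lt_top

lemma abs_intervalIntegral_le_total {Ω : Type*} {W : ℝ → Ω → 𝔼} {ω : Ω}
    (hω : IntegrableOn (fun r ↦ v (W r ω)) (Set.Ioi 0))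
    {T : ℝ} (hT : 0 ≤ T) :
    |∫ r in (0 : ℝ)..T, v (W r ω)| ≤ ∫ r in Set.Ioi (0 : ℝ), |v (W r ω)| := by
  rw [intervalIntegral.integral_of_le hT]
  refine (abs_integral_le_integral_abs).trans ?_
  exact setIntegral_mono_set hω.abs (ae_of_all _ fun _ ↦ abs_nonneg _)
    (ae_of_all _ fun r hr ↦ hr.1)

section Brownian

variable {Ω : Type*} [MeasurableSpace Ω] {P : Measure Ω} {W : ℝ → Ω → EuclideanSpace ℝ (Fin d)}
  {x : EuclideanSpace ℝ (Fin d)}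

lemma measurable_total (hW : Measurable (Function.uncurry W)) {f : 𝔼 → ℝ} (hf : Measurable f) :
    Measurable fun ω ↦ ∫ r in Set.Ioi (0 : ℝ), f (W r ω) := by
  have : StronglyMeasurable fun p : ℝ × Ω ↦ f (W p.1 p.2) := (hf.comp hW).stronglyMeasurable
  exact this.integral_prod_left'.measurable

/-- The expectation of the integral of `|v|` is `greenPow (eabs v) 1 x`, which is finite. -/
lemma HasBrownianMoments.ae_integrableOn [SFinite P] (hW : Measurable (Function.uncurry W))
    (h : HasBrownianMoments W P x) (hd : 3 ≤ d) (hv : Measurable v) (hK : ∀ z, |v z| ≤ K)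
    (hR : ∀ z, v z ≠ 0 → ‖z‖ ≤ R) :
    ∀ᵐ ω ∂P, IntegrableOn (fun r ↦ v (W r ω)) (Set.Ioi 0) := by
  have hg := measurable_eabs hv
  have h1 := h.lintegral_tailInt_Ioi_pow hW hg 1
  simp only [pow_one, Nat.factorial_one, Nat.cast_one, inv_one, mul_one] at h1
  have hm : Measurable fun ω ↦ tailInt (Set.Ioi 0) (fun r ↦ eabs v (W r ω)) 0 :=
    (measurable_tailInt hW hg measurableSet_Ioi).comp measurable_prodMk_left
  filter_upwards [ae_lt_top hm (by rw [h1]; exact greenPow_eabs_ne_top hd hv hK hR 1 x)] with ω hω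
  refine ⟨(measurable_path hW hv ω).aestronglyMeasurable, ?_⟩
  rw [hasFiniteIntegral_iff_norm]
  simpa [tailInt, eabs] using hω

/-- Expand the exponential: each moment divided by its factorial is a Green power. This is an
identity in `ℝ≥0∞`, so it serves both to prove and to exploit finiteness. -/
lemma HasBrownianMoments.lintegral_exp_total [SFinite P] (hW : Measurable (Function.uncurry W))
    (h : HasBrownianMoments W P x) (hd : 3 ≤ d) (hv : Measurable v) (hK : ∀ z, |v z| ≤ K)
    (hR : ∀ z, v z ≠ 0 → ‖z‖ ≤ R) {β : ℝ} (hβ : 0 ≤ β) :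
    ∫⁻ ω, ENNReal.ofReal (Real.exp (β * ∫ r in Set.Ioi (0 : ℝ), |v (W r ω)|)) ∂P
      = ∑' k, ENNReal.ofReal β ^ k * greenPow (eabs v) k x := by
  have hg := measurable_eabs hv
  have hm : Measurable fun ω ↦ tailInt (Set.Ioi 0) (fun r ↦ eabs v (W r ω)) 0 :=
    (measurable_tailInt hW hg measurableSet_Ioi).comp measurable_prodMk_left
  calc _ = ∫⁻ ω, ∑' k : ℕ, ENNReal.ofReal β ^ k *
          (tailInt (Set.Ioi 0) (fun r ↦ eabs v (W r ω)) 0 ^ k * (k.factorial : ℝ≥0∞)⁻¹) ∂P := by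
        refine lintegral_congr_ae ?_
        filter_upwards [h.ae_integrableOn hW hd hv hK hR] with ω hω
        have e : tailInt (Set.Ioi 0) (fun r ↦ eabs v (W r ω)) 0
            = ENNReal.ofReal (∫ r in Set.Ioi (0 : ℝ), |v (W r ω)|) := by
          rw [ofReal_integral_eq_lintegral_ofReal hω.abs (ae_of_all _ fun _ ↦ abs_nonneg _)]
          simp [tailInt, eabs]
        rw [e, ofReal_exp_mul hβ (integral_nonneg fun _ ↦ abs_nonneg _)]
    _ = _ := by
        rw [lintegral_tsum fun k ↦ (((hm.pow_const k).mul_const _).const_mul _).aemeasurable]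
        refine tsum_congr fun k ↦ ?_
        rw [lintegral_const_mul _ ((hm.pow_const k).mul_const _), h.lintegral_tailInt_Ioi_pow hW hg k]

lemma HasBrownianMoments.integrable_exp_total [SFinite P] (hW : Measurable (Function.uncurry W))
    (h : HasBrownianMoments W P x) (hd : 3 ≤ d) (hv : Measurable v) (hK : ∀ z, |v z| ≤ K)
    (hR : ∀ z, v z ≠ 0 → ‖z‖ ≤ R) {β : ℝ} (hβ : 0 ≤ β)
    (hu : ∑' k, ENNReal.ofReal β ^ k * greenPow (eabs v) k x ≠ ⊤) :
    Integrable (fun ω ↦ Real.exp (β * ∫ r in Set.Ioi (0 : ℝ), |v (W r ω)|)) P := by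
  refine ⟨((measurable_total hW (measurable_norm.comp hv)).const_mul
    β).exp.aestronglyMeasurable, ?_⟩
  rw [hasFiniteIntegral_iff_ofReal (ae_of_all _ fun _ ↦ (Real.exp_pos _).le),
    h.lintegral_exp_total hW hd hv hK hR hβ]
  exact hu.lt_top

lemma HasBrownianMoments.integrable_exp_abs_total [SFinite P]
    (hW : Measurable (Function.uncurry W))
    (h : HasBrownianMoments W P x) (hd : 3 ≤ d) (hv : Measurable v) (hK : ∀ z, |v z| ≤ K)
    (hR : ∀ z, v z ≠ 0 → ‖z‖ ≤ R) {β : ℝ} (hβ : 0 ≤ β)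
    (hu : ∑' k, ENNReal.ofReal β ^ k * greenPow (eabs v) k x ≠ ⊤) :
    Integrable (fun ω ↦ Real.exp (β * |∫ r in Set.Ioi (0 : ℝ), v (W r ω)|)) P := by
  refine (h.integrable_exp_total hW hd hv hK hR hβ hu).mono'
    ((measurable_norm.comp (measurable_total hW hv)).const_mul β).exp.aestronglyMeasurable
    (ae_of_all _ fun ω ↦ ?_)
  rw [Real.norm_eq_abs, abs_of_pos (Real.exp_pos _)]
  gcongr
  exact abs_integral_le_integral_abs

/-- Truncated path integrals of Brownian motion converge in expectation under a dominated
continuous function. -/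
lemma HasBrownianMoments.tendsto_integral_truncation [SFinite P]
    (hW : Measurable (Function.uncurry W))
    (h : HasBrownianMoments W P x) (hd : 3 ≤ d) (hv : Measurable v) (hK : ∀ z, |v z| ≤ K)
    (hR : ∀ z, v z ≠ 0 → ‖z‖ ≤ R) {φ : ℝ → ℝ} (hφ : Continuous φ) {bound : Ω → ℝ}
    (hb : Integrable bound P)
    (hφb : ∀ᵐ ω ∂P, ∀ T, 0 ≤ T → |φ (∫ r in (0 : ℝ)..T, v (W r ω))| ≤ bound ω) :
    Tendsto (fun T ↦ ∫ ω, φ (∫ r in (0 : ℝ)..T, v (W r ω)) ∂P) atTop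
      (𝓝 (∫ ω, φ (∫ r in Set.Ioi (0 : ℝ), v (W r ω)) ∂P)) := by
  refine tendsto_integral_filter_of_dominated_convergence bound ?_ ?_ hb ?_
  · exact Eventually.of_forall fun T ↦
      (hφ.measurable.comp (measurable_intervalIntegral hW hv 0 T)).aestronglyMeasurable
  · filter_upwards [eventually_ge_atTop 0] with T hT
    filter_upwards [hφb] with ω hω using hω T hT
  · filter_upwards [h.ae_integrableOn hW hd hv hK hR] with ω hω
    exact (hφ.tendsto _).comp (intervalIntegral_tendsto_integral_Ioi 0 hω tendsto_id)

end Brownian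

end Potential

/-- On the half-line `exp(α ·)` has slope at most `|α|`, as `α ≤ 0`. -/
lemma abs_exp_sub_exp_le {α a b : ℝ} (hα : α ≤ 0) (ha : 0 ≤ a) (hb : 0 ≤ b) :
    |Real.exp (α * a) - Real.exp (α * b)| ≤ |α| * |a - b| := by
  wlog hab : b ≤ a generalizing a b
  · rw [abs_sub_comm, abs_sub_comm a]
    exact this hb ha (le_of_not_ge hab)
  have h1 : Real.exp (α * a) ≤ Real.exp (α * b) := Real.exp_le_exp.2 (by nlinarith)
  have h2 : Real.exp (α * b) ≤ 1 := Real.exp_le_one_iff.2 (mul_nonpos_of_nonpos_of_nonneg hα hb)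
  rw [abs_sub_comm, abs_of_nonneg (sub_nonneg.2 h1), abs_of_nonpos hα,
    abs_of_nonneg (sub_nonneg.2 hab)]
  have e : Real.exp (α * a) = Real.exp (α * b) * Real.exp (α * (a - b)) := by
    rw [← Real.exp_add]; ring_nf
  have h3 := Real.add_one_le_exp (α * (a - b))
  have h4 : 0 ≤ -α * (a - b) := mul_nonneg (by linarith) (by linarith)
  have h5 := Real.exp_pos (α * b)
  rw [e]
  nlinarith

/-! ### Convergence for jointly measurable versions. -/

section Setting

variable {d : ℕ}

local notation "𝔼" => EuclideanSpace ℝ (Fin d)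

lemma integrable_exp_abs_window {Ω : Type*} [MeasurableSpace Ω] {P : Measure Ω}
    [IsProbabilityMeasure P] {Y : ℝ → Ω → 𝔼} (hY : Measurable (Function.uncurry Y)) {v : 𝔼 → ℝ}
    (hv : Measurable v) {K : ℝ} (hK : ∀ z, |v z| ≤ K) {T : ℝ} (hT : 0 ≤ T) {β : ℝ} (hβ : 0 ≤ β) :
    Integrable (fun ω ↦ Real.exp (β * |∫ r in (0 : ℝ)..T, v (Y r ω)|)) P ∧
      ∫ ω, Real.exp (β * |∫ r in (0 : ℝ)..T, v (Y r ω)|) ∂P ≤ Real.exp (β * (K * T)) := by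
  have hle : ∀ ω, Real.exp (β * |∫ r in (0 : ℝ)..T, v (Y r ω)|) ≤ Real.exp (β * (K * T)) :=
    fun ω ↦ by
      gcongr
      exact abs_intervalIntegral_path_le hK ω hT
  have hi : Integrable (fun ω ↦ Real.exp (β * |∫ r in (0 : ℝ)..T, v (Y r ω)|)) P :=
    Integrable.of_bound ((measurable_intervalIntegral hY hv 0 T).norm.const_mul
      β).exp.aestronglyMeasurable (Real.exp (β * (K * T))) (ae_of_all _ fun ω ↦ by
        rw [Real.norm_eq_abs, abs_of_pos (Real.exp_pos _)]; exact hle ω)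
  exact ⟨hi, (integral_mono hi (integrable_const _) hle).trans_eq (by simp)⟩

variable {Ω : ℝ≥0 → Type*} [∀ t, MeasurableSpace (Ω t)]
  {Ω' : Type*} [MeasurableSpace Ω']

/-- Jointly measurable processes `Y t`, distributed as Brownian bridges from `x t` to `y t` running
for time `t`, and `W`, distributed as Brownian motion from `x₀`, with the asymptotics of the end
points; `v` is bounded by `K` and supported in the ball of radius `R`. -/
structure BridgeAsymptotics (P : ∀ t, Measure (Ω t)) (Y : ∀ t, ℝ → Ω t → EuclideanSpace ℝ (Fin d))
    (x y : ℝ≥0 → EuclideanSpace ℝ (Fin d)) (Q : Measure Ω') (W : ℝ → Ω' → EuclideanSpace ℝ (Fin d))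
    (x₀ : EuclideanSpace ℝ (Fin d)) (v : EuclideanSpace ℝ (Fin d) → ℝ) (C K R : ℝ) : Prop where
  three_le : 3 ≤ d
  prob : ∀ t, 0 < t → IsProbabilityMeasure (P t)
  measurable_bridge : ∀ t, Measurable (Function.uncurry (Y t))
  bridge : ∀ t, 0 < t → HasBridgeMoments (Y t) (P t) (x t) (y t) t
  prob_motion : IsProbabilityMeasure Q
  measurable_motion : Measurable (Function.uncurry W)
  motion : HasBrownianMoments W Q x₀
  start : Tendsto x atTop (𝓝 x₀)
  finish : Tendsto (fun t ↦ ‖y t‖) atTop atTop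
  finish_sq : ∀ᶠ t : ℝ≥0 in atTop, ‖y t‖ ^ 2 / (t : ℝ) ≤ C
  measurable : Measurable v
  bound : ∀ z, |v z| ≤ K
  supp : ∀ z, v z ≠ 0 → ‖z‖ ≤ R

namespace BridgeAsymptotics

variable {P : ∀ t, Measure (Ω t)} {Y : ∀ t, ℝ → Ω t → EuclideanSpace ℝ (Fin d)}
  {x y : ℝ≥0 → EuclideanSpace ℝ (Fin d)} {Q : Measure Ω'} {W : ℝ → Ω' → EuclideanSpace ℝ (Fin d)}
  {x₀ : EuclideanSpace ℝ (Fin d)} {v : EuclideanSpace ℝ (Fin d) → ℝ} {C K R : ℝ}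

lemma measurable_abs (h : BridgeAsymptotics P Y x y Q W x₀ v C K R) : Measurable fun z ↦ |v z| :=
  measurable_norm.comp h.measurable

/-- Exponential moments of the path integrals of `|v|` over the bridges are bounded. -/
lemma exists_integral_exp_le (h : BridgeAsymptotics P Y x y Q W x₀ v C K R) {β : ℝ} (hβ : 0 ≤ β)
    {S : ℝ≥0∞} (hS' : S ≠ ⊤) (hS : ∀ z, ∑' k, ENNReal.ofReal β ^ k * greenPow (eabs v) k z ≤ S)
    {n : ℕ} (hn : 0 < n) :
    ∃ B : ℝ, ∀ᶠ t : ℝ≥0 in atTop,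
      Integrable (fun ω ↦ Real.exp (β * (1 - 1 / n) * ∫ r in (0 : ℝ)..t, |v (Y t r ω)|)) (P t) ∧
      ∫ ω, Real.exp (β * (1 - 1 / n) * ∫ r in (0 : ℝ)..t, |v (Y t r ω)|) ∂P t ≤ B := by
  set B : ℝ≥0∞ := n * (ENNReal.ofReal ((n : ℝ) ^ ((d : ℝ) / 2) * Real.exp (C + 1)) * S * S) with hB
  have hB' : B ≠ ⊤ := by finiteness
  refine ⟨B.toReal, ?_⟩
  filter_upwards [eventually_norm_sub_sq_div_le h.start h.finish_sq, eventually_gt_atTop 0]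
    with t ht ht0
  have := h.prob t ht0
  have hle : ∫⁻ ω, ENNReal.ofReal (Real.exp (β * (1 - 1 / n) *
      ∫ r in (0 : ℝ)..t, |v (Y t r ω)|)) ∂P t ≤ B := by
    refine ((h.bridge t ht0).lintegral_exp_le (h.measurable_bridge t) ht0 h.measurable_abs
      (fun _ ↦ abs_nonneg _) h.bound
      (greenPow_eabs_ne_top h.three_le h.measurable h.bound h.supp) hβ hS hn).trans ?_
    rw [hB]
    gcongr
  have hm := (((measurable_intervalIntegral (h.measurable_bridge t) h.measurable_abs 0
    t).const_mul (β * (1 - 1 / n))).exp).aestronglyMeasurable (μ := P t)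
  have h0 : 0 ≤ᵐ[P t] fun ω ↦ Real.exp (β * (1 - 1 / n) * ∫ r in (0 : ℝ)..t, |v (Y t r ω)|) :=
    ae_of_all _ fun _ ↦ (Real.exp_pos _).le
  refine ⟨⟨hm, ?_⟩, ?_⟩
  · rw [hasFiniteIntegral_iff_ofReal h0]
    exact hle.trans_lt hB'.lt_top
  · rw [integral_eq_lintegral_of_nonneg_ae h0 hm]
    exact ENNReal.toReal_mono hB' hle

lemma integrable_exp_motion (h : BridgeAsymptotics P Y x y Q W x₀ v C K R) {β : ℝ} (hβ : 0 ≤ β)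
    (hu : ∑' k, ENNReal.ofReal β ^ k * greenPow (eabs v) k x₀ ≠ ⊤) :
    Integrable (fun ω ↦ Real.exp (β * ∫ r in Set.Ioi (0 : ℝ), |v (W r ω)|)) Q :=
  have := h.prob_motion
  h.motion.integrable_exp_total h.measurable_motion h.three_le h.measurable h.bound h.supp hβ hu

lemma abs_window_le (h : BridgeAsymptotics P Y x y Q W x₀ v C K R) {T : ℝ} (hT : 0 ≤ T) {t : ℝ≥0}
    (hTt : T ≤ t) (ω : Ω t) :
    |∫ r in (0 : ℝ)..T, v (Y t r ω)| ≤ ∫ r in (0 : ℝ)..t, |v (Y t r ω)| := by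
  refine (intervalIntegral.abs_integral_le_integral_abs hT).trans ?_
  exact intervalIntegral.integral_mono_interval le_rfl hT hTt (ae_of_all _ fun _ ↦ abs_nonneg _)
    (intervalIntegrable_path (h.measurable_bridge t) h.measurable_abs
      (fun z ↦ (abs_abs (v z)).trans_le (h.bound z)) ω 0 t)

lemma ofReal_abs_sub_le (h : BridgeAsymptotics P Y x y Q W x₀ v C K R) {T : ℝ}
    {t : ℝ≥0} (hTt : T ≤ t) (ω : Ω t) :
    ENNReal.ofReal |(∫ r in (0 : ℝ)..t, v (Y t r ω)) - ∫ r in (0 : ℝ)..T, v (Y t r ω)|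
      ≤ ∫⁻ r in Set.Ioo T t, eabs v (Y t r ω) := by
  have hi := intervalIntegrable_path (h.measurable_bridge t) h.measurable h.bound ω
  rw [intervalIntegral.integral_interval_sub_left (hi _ _) (hi _ _),
    intervalIntegral.integral_of_le hTt, ← Real.norm_eq_abs]
  rw [setLIntegral_congr Ioo_ae_eq_Ioc, ofReal_norm]
  refine (enorm_integral_le_lintegral_enorm _).trans (lintegral_mono fun r ↦ ?_)
  simp only [eabs, ← Real.norm_eq_abs, ofReal_norm]
  exact le_rfl

/-- The part of the path integral after a large time is uniformly small in `L¹`. -/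
lemma eventually_integral_abs_sub_le (h : BridgeAsymptotics P Y x y Q W x₀ v C K R) {ε : ℝ}
    (hε : 0 < ε) :
    ∀ᶠ T : ℝ in atTop, ∀ᶠ t : ℝ≥0 in atTop,
      ∫ ω, |(∫ r in (0 : ℝ)..t, v (Y t r ω)) - ∫ r in (0 : ℝ)..T, v (Y t r ω)| ∂P t ≤ ε := by
  set D : ℝ≥0∞ := ENNReal.ofReal (2 ^ ((d : ℝ) / 2) * Real.exp (C + 1)) with hD
  have hD' : D ≠ ⊤ := ENNReal.ofReal_ne_top
  have hN := lintegral_eabs_ne_top h.bound h.supp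
  have hε2 : 0 < ENNReal.ofReal (ε / 2) := by simpa using hε
  have h1 : Tendsto (fun T ↦ D * ((∫⁻ r in Set.Ioi T,
      ENNReal.ofReal ((2 * Real.pi * r) ^ (-(d : ℝ) / 2))) * ∫⁻ z, eabs v z)) atTop (𝓝 0) := by
    have := ENNReal.Tendsto.const_mul (a := D) (ENNReal.Tendsto.mul_const (b := ∫⁻ z, eabs v z)
      (tendsto_lintegral_Ioi_rpow h.three_le) (Or.inr hN)) (Or.inr hD')
    simpa using this
  have h2 : Tendsto (fun t ↦ D * greenPow (eabs v) 1 (y t)) atTop (𝓝 0) := by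
    have := ENNReal.Tendsto.const_mul (a := D) (tendsto_greenPow_one h.three_le
      (measurable_eabs h.measurable) ENNReal.ofReal_ne_top (eabs_le h.bound) hN
      (norm_le_of_eabs_ne_zero h.supp) h.finish) (Or.inr hD')
    simpa using this
  filter_upwards [h1.eventually_le_const hε2, eventually_ge_atTop 0] with T hT hT0
  have hTt : Tendsto (fun t : ℝ≥0 ↦ (t : ℝ)) atTop atTop := NNReal.tendsto_coe_atTop.2 tendsto_id
  filter_upwards [h2.eventually_le_const hε2, eventually_norm_sub_sq_div_le h.start h.finish_sq,
    eventually_gt_atTop 0, hTt.eventually_ge_atTop T] with t h3 h4 ht0 htT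
  have := h.prob t ht0
  have hY := h.measurable_bridge t
  have hm : Measurable fun ω ↦
      |(∫ r in (0 : ℝ)..t, v (Y t r ω)) - ∫ r in (0 : ℝ)..T, v (Y t r ω)| :=
    measurable_norm.comp ((measurable_intervalIntegral hY h.measurable 0 t).sub
      (measurable_intervalIntegral hY h.measurable 0 T))
  rw [integral_eq_lintegral_of_nonneg_ae (ae_of_all _ fun _ ↦ abs_nonneg _)
    hm.aestronglyMeasurable]
  refine ENNReal.toReal_le_of_le_ofReal hε.le ?_
  calc _ ≤ ∫⁻ ω, (∫⁻ r in Set.Ioo T t, eabs v (Y t r ω)) ∂P t :=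
        lintegral_mono fun ω ↦ h.ofReal_abs_sub_le htT ω
    _ ≤ _ := (h.bridge t ht0).lintegral_tail_le hY ht0 (measurable_eabs h.measurable) hT0 (D := D)
        (by rw [hD]; gcongr)
    _ ≤ ENNReal.ofReal (ε / 2) + ENNReal.ofReal (ε / 2) := add_le_add hT h3
    _ = ENNReal.ofReal ε := by
        rw [← ENNReal.ofReal_add (by positivity) (by positivity), add_halves]

lemma tendsto_window (h : BridgeAsymptotics P Y x y Q W x₀ v C K R) {T : ℝ} (hT : 0 < T) (k : ℕ) :
    Tendsto (fun t ↦ ∫ ω, (∫ r in (0 : ℝ)..T, v (Y t r ω)) ^ k ∂P t) atTop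
      (𝓝 (∫ ω, (∫ r in (0 : ℝ)..T, v (W r ω)) ^ k ∂Q)) :=
  have := h.prob_motion
  tendsto_window_pow h.prob h.measurable_bridge h.bridge h.measurable_motion h.motion h.start
    h.finish_sq h.measurable h.bound hT k

/-- Convergence of the moments of the path integrals. -/
lemma tendsto_moment (h : BridgeAsymptotics P Y x y Q W x₀ v C K R) (k : ℕ) :
    Tendsto (fun t : ℝ≥0 ↦ ∫ ω, (∫ r in (0 : ℝ)..t, v (Y t r ω)) ^ k ∂P t) atTop
      (𝓝 (∫ ω, (∫ r in Set.Ioi (0 : ℝ), v (W r ω)) ^ k ∂Q)) := by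
  have := h.prob_motion
  obtain ⟨β, hβ, hu⟩ := exists_pos_tsum_greenPow_ne_top h.three_le h.measurable h.bound h.supp
  obtain ⟨S, hS', hS⟩ := exists_tsum_eabs_le h.three_le h.measurable h.bound h.supp x₀ (hu x₀)
  -- Two pieces suffice: for moments any positive exponential order will do.
  obtain ⟨B, hB⟩ := h.exists_integral_exp_le hβ.le hS' hS two_pos
  set γ : ℝ := β * (1 - 1 / (2 : ℕ)) with hγ
  have hγ0 : 0 < γ := by rw [hγ]; norm_num; exact hβ
  refine tendsto_of_truncation (fun T hT ↦ h.tendsto_window hT k)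
    (h.motion.tendsto_integral_truncation h.measurable_motion h.three_le h.measurable h.bound h.supp
      (φ := fun z ↦ z ^ k) (continuous_pow k)
      (bound := fun ω ↦ (∫ r in Set.Ioi (0 : ℝ), |v (W r ω)|) ^ k) ?_ ?_) ?_
  · refine integrable_pow_of_exp (measurable_total h.measurable_motion h.measurable_abs).aemeasurable
      hβ ?_ k
    simpa only [abs_of_nonneg (integral_nonneg fun _ ↦ abs_nonneg _)]
      using h.integrable_exp_motion hβ.le (hu x₀)
  · filter_upwards [h.motion.ae_integrableOn h.measurable_motion h.three_le h.measurable h.bound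
      h.supp] with ω hω T hT
    simp only [abs_pow]
    exact pow_le_pow_left₀ (abs_nonneg _) (abs_intervalIntegral_le_total hω hT) k
  · intro ε hε
    have hA : Tendsto (fun N : ℝ ↦ 2 * k / N * ((k + 1).factorial / γ ^ (k + 1) * B)) atTop
        (𝓝 0) := by
      have := (tendsto_const_nhds (x := 2 * (k : ℝ))).div_atTop tendsto_id
      simpa using this.mul_const ((k + 1).factorial / γ ^ (k + 1) * B)
    -- `N` is fixed first, making the contribution of large values at most `ε / 2`; the tolerance in
    -- `L¹` is then chosen in terms of `N`.
    obtain ⟨N, hN, hN0⟩ :=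
      ((hA.eventually_le_const (half_pos hε)).and (eventually_gt_atTop 0)).exists
    have hc : 0 < ε / 2 / (k * N ^ (k - 1) + 1) := by positivity
    filter_upwards [h.eventually_integral_abs_sub_le hc, eventually_ge_atTop 0] with T hT hT0
    have hTt : Tendsto (fun t : ℝ≥0 ↦ (t : ℝ)) atTop atTop := NNReal.tendsto_coe_atTop.2 tendsto_id
    filter_upwards [hT, hB, hTt.eventually_ge_atTop T] with t h1 h2 h3
    have hm : ∀ T, AEMeasurable (fun ω ↦ ∫ r in (0 : ℝ)..T, v (Y t r ω)) (P t) := fun T ↦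
      (measurable_intervalIntegral (h.measurable_bridge t) h.measurable 0 T).aemeasurable
    refine (abs_integral_pow_sub_le (hm t) (hm T)
      (measurable_intervalIntegral (h.measurable_bridge t) h.measurable_abs 0 t).aemeasurable
      (h.abs_window_le t.2 le_rfl) (h.abs_window_le hT0 h3) hγ0 h2.1 h2.2 hN0 k).trans ?_
    have h4 : k * N ^ (k - 1) *
        ∫ ω, |(∫ r in (0 : ℝ)..t, v (Y t r ω)) - ∫ r in (0 : ℝ)..T, v (Y t r ω)| ∂P t ≤ ε / 2 := by
      calc _ ≤ (k * N ^ (k - 1) + 1) * (ε / 2 / (k * N ^ (k - 1) + 1)) := by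
            gcongr
            exact (lt_add_one _).le
        _ = ε / 2 := by field_simp
    linarith

/-- Convergence of the exponential moments of order less than `β` if the absolute path integral of
Brownian motion has a finite exponential moment of order `β`. -/
lemma tendsto_exp (h : BridgeAsymptotics P Y x y Q W x₀ v C K R) {α β : ℝ} (hαβ : |α| < β)
    (hi : Integrable (fun ω ↦ Real.exp (β * ∫ r in Set.Ioi (0 : ℝ), |v (W r ω)|)) Q) :
    Integrable (fun ω ↦ Real.exp (α * ∫ r in Set.Ioi (0 : ℝ), v (W r ω))) Q ∧
    Tendsto (fun t : ℝ≥0 ↦ ∫ ω, Real.exp (α * ∫ r in (0 : ℝ)..t, v (Y t r ω)) ∂P t) atTop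
      (𝓝 (∫ ω, Real.exp (α * ∫ r in Set.Ioi (0 : ℝ), v (W r ω)) ∂Q)) := by
  have := h.prob_motion
  have hβ : 0 < β := (abs_nonneg α).trans_lt hαβ
  -- Integrability at `x₀` is read as convergence of the Green series there, which then is bounded
  -- over all starting points.
  have hu : ∑' k, ENNReal.ofReal β ^ k * greenPow (eabs v) k x₀ ≠ ⊤ := by
    rw [← h.motion.lintegral_exp_total h.measurable_motion h.three_le h.measurable h.bound h.supp
      hβ.le]
    exact ((hasFiniteIntegral_iff_ofReal (ae_of_all _ fun _ ↦ (Real.exp_pos _).le)).1 hi.2).ne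
  obtain ⟨S, hS', hS⟩ := exists_tsum_eabs_le h.three_le h.measurable h.bound h.supp x₀ hu
  -- The strict inequality `|α| < β` leaves room for the loss `1/n`.
  obtain ⟨n, hn0, hn⟩ : ∃ n : ℕ, 0 < n ∧ |α| < β * (1 - 1 / n) := by
    have h1 : Tendsto (fun n : ℕ ↦ β * (1 - 1 / (n : ℝ))) atTop (𝓝 (β * (1 - 0))) :=
      (tendsto_const_nhds.sub tendsto_one_div_atTop_nhds_zero_nat).const_mul β
    rw [sub_zero, mul_one] at h1
    exact ((eventually_gt_atTop 0).and (h1.eventually_const_lt hαβ)).exists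
  obtain ⟨B, hB⟩ := h.exists_integral_exp_le hβ.le hS' hS hn0
  set γ : ℝ := β * (1 - 1 / n) with hγ
  have hγ0 : 0 < γ := (abs_nonneg α).trans_lt hn
  have hγβ : γ ≤ β := mul_le_of_le_one_right hβ.le (by simp)
  have hWm := (measurable_total h.measurable_motion h.measurable).aemeasurable (μ := Q)
  have hYi : Integrable (fun ω ↦ Real.exp (γ * |∫ r in Set.Ioi (0 : ℝ), v (W r ω)|)) Q := by
    refine hi.mono' (hWm.abs.const_mul γ).exp.aestronglyMeasurable (ae_of_all _ fun ω ↦ ?_)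
    rw [Real.norm_eq_abs, abs_of_pos (Real.exp_pos _)]
    gcongr
    exact abs_integral_le_integral_abs
  refine ⟨integrable_exp_of_abs hWm hn.le hYi,
    tendsto_integral_exp_of_moments (B := B) hn ?_ hWm hYi h.tendsto_moment⟩
  filter_upwards [hB] with t ht
  have hm := (measurable_intervalIntegral (h.measurable_bridge t) h.measurable 0 t).aemeasurable
    (μ := P t)
  have hle : ∀ ω, Real.exp (γ * |∫ r in (0 : ℝ)..t, v (Y t r ω)|)
      ≤ Real.exp (γ * ∫ r in (0 : ℝ)..t, |v (Y t r ω)|) := fun ω ↦ by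
    gcongr
    exact h.abs_window_le t.2 le_rfl ω
  have hint : Integrable (fun ω ↦ Real.exp (γ * |∫ r in (0 : ℝ)..t, v (Y t r ω)|)) (P t) :=
    ht.1.mono' (hm.abs.const_mul γ).exp.aestronglyMeasurable (ae_of_all _ fun ω ↦ by
      rw [Real.norm_eq_abs, abs_of_pos (Real.exp_pos _)]; exact hle ω)
  exact ⟨hm, hint, (integral_mono hint ht.1 hle).trans ht.2⟩

/-- Convergence of the exponential moments of nonpositive order for nonnegative `v`. -/
lemma tendsto_exp_of_nonpos (h : BridgeAsymptotics P Y x y Q W x₀ v C K R) (h0 : ∀ z, 0 ≤ v z)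
    {α : ℝ} (hα : α ≤ 0) :
    Tendsto (fun t : ℝ≥0 ↦ ∫ ω, Real.exp (α * ∫ r in (0 : ℝ)..t, v (Y t r ω)) ∂P t) atTop
      (𝓝 (∫ ω, Real.exp (α * ∫ r in Set.Ioi (0 : ℝ), v (W r ω)) ∂Q)) := by
  have := h.prob_motion
  refine tendsto_of_truncation (aT := fun T t ↦
      ∫ ω, Real.exp (α * ∫ r in (0 : ℝ)..T, v (Y t r ω)) ∂P t)
    (b := fun T ↦ ∫ ω, Real.exp (α * ∫ r in (0 : ℝ)..T, v (W r ω)) ∂Q) (fun T hT ↦ ?_)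
    (h.motion.tendsto_integral_truncation h.measurable_motion h.three_le h.measurable h.bound h.supp
      (φ := fun z ↦ Real.exp (α * z)) (by fun_prop) (integrable_const 1) ?_) ?_
  -- Over a bounded window the integral is bounded by `K * T`, so any order beyond `|α|` serves and
  -- convergence of moments suffices.
  · refine tendsto_integral_exp_of_moments (β := |α| + 1) (B := Real.exp ((|α| + 1) * (K * T)))
      (lt_add_one _) ?_ (measurable_intervalIntegral h.measurable_motion h.measurable 0 T).aemeasurable
      (integrable_exp_abs_window h.measurable_motion h.measurable h.bound hT.le (by positivity)).1
      (h.tendsto_window hT)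
    filter_upwards [eventually_gt_atTop 0] with t ht
    have := h.prob t ht
    exact ⟨(measurable_intervalIntegral (h.measurable_bridge t) h.measurable 0 T).aemeasurable,
      integrable_exp_abs_window (h.measurable_bridge t) h.measurable h.bound hT.le (by positivity)⟩
  · refine ae_of_all _ fun ω T hT ↦ ?_
    rw [abs_of_pos (Real.exp_pos _)]
    exact Real.exp_le_one_iff.2 (mul_nonpos_of_nonpos_of_nonneg hα
      (intervalIntegral.integral_nonneg hT fun _ _ ↦ h0 _))
  · intro ε hε
    have hc : 0 < ε / (|α| + 1) := by positivity
    filter_upwards [h.eventually_integral_abs_sub_le hc, eventually_ge_atTop 0] with T hT hT0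
    filter_upwards [hT, eventually_gt_atTop 0] with t h1 ht
    have := h.prob t ht
    have hm : ∀ T, Measurable (fun ω ↦ ∫ r in (0 : ℝ)..T, v (Y t r ω)) := fun T ↦
      measurable_intervalIntegral (h.measurable_bridge t) h.measurable 0 T
    have hi : ∀ T, 0 ≤ T → Integrable (fun ω ↦ ∫ r in (0 : ℝ)..T, v (Y t r ω)) (P t) := fun T hT ↦
      Integrable.of_bound (hm T).aestronglyMeasurable (K * T)
        (ae_of_all _ fun ω ↦ abs_intervalIntegral_path_le h.bound ω hT)
    have he : ∀ T, 0 ≤ T →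
        Integrable (fun ω ↦ Real.exp (α * ∫ r in (0 : ℝ)..T, v (Y t r ω))) (P t) := fun T hT ↦
      integrable_exp_of_abs (hm T).aemeasurable le_rfl
        (integrable_exp_abs_window (h.measurable_bridge t) h.measurable h.bound hT
          (abs_nonneg α)).1
    have hn : ∀ T, 0 ≤ T → ∀ ω, 0 ≤ ∫ r in (0 : ℝ)..T, v (Y t r ω) := fun T hT ω ↦
      intervalIntegral.integral_nonneg hT fun _ _ ↦ h0 _
    rw [← integral_sub (he t t.2) (he T hT0)]
    refine abs_integral_le_integral_abs.trans ?_
    calc _ ≤ ∫ ω, |α| * |(∫ r in (0 : ℝ)..t, v (Y t r ω)) - ∫ r in (0 : ℝ)..T, v (Y t r ω)| ∂P t :=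
          integral_mono ((he t t.2).sub (he T hT0)).abs
            (((hi t t.2).sub (hi T hT0)).abs.const_mul |α|) fun ω ↦
            abs_exp_sub_exp_le hα (hn t t.2 ω) (hn T hT0 ω)
      _ = |α| * ∫ ω, |(∫ r in (0 : ℝ)..t, v (Y t r ω)) - ∫ r in (0 : ℝ)..T, v (Y t r ω)| ∂P t :=
          integral_const_mul _ _
      _ ≤ (|α| + 1) * (ε / (|α| + 1)) := by
          gcongr
          exact (lt_add_one _).le
      _ = ε := by field_simp

end BridgeAsymptotics

end Setting

/-! ### Transfer between the given processes and their measurable versions. -/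

section Transfer

variable {d : ℕ} {Ω : Type*} [MeasurableSpace Ω] {P : Measure Ω}

local notation "𝔼" => EuclideanSpace ℝ (Fin d)

lemma pathIntegral_ae_eq {X : ℝ≥0 → Ω → 𝔼} {Y : ℝ → Ω → 𝔼} {t : ℝ≥0}
    (h : ∀ᵐ ω ∂P, ∀ s ∈ Set.Icc (0 : ℝ) t, Y s ω = X s.toNNReal ω) (v : 𝔼 → ℝ) :
    pathIntegral v X t =ᵐ[P] fun ω ↦ ∫ s in (0 : ℝ)..t, v (Y s ω) := by
  filter_upwards [h] with ω hω
  refine intervalIntegral.integral_congr fun s hs ↦ ?_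
  rw [Set.uIcc_of_le t.coe_nonneg] at hs
  simp only [hω s hs]

lemma totalPathIntegral_ae_eq {W : ℝ≥0 → Ω → 𝔼} {Y : ℝ → Ω → 𝔼}
    (h : ∀ᵐ ω ∂P, ∀ s, Y s ω = W s.toNNReal ω) (v : 𝔼 → ℝ) :
    totalPathIntegral v W =ᵐ[P] fun ω ↦ ∫ s in Set.Ioi (0 : ℝ), v (Y s ω) := by
  filter_upwards [h] with ω hω
  simp only [totalPathIntegral, hω]

lemma IsBrownianMotion.ae_integrableOn {W : ℝ≥0 → Ω → 𝔼} {x : 𝔼} (h : IsBrownianMotion W x P)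
    (hd : 3 ≤ d) {v : 𝔼 → ℝ} (hv : Measurable v) {K R : ℝ} (hK : ∀ z, |v z| ≤ K)
    (hR : ∀ z, v z ≠ 0 → ‖z‖ ≤ R) :
    ∀ᵐ ω ∂P, IntegrableOn (fun s : ℝ ↦ v (W s.toNNReal ω)) (Set.Ioi 0) := by
  obtain ⟨_, Y, hY, he, hm⟩ := h.exists_version
  filter_upwards [hm.ae_integrableOn hY hd hv hK hR, he] with ω h1 h2
  simpa only [h2] using h1

/-- Exponential moments of small order of the absolute path integrals are finite. -/
lemma exists_pos_absExpFinite {W : 𝔼 → ℝ≥0 → Ω → 𝔼} (h : ∀ z, IsBrownianMotion (W z) z P)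
    (hd : 3 ≤ d) {v : 𝔼 → ℝ} (hv : Measurable v) {K R : ℝ} (hK : ∀ z, |v z| ≤ K)
    (hR : ∀ z, v z ≠ 0 → ‖z‖ ≤ R) : ∃ α₀ : ℝ, 0 < α₀ ∧ AbsExpFinite v W P α₀ := by
  obtain ⟨β, hβ, hu⟩ := exists_pos_tsum_greenPow_ne_top hd hv hK hR
  refine ⟨β, hβ, fun α hα z ↦ ?_⟩
  obtain ⟨_, Y, hY, he, hm⟩ := (h z).exists_version
  have hmt := (measurable_total hY (measurable_norm.comp hv)).aemeasurable (μ := P)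
  refine (integrable_exp_of_abs hmt hα.le ?_).congr ?_
  · simp only [Function.comp_def, Real.norm_eq_abs,
      abs_of_nonneg (integral_nonneg fun _ ↦ abs_nonneg _)]
    exact hm.integrable_exp_total hY hd hv hK hR hβ.le (hu z)
  · filter_upwards [totalPathIntegral_ae_eq he fun z ↦ |v z|] with ω hω
    rw [hω]
    rfl

/-- For nonnegative `v` the one-sided condition on exponential moments implies the two-sided one. -/
lemma ExpFiniteBelow.absExpFinite {W : 𝔼 → ℝ≥0 → Ω → 𝔼} {v : 𝔼 → ℝ} (h0 : ∀ z, 0 ≤ v z) {α₁ : ℝ}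
    (h : ExpFiniteBelow v W P α₁) : AbsExpFinite v W P α₁ := by
  intro α hα z
  simpa only [abs_of_nonneg (h0 _)] using h α ((le_abs_self α).trans_lt hα) z

end Transfer

end

end BridgeIntegral

theorem theorem2 {d : ℕ} (hd : 3 ≤ d)
    (v : EuclideanSpace ℝ (Fin d) → ℝ) (hv : Measurable v)
    (hv_bdd : ∃ K : ℝ, ∀ z, |v z| ≤ K)
    (hv_supp : Bornology.IsBounded (Function.support v))
    (x y : ℝ≥0 → EuclideanSpace ℝ (Fin d)) (x₀ : EuclideanSpace ℝ (Fin d))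
    (hx : Tendsto x atTop (𝓝 x₀))
    (hy : Tendsto (fun t ↦ ‖y t‖) atTop atTop)
    (hy_bdd : ∃ C : ℝ, ∀ᶠ t : ℝ≥0 in atTop, ‖y t‖ ^ 2 / (t : ℝ) ≤ C)
    -- for each `t > 0`, a Brownian bridge from `x t` to `y t` running for time `t`
    {Ω : ℝ≥0 → Type*} [∀ t, MeasurableSpace (Ω t)] (P : ∀ t, Measure (Ω t))
    (X : ∀ t, ℝ≥0 → Ω t → EuclideanSpace ℝ (Fin d))
    (hX : ∀ t, 0 < t → BridgeIntegral.IsBrownianBridge (X t) (x t) (y t) t (P t))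
    -- for each `z`, a Brownian motion started at `z`
    {Ω' : Type*} [MeasurableSpace Ω'] (Q : Measure Ω')
    (W : EuclideanSpace ℝ (Fin d) → ℝ≥0 → Ω' → EuclideanSpace ℝ (Fin d))
    (hW : ∀ z, BridgeIntegral.IsBrownianMotion (W z) z Q) :
    -- the path integrals of Brownian motion converge absolutely, almost surely
    (∀ z, ∀ᵐ ω ∂Q, IntegrableOn (fun s : ℝ ↦ v (W z s.toNNReal ω)) (Set.Ioi 0)) ∧
    -- convergence of moments
    (∀ k : ℕ,
      (∀ t, 0 < t →
        Integrable (fun ω ↦ BridgeIntegral.pathIntegral v (X t) t ω ^ k) (P t)) ∧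
      Integrable (fun ω ↦ BridgeIntegral.totalPathIntegral v (W x₀) ω ^ k) Q ∧
      Tendsto (fun t ↦ moment (BridgeIntegral.pathIntegral v (X t) t) k (P t)) atTop
        (𝓝 (moment (BridgeIntegral.totalPathIntegral v (W x₀)) k Q))) ∧
    -- convergence of moment generating functions on `(-α₀, α₀)`
    (∃ α₀ : ℝ, 0 < α₀ ∧ BridgeIntegral.AbsExpFinite v W Q α₀) ∧
    (∀ α₀ : ℝ, BridgeIntegral.AbsExpFinite v W Q α₀ → ∀ α : ℝ, |α| < α₀ →
      (∀ t, 0 < t →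
        Integrable (fun ω ↦ Real.exp (α * BridgeIntegral.pathIntegral v (X t) t ω)) (P t)) ∧
      Integrable (fun ω ↦ Real.exp (α * BridgeIntegral.totalPathIntegral v (W x₀) ω)) Q ∧
      Tendsto (fun t ↦ mgf (BridgeIntegral.pathIntegral v (X t) t) (P t) α) atTop
        (𝓝 (mgf (BridgeIntegral.totalPathIntegral v (W x₀)) Q α))) ∧
    -- convergence of moment generating functions on `(-∞, α₁)` for nonnegative `v`
    ((∀ z, 0 ≤ v z) →
      ∀ α₁ : ℝ, BridgeIntegral.ExpFiniteBelow v W Q α₁ → ∀ α : ℝ, α < α₁ →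
      (∀ t, 0 < t →
        Integrable (fun ω ↦ Real.exp (α * BridgeIntegral.pathIntegral v (X t) t ω)) (P t)) ∧
      Integrable (fun ω ↦ Real.exp (α * BridgeIntegral.totalPathIntegral v (W x₀) ω)) Q ∧
      Tendsto (fun t ↦ mgf (BridgeIntegral.pathIntegral v (X t) t) (P t) α) atTop
        (𝓝 (mgf (BridgeIntegral.totalPathIntegral v (W x₀)) Q α))) := by
  obtain ⟨K, hK⟩ := hv_bdd
  obtain ⟨C, hC⟩ := hy_bdd
  obtain ⟨R, hR'⟩ := hv_supp.exists_norm_le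
  have hR : ∀ z, v z ≠ 0 → ‖z‖ ≤ R := fun z hz ↦ hR' z hz
  have hY : ∀ t, ∃ Y : ℝ → Ω t → EuclideanSpace ℝ (Fin d), Measurable (Function.uncurry Y) ∧
      (0 < t → IsProbabilityMeasure (P t) ∧
        (∀ᵐ ω ∂P t, ∀ s ∈ Set.Icc (0 : ℝ) t, Y s ω = X t s.toNNReal ω) ∧
        BridgeIntegral.HasBridgeMoments Y (P t) (x t) (y t) t) := by
    intro t
    rcases eq_or_ne t 0 with rfl | ht
    -- No bridge is given at `t = 0`, so any measurable process fills the slot.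
    · exact ⟨fun _ _ ↦ 0, measurable_const, fun h ↦ absurd h (lt_irrefl _)⟩
    · have ht' : 0 < t := pos_iff_ne_zero.2 ht
      obtain ⟨h1, Y, h2, h3, h4⟩ := BridgeIntegral.IsBrownianBridge.exists_version ht' (hX t ht')
      exact ⟨Y, h2, fun _ ↦ ⟨h1, h3, h4⟩⟩
  choose Y hYm hYt using hY
  obtain ⟨hQ, B, hBm, hBe, hB⟩ := (hW x₀).exists_version
  have h : BridgeIntegral.BridgeAsymptotics P Y x y Q B x₀ v C K R :=
    { three_le := hd
      prob := fun t ht ↦ (hYt t ht).1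
      measurable_bridge := hYm
      bridge := fun t ht ↦ (hYt t ht).2.2
      prob_motion := hQ
      measurable_motion := hBm
      motion := hB
      start := hx
      finish := hy
      finish_sq := hC
      measurable := hv
      bound := hK
      supp := hR }
  have hZ : ∀ t, 0 < t → BridgeIntegral.pathIntegral v (X t) t =ᵐ[P t]
      fun ω ↦ ∫ s in (0 : ℝ)..t, v (Y t s ω) := fun t ht ↦
    BridgeIntegral.pathIntegral_ae_eq (hYt t ht).2.1 v
  have hT := BridgeIntegral.totalPathIntegral_ae_eq hBe v
  have hTabs := BridgeIntegral.totalPathIntegral_ae_eq hBe fun z ↦ |v z|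
  -- For fixed `t` the path integral is bounded by `K * t`, so no condition on `α` is needed.
  have hexp : ∀ α : ℝ, ∀ t, 0 < t →
      Integrable (fun ω ↦ Real.exp (α * BridgeIntegral.pathIntegral v (X t) t ω)) (P t) := by
    intro α t ht
    have := h.prob t ht
    refine (BridgeIntegral.integrable_exp_of_abs
      (BridgeIntegral.measurable_intervalIntegral (hYm t) hv 0 t).aemeasurable le_rfl
      (BridgeIntegral.integrable_exp_abs_window (hYm t) hv hK t.2 (abs_nonneg α)).1).congr ?_
    filter_upwards [hZ t ht] with ω hω
    rw [hω]
  have hmgf : ∀ α : ℝ,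
      Integrable (fun ω ↦ Real.exp (α * ∫ s in Set.Ioi (0 : ℝ), v (B s ω))) Q ∧
        Tendsto (fun t : ℝ≥0 ↦ ∫ ω, Real.exp (α * ∫ s in (0 : ℝ)..t, v (Y t s ω)) ∂P t) atTop
          (𝓝 (∫ ω, Real.exp (α * ∫ s in Set.Ioi (0 : ℝ), v (B s ω)) ∂Q)) →
      (∀ t, 0 < t →
        Integrable (fun ω ↦ Real.exp (α * BridgeIntegral.pathIntegral v (X t) t ω)) (P t)) ∧
      Integrable (fun ω ↦ Real.exp (α * BridgeIntegral.totalPathIntegral v (W x₀) ω)) Q ∧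
      Tendsto (fun t ↦ mgf (BridgeIntegral.pathIntegral v (X t) t) (P t) α) atTop
        (𝓝 (mgf (BridgeIntegral.totalPathIntegral v (W x₀)) Q α)) := by
    rintro α ⟨h1, h2⟩
    have e : (fun ω ↦ Real.exp (α * ∫ s in Set.Ioi (0 : ℝ), v (B s ω))) =ᵐ[Q]
        fun ω ↦ Real.exp (α * BridgeIntegral.totalPathIntegral v (W x₀) ω) := by
      filter_upwards [hT] with ω hω
      rw [hω]
    refine ⟨hexp α, h1.congr e, ?_⟩
    rw [mgf, ← integral_congr_ae e]
    refine h2.congr' ?_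
    filter_upwards [eventually_gt_atTop 0] with t ht
    refine integral_congr_ae ?_
    filter_upwards [hZ t ht] with ω hω
    rw [hω]
  have habs : ∀ α₀ : ℝ, BridgeIntegral.AbsExpFinite v W Q α₀ → ∀ α : ℝ, |α| < α₀ →
      Integrable (fun ω ↦ Real.exp (α * ∫ s in Set.Ioi (0 : ℝ), v (B s ω))) Q ∧
        Tendsto (fun t : ℝ≥0 ↦ ∫ ω, Real.exp (α * ∫ s in (0 : ℝ)..t, v (Y t s ω)) ∂P t) atTop
          (𝓝 (∫ ω, Real.exp (α * ∫ s in Set.Ioi (0 : ℝ), v (B s ω)) ∂Q)) := by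
    intro α₀ hα₀ α hα
    -- An order strictly between `|α|` and `α₀` supplies the room that `tendsto_exp` needs; only the
    -- start `x₀` is used.
    obtain ⟨β, hβ, hβ'⟩ := exists_between hα
    have hβ0 : 0 < β := (abs_nonneg α).trans_lt hβ
    refine h.tendsto_exp hβ ((hα₀ β (by rwa [abs_of_pos hβ0]) x₀).congr ?_)
    filter_upwards [hTabs] with ω hω
    rw [hω]
  refine ⟨fun z ↦ (hW z).ae_integrableOn hd hv hK hR, fun k ↦ ⟨fun t ht ↦ ?_, ?_, ?_⟩,
    BridgeIntegral.exists_pos_absExpFinite hW hd hv hK hR,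
    fun α₀ hα₀ α hα ↦ hmgf α (habs α₀ hα₀ α hα), fun h0 α₁ hα₁ α hα ↦ hmgf α ?_⟩
  · have := h.prob t ht
    refine (BridgeIntegral.integrable_pow_of_exp
      (BridgeIntegral.measurable_intervalIntegral (hYm t) hv 0 t).aemeasurable one_pos
      (BridgeIntegral.integrable_exp_abs_window (hYm t) hv hK t.2 zero_le_one).1 k).congr ?_
    filter_upwards [hZ t ht] with ω hω
    rw [hω]
  · obtain ⟨β, hβ, hu⟩ := BridgeIntegral.exists_pos_tsum_greenPow_ne_top hd hv hK hR
    refine (BridgeIntegral.integrable_pow_of_exp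
      (BridgeIntegral.measurable_total hBm hv).aemeasurable hβ
      (hB.integrable_exp_abs_total hBm hd hv hK hR hβ.le (hu x₀)) k).congr ?_
    filter_upwards [hT] with ω hω
    rw [hω]
  · have e : ∫ ω, (∫ s in Set.Ioi (0 : ℝ), v (B s ω)) ^ k ∂Q
        = moment (BridgeIntegral.totalPathIntegral v (W x₀)) k Q := by
      refine integral_congr_ae ?_
      filter_upwards [hT] with ω hω
      simp only [Pi.pow_apply, hω]
    rw [← e]
    refine (h.tendsto_moment k).congr' ?_
    filter_upwards [eventually_gt_atTop 0] with t ht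
    refine integral_congr_ae ?_
    filter_upwards [hZ t ht] with ω hω
    simp only [Pi.pow_apply, hω]
  -- For `α > 0` the two-sided result applies; for `α ≤ 0`, where `|α|` may exceed `α₁`, boundedness
  -- of the exponential replaces it.
  · rcases lt_or_ge 0 α with hα0 | hα0
    · exact habs α₁ (BridgeIntegral.ExpFiniteBelow.absExpFinite h0 hα₁) α (by rwa [abs_of_pos hα0])
    · refine ⟨(hα₁ α hα x₀).congr ?_, h.tendsto_exp_of_nonpos h0 hα0⟩
      filter_upwards [hT] with ω hω
      rw [hω]
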